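/- Let $n\ge 2$, let $G=\mathrm{SL}(n,\mathbb{R})$, and let $\mathsf{C}$ be a compact connected oriented smooth 1-manifold. Let $S^{n-1}=(\mathbb{R}^n\setminus\{0\})/\mathbb{R}_{>0}$, and let $\mathrm{Fl}^+(\mathbb{R}^n)$ be the manifold of oriented flags, i.e. of increasing sequences of oriented subspaces $E_i\subset\mathbb{R}^n$ with $\dim E_i=i$ (with the standard orientation for $i=0,n$), with the projection $\mathrm{Fl}^+(\mathbb{R}^n)\to S^{n-1}$ taking a flag to the oriented line $E_1$. Let $Q\to\mathsf{C}$ be a smooth principal $G$-bundle with a smooth $G$-equivariant map $\tau\colon Q\to S^{n-1}$ (that is, $\tau(q\cdot g)=g^{-1}\cdot\tau(q)$) and a smooth $G$-equivariant lift $\widehat\tau\colon Q\to \mathrm{Fl}^+(\mathbb{R}^n)$ of $\tau$. Let $\mathcal{A}(Q)$ be the affine space of principal connections on $Q$, modelled on the space $\Omega^1(\mathsf{C},Q\times_G\mathfrak{g})$ of 1-forms with values in the adjoint bundle, with the action $u\cdot\theta=(u^{-1})^*\theta$ of the gauge group. A connection $\theta\in\mathcal{A}(Q)$ is called $\widehat\tau$-positive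 if 1. $\tau$ restricts to nondegenerate curves on the horizontal leaves of $\theta$: for every $\theta$-horizontal local section $s$ of $Q$, every local lift $\tilde\gamma$ of $\gamma=\tau\circ s$ to $\mathbb{R}^n\setminus\{0\}$, and every oriented local coordinate on $\mathsf{C}$, the vectors $\tilde\gamma,\tilde\gamma',\dots,\tilde\gamma^{(n-1)}$ form an oriented basis of $\mathbb{R}^n$ at every point; and 2. the $G$-equivariant lift $\widehat\tau_\theta\colon Q\to\mathrm{Fl}^+(\mathbb{R}^n)$ of $\tau$ whose value at $s(t)$ is the oriented flag spanned by $\tilde\gamma(t),\tilde\gamma'(t),\dots,\tilde\gamma^{(n-1)}(t)$ is homotopic to $\widehat\tau$ through $G$-equivariant lifts of $\tau$. Let $\mathcal{A}^{\widehat\tau}(Q)\subset\mathcal{A}(Q)$ be the set of $\widehat\tau$-positive connections. Let $\mathrm{Gau}(Q,\tau)$ be the group of gauge transformations $u$ of $Q$ with $\tau\circ u^{-1}=\tau$, let $\mathrm{Gau}_{\mathsf o}(Q,\tau)$ be its identity component, and let $\mathfrak{gau}(Q,\tau)$ be its Lie algebra, i.e. the space of sections of $Q\times_G\mathfrak{g}$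 leaving $\tau$ infinitesimally invariant. Let $\mathrm{ann}(\mathfrak{gau}(Q,\tau))\subset\Omega^1(\mathsf{C},Q\times_G\mathfrak{g})$ be the annihilator of $\mathfrak{gau}(Q,\tau)$ with respect to the pairing $(a,\zeta)\mapsto\int_{\mathsf{C}}\mathrm{tr}(a\,\zeta)$. The (affine) moment map for the action of $\mathrm{Gau}_{\mathsf o}(Q,\tau)$ on $\mathcal{A}(Q)$ is the quotient projection $$\mathcal{A}(Q)\to\mathcal{A}(Q,\tau):=\mathcal{A}(Q)/\mathrm{ann}(\mathfrak{gau}(Q,\tau)),$$ and the action of $\mathrm{Gau}_{\mathsf o}(Q,\tau)$ on $\mathcal{A}(Q)$ descends to $\mathcal{A}(Q,\tau)$. Then the image of $\mathcal{A}^{\widehat\tau}(Q)$ under this projection is a single $\mathrm{Gau}_{\mathsf o}(Q,\tau)$-orbit $\mathcal{O}\subset\mathcal{A}(Q,\tau)$, and the action of $\mathrm{Gau}_{\mathsf o}(Q,\tau)$ on $\mathcal{O}$ is free. -/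

import Mathlib

open scoped Manifold ContDiff Topology
open MulOpposite TopologicalSpace

noncomputable section

/-! ### Matrix-valued functions and one-forms on an oriented one-manifold -/

/-- The real special linear group of size `n`. -/
abbrev SLn (n : ℕ) : Type := Matrix.SpecialLinearGroup (Fin n) ℝ

/-- Real square matrices of size `n`. -/
abbrev Mat (n : ℕ) : Type := Matrix (Fin n) (Fin n) ℝ

/-- A matrix-valued function is smooth on `U` if all its entries are. -/
def MatSmoothOn {n : ℕ} {E : Type*} [NormedAddCommGroup E] [NormedSpace ℝ E]
    {H : Type*} [TopologicalSpace H] (I : ModelWithCorners ℝ E H)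
    {M : Type*} [TopologicalSpace M] [ChartedSpace H M]
    (f : M → Mat n) (U : Set M) : Prop :=
  ∀ i j, ContMDiffOn I 𝓘(ℝ, ℝ) ∞ (fun x => f x i j) U

section MatSmooth

variable {n : ℕ} {E : Type*} [NormedAddCommGroup E] [NormedSpace ℝ E]
  {H : Type*} [TopologicalSpace H] {I : ModelWithCorners ℝ E H}
  {M : Type*} [TopologicalSpace M] [ChartedSpace H M]

theorem MatSmoothOn.congr {f g : M → Mat n} {U : Set M} (hf : MatSmoothOn I f U)
    (h : ∀ x ∈ U, g x = f x) : MatSmoothOn I g U := fun i j =>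
  (hf i j).congr fun x hx => by rw [h x hx]

theorem MatSmoothOn.mono {f : M → Mat n} {U V : Set M} (hf : MatSmoothOn I f U)
    (h : V ⊆ U) : MatSmoothOn I f V := fun i j => (hf i j).mono h

theorem MatSmoothOn.const (A : Mat n) (U : Set M) : MatSmoothOn I (fun _ => A) U :=
  fun _ _ => contMDiffOn_const

theorem MatSmoothOn.mul {f g : M → Mat n} {U : Set M} (hf : MatSmoothOn I f U)
    (hg : MatSmoothOn I g U) : MatSmoothOn I (fun x => f x * g x) U := fun i j => by
  simp only [Matrix.mul_apply]
  exact contMDiffOn_finsetSum fun k _ => (hf i k).mul (hg k j)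

theorem MatSmoothOn.det {f : M → Mat n} {U : Set M} (hf : MatSmoothOn I f U) :
    ContMDiffOn I 𝓘(ℝ, ℝ) ∞ (fun x => (f x).det) U := by
  simp only [Matrix.det_apply']
  exact contMDiffOn_finsetSum fun σ _ =>
    contMDiffOn_const.mul (contMDiffOn_finsetProd fun i _ => hf (σ i) i)

theorem MatSmoothOn.adjugate {f : M → Mat n} {U : Set M} (hf : MatSmoothOn I f U) :
    MatSmoothOn I (fun x => (f x).adjugate) U := fun i j => by
  simp only [Matrix.adjugate_apply]
  refine MatSmoothOn.det (I := I) (f := fun x => (f x).updateRow j (Pi.single i 1)) ?_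
  intro k l
  by_cases hk : k = j
  · subst hk
    simp only [Matrix.updateRow_self]
    exact contMDiffOn_const
  · simp only [Matrix.updateRow_ne hk]
    exact hf k l

theorem MatSmoothOn.inv {f : M → SLn n} {U : Set M}
    (hf : MatSmoothOn I (fun x => (f x : Mat n)) U) :
    MatSmoothOn I (fun x => ((f x)⁻¹ : SLn n).1) U := by
  simpa only [Matrix.SpecialLinearGroup.coe_inv] using hf.adjugate

end MatSmooth

/-- The chosen atlas of a one-dimensional manifold is oriented: all changes of coordinates are
strictly increasing. The charts of the atlas are the oriented local coordinates. -/
class OrientedAtlas (C : Type*) [TopologicalSpace C] [ChartedSpace ℝ C] : Prop where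
  deriv_pos : ∀ e ∈ atlas ℝ C, ∀ e' ∈ atlas ℝ C, ∀ t ∈ (e.symm.trans e').source,
    0 < deriv (fun s => e' (e.symm s)) t

/-- One-forms (not necessarily smooth) on a one-manifold, with values in a vector space. -/
abbrev OneForm (C : Type*) [TopologicalSpace C] [ChartedSpace ℝ C]
    (V : Type*) [AddCommGroup V] [Module ℝ V] : Type _ :=
  ∀ x : C, TangentSpace 𝓘(ℝ, ℝ) x →ₗ[ℝ] V

section Forms

variable {C : Type*} [TopologicalSpace C] [ChartedSpace ℝ C]

/-- The coefficient `f` in the expression `f(t) dt` of a one-form in the coordinate `e`. -/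
def formCoeff {V : Type*} [AddCommGroup V] [Module ℝ V]
    (e : OpenPartialHomeomorph C ℝ) (α : OneForm C V) (t : ℝ) : V :=
  α (e.symm t) (mfderiv 𝓘(ℝ, ℝ) 𝓘(ℝ, ℝ) e.symm t (1 : ℝ))

/-- A matrix-valued one-form is smooth on `U` if its coefficients in all charts are smooth. -/
def FormSmoothOn {n : ℕ} (α : OneForm C (Mat n)) (U : Set C) : Prop :=
  ∀ e ∈ atlas ℝ C, ∀ i j,
    ContDiffOn ℝ ∞ (fun t => formCoeff e α t i j) (e.target ∩ e.symm ⁻¹' U)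

/-- The differential of a matrix-valued function, entry by entry. -/
def matDeriv {n : ℕ} (f : C → Mat n) (x : C) (v : TangentSpace 𝓘(ℝ, ℝ) x) : Mat n :=
  Matrix.of fun i j => (mfderiv 𝓘(ℝ, ℝ) 𝓘(ℝ, ℝ) (fun y => f y i j) x v : ℝ)

variable [IsManifold 𝓘(ℝ, ℝ) ∞ C] [T2Space C] [CompactSpace C]

variable (C) in
/-- A smooth partition of unity subordinate to the domains of the preferred charts. -/
def chartPartition : SmoothPartitionOfUnity C 𝓘(ℝ, ℝ) C Set.univ :=
  (SmoothPartitionOfUnity.exists_isSubordinate_chartAt_source 𝓘(ℝ, ℝ) C).choose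

variable (C) in
theorem chartPartition_subordinate :
    (chartPartition C).IsSubordinate fun x => (chartAt ℝ x).source :=
  (SmoothPartitionOfUnity.exists_isSubordinate_chartAt_source 𝓘(ℝ, ℝ) C).choose_spec

/-- The integral of a one-form over a compact oriented one-manifold: cut the form into pieces
supported in oriented charts by a partition of unity, and add the integrals of the pieces. -/
def formIntegral (β : OneForm C ℝ) : ℝ :=
  ∑ᶠ c : C, ∫ t in (chartAt ℝ c).target,
    chartPartition C c ((chartAt ℝ c).symm t) * formCoeff (chartAt ℝ c) β t

/-- A real one-form is continuous if its coefficients in all charts are. -/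
def FormContinuous (β : OneForm C ℝ) : Prop :=
  ∀ e ∈ atlas ℝ C, ContinuousOn (formCoeff e β) e.target

theorem formIntegral_add {β γ : OneForm C ℝ} (hβ : FormContinuous β) (hγ : FormContinuous γ) :
    formIntegral (fun x => β x + γ x) = formIntegral β + formIntegral γ := by
  have hfin : {c : C | (Function.support (chartPartition C c)).Nonempty}.Finite :=
    (chartPartition C).locallyFinite.finite_nonempty_of_compact
  have hsupp : ∀ δ : OneForm C ℝ, (Function.support fun c : C =>
      ∫ t in (chartAt ℝ c).target,
        chartPartition C c ((chartAt ℝ c).symm t) * formCoeff (chartAt ℝ c) δ t).Finite := by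
    intro δ
    refine hfin.subset fun c hc => ?_
    by_contra hne
    apply hc
    have hz : ∀ x, chartPartition C c x = 0 := by
      intro x
      by_contra hx
      exact hne ⟨x, hx⟩
    simp [hz]
  have hint : ∀ δ : OneForm C ℝ, FormContinuous δ → ∀ c : C,
      MeasureTheory.IntegrableOn (fun t => chartPartition C c ((chartAt ℝ c).symm t) *
        formCoeff (chartAt ℝ c) δ t) (chartAt ℝ c).target := by
    intro δ hδ c
    set e := chartAt ℝ c with he
    have hsub : tsupport (chartPartition C c) ⊆ e.source := chartPartition_subordinate C c
    have hK : IsCompact (e '' tsupport (chartPartition C c)) :=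
      ((isClosed_tsupport _).isCompact).image_of_continuousOn (e.continuousOn.mono hsub)
    have hKt : e '' tsupport (chartPartition C c) ⊆ e.target := by
      rintro _ ⟨x, hx, rfl⟩
      exact e.map_source (hsub hx)
    have hcont : ContinuousOn (fun t => chartPartition C c (e.symm t) * formCoeff e δ t)
        e.target :=
      ((chartPartition C c).contMDiff.continuous.comp_continuousOn e.continuousOn_symm).mul
        (hδ e (chart_mem_atlas ℝ c))
    refine ((hcont.mono hKt).integrableOn_compact hK).of_forall_sdiff_eq_zero
      e.open_target.measurableSet ?_
    rintro t ⟨ht, htK⟩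
    have : chartPartition C c (e.symm t) = 0 := by
      by_contra hne
      exact htK ⟨e.symm t, subset_tsupport _ hne, e.right_inv ht⟩
    simp [this]
  unfold formIntegral
  rw [← finsum_add_distrib (hsupp β) (hsupp γ)]
  refine finsum_congr fun c => ?_
  rw [← MeasureTheory.integral_add (hint β hβ c) (hint γ hγ c)]
  refine MeasureTheory.integral_congr_ae (Filter.Eventually.of_forall fun t => ?_)
  simp only [formCoeff, LinearMap.add_apply, mul_add]

theorem formIntegral_neg (β : OneForm C ℝ) :
    formIntegral (fun x => -β x) = -formIntegral β := by
  unfold formIntegral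
  rw [← finsum_neg_distrib]
  refine finsum_congr fun c => ?_
  rw [← MeasureTheory.integral_neg]
  refine MeasureTheory.integral_congr_ae (Filter.Eventually.of_forall fun t => ?_)
  simp only [formCoeff, LinearMap.neg_apply, mul_neg]

end Forms

/-! ### The sphere of rays and the manifold of oriented flags -/

/-- The sphere, as the quotient of the nonzero vectors by positive scalars. -/
abbrev RaySphere (n : ℕ) : Type := Module.Ray ℝ (Fin n → ℝ)

/-- The action of the special linear group on rays. -/
def actRay {n : ℕ} (g : SLn n) : RaySphere n → RaySphere n :=
  Module.Ray.map (Matrix.SpecialLinearGroup.toLin' g)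

/-- Oriented bases of `ℝⁿ`, as the columns of matrices of positive determinant. -/
abbrev OrientedBasis (n : ℕ) : Type := {A : Mat n // 0 < A.det}

/-- Upper triangular with positive diagonal entries. -/
def IsPosUpper {n : ℕ} (b : Mat n) : Prop :=
  (∀ i j, j < i → b i j = 0) ∧ ∀ i, 0 < b i i

theorem IsPosUpper.blockTriangular {n : ℕ} {b : Mat n} (hb : IsPosUpper b) :
    b.BlockTriangular id := fun i j h => hb.1 i j h

theorem IsPosUpper.one (n : ℕ) : IsPosUpper (1 : Mat n) :=
  ⟨fun i j h => Matrix.one_apply_ne (ne_of_gt h), fun i => by simp⟩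

theorem IsPosUpper.diag_mul {n : ℕ} {b c : Mat n} (hb : b.BlockTriangular id)
    (hc : c.BlockTriangular id) (i : Fin n) : (b * c) i i = b i i * c i i := by
  rw [Matrix.mul_apply, Finset.sum_eq_single i]
  · intro k _ hk
    rcases lt_or_gt_of_ne hk with h | h
    · rw [hb (show id k < id i from h), zero_mul]
    · rw [hc (show id i < id k from h), mul_zero]
  · simp

theorem IsPosUpper.mul {n : ℕ} {b c : Mat n} (hb : IsPosUpper b) (hc : IsPosUpper c) :
    IsPosUpper (b * c) :=
  ⟨fun _ _ h => (hb.blockTriangular.mul hc.blockTriangular) h, fun i => by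
    rw [IsPosUpper.diag_mul hb.blockTriangular hc.blockTriangular]
    exact mul_pos (hb.2 i) (hc.2 i)⟩

theorem IsPosUpper.det_pos {n : ℕ} {b : Mat n} (hb : IsPosUpper b) : 0 < b.det := by
  rw [Matrix.det_of_isUpperTriangular hb.blockTriangular]
  exact Finset.prod_pos fun i _ => hb.2 i

theorem IsPosUpper.inv {n : ℕ} {b : Mat n} (hb : IsPosUpper b) : IsPosUpper b⁻¹ := by
  have hu : IsUnit b.det := hb.det_pos.ne'.isUnit
  have : Invertible b := Matrix.invertibleOfIsUnitDet b hu
  have ht : (b⁻¹).BlockTriangular id := Matrix.blockTriangular_inv_of_blockTriangular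
    hb.blockTriangular
  refine ⟨fun _ _ h => ht h, fun i => ?_⟩
  have h1 : b i i * b⁻¹ i i = 1 := by
    rw [← IsPosUpper.diag_mul hb.blockTriangular ht, Matrix.mul_nonsing_inv _ hu,
      Matrix.one_apply_eq]
  have := hb.2 i
  by_contra hneg
  nlinarith [mul_nonneg this.le (le_of_not_gt hneg |> neg_nonneg.mpr)]

/-- Two oriented bases define the same oriented flag if, for every `i`, their first `i` vectors
span the same subspace with the same orientation; that is, if the base change matrix is upper
triangular with positive diagonal. -/
instance flagSetoid (n : ℕ) : Setoid (OrientedBasis n) where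
  r A A' := ∃ b : Mat n, IsPosUpper b ∧ A'.1 = A.1 * b
  iseqv :=
    { refl := fun A => ⟨1, IsPosUpper.one n, by simp⟩
      symm := by
        rintro A A' ⟨b, hb, h⟩
        refine ⟨b⁻¹, hb.inv, ?_⟩
        rw [h, Matrix.mul_assoc, Matrix.mul_nonsing_inv _ hb.det_pos.ne'.isUnit, Matrix.mul_one]
      trans := by
        rintro A A' A'' ⟨b, hb, h⟩ ⟨b', hb', h'⟩
        exact ⟨b * b', hb.mul hb', by rw [h', h, Matrix.mul_assoc]⟩ }

/-- The oriented flags in `ℝⁿ`: increasing sequences of oriented subspaces, one in every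
dimension, the last one being `ℝⁿ` with its standard orientation. A flag is given by the oriented
bases adapted to it. -/
def OrientedFlag (n : ℕ) : Type := Quotient (flagSetoid n)

/-- The oriented flag generated by the columns of a matrix with positive determinant. -/
def flagOf {n : ℕ} (A : Mat n) (hA : 0 < A.det) : OrientedFlag n :=
  Quotient.mk (flagSetoid n) ⟨A, hA⟩

/-- The action of the special linear group on oriented flags. -/
def actFlag {n : ℕ} (g : SLn n) : OrientedFlag n → OrientedFlag n :=
  Quotient.map (fun A : OrientedBasis n => (⟨g.1 * A.1, by
      rw [Matrix.det_mul, g.2, one_mul]; exact A.2⟩ : OrientedBasis n)) (by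
    rintro A A' ⟨b, hb, h⟩
    exact ⟨b, hb, by simp only [h, Matrix.mul_assoc]⟩)

theorem firstColumn_ne_zero {n : ℕ} [NeZero n] (A : OrientedBasis n) : A.1.col 0 ≠ 0 := by
  intro h
  exact A.2.ne' (Matrix.det_eq_zero_of_column_eq_zero 0 fun i => congrFun h i)

/-- The projection from oriented flags to the sphere: the first, oriented, line of the flag. -/
def flagRay {n : ℕ} [NeZero n] : OrientedFlag n → RaySphere n :=
  Quotient.lift (fun A => rayOfNeZero ℝ (A.1.col 0) (firstColumn_ne_zero A)) (by
    rintro A A' ⟨b, hb, h⟩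
    have hcol : A'.1.col 0 = b 0 0 • A.1.col 0 := by
      funext i
      simp only [Matrix.col_apply, Pi.smul_apply, smul_eq_mul]
      rw [h, Matrix.mul_apply, Finset.sum_eq_single 0]
      · exact mul_comm _ _
      · intro k _ hk
        rw [hb.1 k 0 (Fin.pos_iff_ne_zero.mpr hk), mul_zero]
      · simp
    refine (ray_eq_iff _ _).mpr ?_
    rw [hcol]
    exact SameRay.sameRay_pos_smul_right _ (hb.2 0))

/-! ### Principal bundles, sections, connections -/

section Bundle

variable (n : ℕ) (C Q : Type*) [TopologicalSpace C] [ChartedSpace ℝ C] [MulAction (SLn n)ᵐᵒᵖ Q]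

/-- The group element relating two points of the same orbit: `q · (groupDiff q q') = q'`. -/
def groupDiff {n : ℕ} {Q : Type*} [MulAction (SLn n)ᵐᵒᵖ Q] (q q' : Q) : SLn n :=
  open Classical in if h : ∃ g : SLn n, op g • q = q' then h.choose else 1

/-- A smooth principal bundle over `C` with structure group `SL(n, ℝ)`, the right action on the
total space `Q` being written `op g • q`. The fibres are the orbits of the action, which is free,
and the smooth structure is given by a bundle atlas: local sections (equivalently local
trivializations `(x, g) ↦ s(x) · g`) whose domains cover `C` and whose transition functions are
smooth. -/
structure PrincipalSLBundle where
  proj : Q → C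
  proj_smul : ∀ (g : SLn n) (q : Q), proj (op g • q) = proj q
  existsUnique_smul : ∀ q q' : Q, proj q = proj q' → ∃! g : SLn n, op g • q = q'
  frames : Set (Opens C × (C → Q))
  frames_section : ∀ f ∈ frames, ∀ x ∈ f.1, proj (f.2 x) = x
  frames_cover : ∀ x : C, ∃ f ∈ frames, x ∈ f.1
  frames_smooth : ∀ f ∈ frames, ∀ f' ∈ frames,
    MatSmoothOn 𝓘(ℝ, ℝ) (fun x => (groupDiff (f.2 x) (f'.2 x) : SLn n).1)
      ((f.1 : Set C) ∩ f'.1)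

variable {n C Q}

namespace PrincipalSLBundle

variable (P : PrincipalSLBundle n C Q)

theorem groupDiff_eq (P : PrincipalSLBundle n C Q) {q q' : Q} {g : SLn n} (h : op g • q = q') : (groupDiff q q' : SLn n) = g := by
  have hex : ∃ g : SLn n, op g • q = q' := ⟨g, h⟩
  have h1 : op (groupDiff q q' : SLn n) • q = q' := by
    unfold groupDiff
    rw [dif_pos hex]
    exact hex.choose_spec
  refine (P.existsUnique_smul q q' ?_).unique h1 h
  rw [← h, P.proj_smul]

theorem groupDiff_smul {q q' : Q} (h : P.proj q = P.proj q') :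
    op (groupDiff q q' : SLn n) • q = q' := by
  obtain ⟨g, hg, -⟩ := P.existsUnique_smul q q' h
  rw [P.groupDiff_eq hg, hg]

theorem groupDiff_inv_smul {q q' : Q} (h : P.proj q = P.proj q') :
    op (groupDiff q q' : SLn n)⁻¹ • q' = q := by
  rw [op_inv, inv_smul_eq_iff, P.groupDiff_smul h]

/-- A smooth local section of the bundle. Values of `toFun` outside `dom` are irrelevant. -/
structure LocalSection where
  dom : Opens C
  toFun : C → Q
  proj_toFun : ∀ x ∈ dom, P.proj (toFun x) = x
  smooth : ∀ f ∈ P.frames,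
    MatSmoothOn 𝓘(ℝ, ℝ) (fun x => (groupDiff (f.2 x) (toFun x) : SLn n).1)
      ((f.1 : Set C) ∩ dom)

theorem exists_section (x : C) : ∃ σ : P.LocalSection, x ∈ σ.dom := by
  obtain ⟨f, hf, hx⟩ := P.frames_cover x
  exact ⟨⟨f.1, f.2, P.frames_section f hf, fun f' hf' => P.frames_smooth f' hf' f hf⟩, hx⟩

/-- A principal connection `θ` on `Q`, given by its gauge potentials: `form σ` is the pull-back
`σ^*θ` of the connection one-form under a local section `σ` (extended by zero outside the domain
of `σ`). These are smooth one-forms with values in trace-free matrices, related by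
`(σ · g)^*θ = g⁻¹ (σ^*θ) g + g⁻¹ dg`. -/
@[ext]
structure Connection where
  form : P.LocalSection → OneForm C (Mat n)
  form_outside : ∀ σ x, x ∉ σ.dom → form σ x = 0
  trace_form : ∀ σ x v, (form σ x v).trace = 0
  smooth : ∀ σ, FormSmoothOn (form σ) σ.dom
  change : ∀ (σ σ' : P.LocalSection) (x : C), x ∈ σ.dom → x ∈ σ'.dom → ∀ v,
    form σ' x v =
      ((groupDiff (σ.toFun x) (σ'.toFun x) : SLn n)⁻¹).1 * form σ x v
          * (groupDiff (σ.toFun x) (σ'.toFun x) : SLn n).1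
        + ((groupDiff (σ.toFun x) (σ'.toFun x) : SLn n)⁻¹).1
          * matDeriv (fun y => (groupDiff (σ.toFun y) (σ'.toFun y) : SLn n).1) x v

/-- Smooth one-forms on `C` with values in the adjoint bundle `Q ×_G 𝔤`, again given by their
expressions in local sections. This is the space of translations of the affine space of
connections. -/
@[ext]
structure AdForm where
  form : P.LocalSection → OneForm C (Mat n)
  form_outside : ∀ σ x, x ∉ σ.dom → form σ x = 0
  trace_form : ∀ σ x v, (form σ x v).trace = 0
  smooth : ∀ σ, FormSmoothOn (form σ) σ.dom
  change : ∀ (σ σ' : P.LocalSection) (x : C), x ∈ σ.dom → x ∈ σ'.dom → ∀ v,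
    form σ' x v =
      ((groupDiff (σ.toFun x) (σ'.toFun x) : SLn n)⁻¹).1 * form σ x v
          * (groupDiff (σ.toFun x) (σ'.toFun x) : SLn n).1

variable {P}

/-- The difference of two connections. -/
def Connection.diff (θ θ' : P.Connection) : P.AdForm where
  form σ x := θ.form σ x - θ'.form σ x
  form_outside σ x hx := by rw [θ.form_outside σ x hx, θ'.form_outside σ x hx, sub_zero]
  trace_form σ x v := by
    rw [LinearMap.sub_apply, Matrix.trace_sub, θ.trace_form, θ'.trace_form, sub_zero]
  smooth σ e he i j := (θ.smooth σ e he i j).sub (θ'.smooth σ e he i j)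
  change σ σ' x hx hx' v := by
    rw [LinearMap.sub_apply, LinearMap.sub_apply, θ.change σ σ' x hx hx' v,
      θ'.change σ σ' x hx hx' v]
    noncomm_ring

variable (P)

/-! ### Equivariant maps to the sphere and to flags -/

/-- A smooth equivariant map `τ` from the total space to the sphere. Smoothness means that along
every local section it is the ray through a smooth nonvanishing vector. -/
structure SphereMap where
  toFun : Q → RaySphere n
  equivariant : ∀ (g : SLn n) (q : Q), toFun (op g • q) = actRay g⁻¹ (toFun q)
  smooth : ∀ σ : P.LocalSection, ∃ w : C → Fin n → ℝ,
    (∀ i, ContMDiffOn 𝓘(ℝ, ℝ) 𝓘(ℝ, ℝ) ∞ (fun x => w x i) σ.dom) ∧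
    ∀ x ∈ σ.dom, ∃ h : w x ≠ 0, toFun (σ.toFun x) = rayOfNeZero ℝ (w x) h

variable {P}

/-- A smooth equivariant lift of `τ` to a map into oriented flags. -/
@[ext]
structure FlagLift [NeZero n] (τ : P.SphereMap) where
  toFun : Q → OrientedFlag n
  equivariant : ∀ (g : SLn n) (q : Q), toFun (op g • q) = actFlag g⁻¹ (toFun q)
  lifts : ∀ q, flagRay (toFun q) = τ.toFun q
  smooth : ∀ σ : P.LocalSection, ∃ A : C → Mat n,
    MatSmoothOn 𝓘(ℝ, ℝ) A σ.dom ∧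
    ∀ x ∈ σ.dom, ∃ h : 0 < (A x).det, toFun (σ.toFun x) = flagOf (A x) h

/-- Smooth homotopy of lifts of `τ`, through equivariant lifts of `τ`. -/
def FlagLift.Homotopic [NeZero n] {τ : P.SphereMap} (f₀ f₁ : FlagLift τ) : Prop :=
  ∃ F : ℝ → FlagLift τ, F 0 = f₀ ∧ F 1 = f₁ ∧
    ∀ σ : P.LocalSection, ∃ A : ℝ × C → Mat n,
      MatSmoothOn (𝓘(ℝ, ℝ).prod 𝓘(ℝ, ℝ)) A (Set.univ ×ˢ (σ.dom : Set C)) ∧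
      ∀ s : ℝ, ∀ x ∈ σ.dom, ∃ h : 0 < (A (s, x)).det,
        (F s).toFun (σ.toFun x) = flagOf (A (s, x)) h

/-! ### Positive connections -/

/-- A local section is horizontal if the connection pulls back to zero. -/
def Connection.IsHorizontal (θ : P.Connection) (σ : P.LocalSection) : Prop :=
  ∀ x ∈ σ.dom, θ.form σ x = 0

/-- `w` is a smooth lift to nonzero vectors, over the domain of `σ`, of the curve `τ ∘ σ`. -/
def SphereMap.IsVectorLift (τ : P.SphereMap) (σ : P.LocalSection) (w : C → Fin n → ℝ) : Prop :=
  (∀ i, ContMDiffOn 𝓘(ℝ, ℝ) 𝓘(ℝ, ℝ) ∞ (fun x => w x i) σ.dom) ∧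
  ∀ x ∈ σ.dom, ∃ h : w x ≠ 0, τ.toFun (σ.toFun x) = rayOfNeZero ℝ (w x) h

/-- The matrix with columns `w, w', …, w⁽ⁿ⁻¹⁾`, derivatives being taken in the coordinate `e`. -/
def wronskian (e : OpenPartialHomeomorph C ℝ) (w : C → Fin n → ℝ) (x : C) : Mat n :=
  Matrix.of fun i k => iteratedDeriv (k : ℕ) (fun t => w (e.symm t) i) (e x)

/-- `τ` restricts to (positive) nondegenerate curves on the horizontal leaves of `θ`. -/
def Connection.IsNondegenerate (θ : P.Connection) (τ : P.SphereMap) : Prop :=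
  ∀ σ : P.LocalSection, θ.IsHorizontal σ → ∀ w, τ.IsVectorLift σ w →
    ∀ e ∈ atlas ℝ C, ∀ x ∈ σ.dom, x ∈ e.source → 0 < (wronskian e w x).det

/-- `f` is the lift of `τ` determined by `θ`: along every horizontal leaf, `f` is the oriented
flag spanned by the successive derivatives of the curve obtained by restricting `τ`. -/
def Connection.IsOsculatingLift [NeZero n] (θ : P.Connection) {τ : P.SphereMap}
    (f : FlagLift τ) : Prop :=
  ∀ σ : P.LocalSection, θ.IsHorizontal σ → ∀ w, τ.IsVectorLift σ w →
    ∀ e ∈ atlas ℝ C, ∀ x ∈ σ.dom, x ∈ e.source →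
      ∃ h : 0 < (wronskian e w x).det, f.toFun (σ.toFun x) = flagOf (wronskian e w x) h

/-- Positivity of a connection with respect to a given lift of `τ`: nondegeneracy, and the lift
determined by the connection is homotopic to the given one. -/
def Connection.IsPositive [NeZero n] (θ : P.Connection) {τ : P.SphereMap} (τhat : FlagLift τ) :
    Prop :=
  θ.IsNondegenerate τ ∧ ∃ f : FlagLift τ, θ.IsOsculatingLift f ∧ τhat.Homotopic f

/-! ### Gauge transformations -/

variable (P)

/-- The gauge group: smooth equivariant bijections of the total space covering the identity. -/
def Gau : Subgroup (Equiv.Perm Q) where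
  carrier := {u | (∀ q, P.proj (u q) = P.proj q) ∧
    (∀ (g : SLn n) (q : Q), u (op g • q) = op g • u q) ∧
    ∀ σ : P.LocalSection,
      MatSmoothOn 𝓘(ℝ, ℝ) (fun x => (groupDiff (σ.toFun x) (u (σ.toFun x)) : SLn n).1) σ.dom}
  one_mem' := by
    refine ⟨fun _ => rfl, fun _ _ => rfl, fun σ => ?_⟩
    refine (MatSmoothOn.const 1 _).congr fun x _ => ?_
    rw [P.groupDiff_eq (g := 1) (by simp)]
    rfl
  mul_mem' := by
    rintro u v ⟨hu1, hu2, hu3⟩ ⟨hv1, hv2, hv3⟩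
    refine ⟨fun q => by simp [hu1, hv1], fun g q => by simp [hu2, hv2], fun σ => ?_⟩
    refine ((hu3 σ).mul (hv3 σ)).congr fun x _ => ?_
    rw [← Matrix.SpecialLinearGroup.coe_mul]
    congr 1
    refine P.groupDiff_eq ?_
    rw [op_mul, mul_smul, P.groupDiff_smul (hu1 _).symm, ← hu2, P.groupDiff_smul (hv1 _).symm]
    rfl
  inv_mem' := by
    rintro u ⟨hu1, hu2, hu3⟩
    have h1 : ∀ q, P.proj (u⁻¹ q) = P.proj q := fun q => by
      rw [← hu1 (u⁻¹ q)]
      exact congrArg P.proj (Equiv.apply_symm_apply u q)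
    have h2 : ∀ (g : SLn n) (q : Q), u⁻¹ (op g • q) = op g • u⁻¹ q := fun g q => by
      rw [Equiv.Perm.inv_eq_iff_eq, hu2]
      exact congrArg (op g • ·) (Equiv.apply_symm_apply u q).symm
    refine ⟨h1, h2, fun σ => ?_⟩
    refine (hu3 σ).inv.congr fun x _ => ?_
    congr 1
    refine P.groupDiff_eq ?_
    rw [eq_comm, Equiv.Perm.inv_eq_iff_eq, hu2, eq_comm]
    exact P.groupDiff_inv_smul (hu1 (σ.toFun x)).symm

variable {P}

theorem Gau.groupDiff_map (u : P.Gau) (q q' : Q) :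
    (groupDiff (u.1 q) (u.1 q') : SLn n) = groupDiff q q' := by
  by_cases h : ∃ g : SLn n, op g • q = q'
  · obtain ⟨g, hg⟩ := h
    rw [P.groupDiff_eq hg]
    exact P.groupDiff_eq (by rw [← u.2.2.1, hg])
  · have h' : ¬ ∃ g : SLn n, op g • u.1 q = u.1 q' := by
      rintro ⟨g, hg⟩
      exact h ⟨g, u.1.injective (by rw [u.2.2.1, hg])⟩
    unfold groupDiff
    rw [dif_neg h, dif_neg h']

/-- The image of a local section under a gauge transformation. -/
def LocalSection.map (u : P.Gau) (σ : P.LocalSection) : P.LocalSection where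
  dom := σ.dom
  toFun x := u.1 (σ.toFun x)
  proj_toFun x hx := by rw [u.2.1, σ.proj_toFun x hx]
  smooth f hf := by
    refine ((σ.smooth f hf).mul ((u.2.2.2 σ).mono Set.inter_subset_right)).congr fun x hx => ?_
    rw [← Matrix.SpecialLinearGroup.coe_mul]
    congr 1
    refine P.groupDiff_eq ?_
    rw [op_mul, mul_smul, P.groupDiff_smul, P.groupDiff_smul (u.2.1 _).symm]
    rw [P.frames_section f hf x hx.1, σ.proj_toFun x hx.2]

/-- The action of gauge transformations on connections, `u · θ = (u⁻¹)^*θ`; the gauge potential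
of `u · θ` for `σ` is that of `θ` for `u⁻¹ ∘ σ`. -/
instance : MulAction P.Gau P.Connection where
  smul u θ :=
    { form := fun σ => θ.form (σ.map u⁻¹)
      form_outside := fun σ x hx => θ.form_outside (σ.map u⁻¹) x hx
      trace_form := fun σ x v => θ.trace_form (σ.map u⁻¹) x v
      smooth := fun σ => θ.smooth (σ.map u⁻¹)
      change := fun σ σ' x hx hx' v => by
        have h := θ.change (σ.map u⁻¹) (σ'.map u⁻¹) x hx hx' v
        simpa only [LocalSection.map, Gau.groupDiff_map] using h }
  one_smul θ := by
    refine Connection.ext (funext fun σ => ?_)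
    change θ.form (σ.map 1⁻¹) = θ.form σ
    rw [inv_one]
    rfl
  mul_smul u v θ := by
    refine Connection.ext (funext fun σ => ?_)
    change θ.form (σ.map (u * v)⁻¹) = θ.form ((σ.map u⁻¹).map v⁻¹)
    rw [mul_inv_rev]
    rfl

variable (P)

/-- The gauge transformations that fix `τ`. -/
def GauFix (τ : P.SphereMap) : Subgroup P.Gau where
  carrier := {u | ∀ q, τ.toFun (u.1 q) = τ.toFun q}
  one_mem' := fun _ => rfl
  mul_mem' := by
    intro u v hu hv q
    exact (hu _).trans (hv q)
  inv_mem' := by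
    intro u hu q
    have h := hu ((u⁻¹).1 q)
    rw [← h]
    congr 1
    exact Equiv.apply_symm_apply u.1 q

/-- The identity component of the group of gauge transformations fixing `τ`: those that can be
joined to the identity by a smooth path of gauge transformations fixing `τ`. -/
def GauO (τ : P.SphereMap) : Subgroup (P.GauFix τ) where
  carrier := {u | ∃ U : ℝ → P.GauFix τ, U 0 = 1 ∧ U 1 = u ∧ ∀ σ : P.LocalSection,
    MatSmoothOn (𝓘(ℝ, ℝ).prod 𝓘(ℝ, ℝ))
      (fun p : ℝ × C => (groupDiff (σ.toFun p.2) ((U p.1).1.1 (σ.toFun p.2)) : SLn n).1)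
      (Set.univ ×ˢ (σ.dom : Set C))}
  one_mem' := by
    refine ⟨fun _ => 1, rfl, rfl, fun σ => ?_⟩
    refine (MatSmoothOn.const 1 _).congr fun x _ => ?_
    rw [P.groupDiff_eq (g := 1) (by simp)]
    rfl
  mul_mem' := by
    rintro u v ⟨U, hU0, hU1, hU⟩ ⟨V, hV0, hV1, hV⟩
    refine ⟨fun s => U s * V s, by simp [hU0, hV0], by simp [hU1, hV1], fun σ => ?_⟩
    refine ((hU σ).mul (hV σ)).congr fun p _ => ?_
    rw [← Matrix.SpecialLinearGroup.coe_mul]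
    congr 1
    refine P.groupDiff_eq ?_
    rw [op_mul, mul_smul, P.groupDiff_smul ((U p.1).1.2.1 _).symm, ← (U p.1).1.2.2.1,
      P.groupDiff_smul ((V p.1).1.2.1 _).symm]
    rfl
  inv_mem' := by
    rintro u ⟨U, hU0, hU1, hU⟩
    refine ⟨fun s => (U s)⁻¹, by simp [hU0], by simp [hU1], fun σ => ?_⟩
    refine (hU σ).inv.congr fun p _ => ?_
    congr 1
    refine P.groupDiff_eq ?_
    change _ = ((U p.1).1.1)⁻¹ (σ.toFun p.2)
    rw [eq_comm, Equiv.Perm.inv_eq_iff_eq, (U p.1).1.2.2.1, eq_comm]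
    exact P.groupDiff_inv_smul ((U p.1).1.2.1 (σ.toFun p.2)).symm

variable {P}

/-- The Lie algebra of the group of gauge transformations fixing `τ`: smooth sections of the
adjoint bundle (equivariant maps `ζ` from the total space to trace-free matrices) for which
`τ` is infinitesimally invariant, i.e. `ζ(q)` annihilates the point `τ(q)` of the sphere: it maps
the vectors on this ray to multiples of themselves. -/
structure InfGauFix (τ : P.SphereMap) where
  toFun : Q → Mat n
  trace_toFun : ∀ q, (toFun q).trace = 0
  equivariant : ∀ (g : SLn n) (q : Q), toFun (op g • q) = (g⁻¹).1 * toFun q * g.1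
  smooth : ∀ σ : P.LocalSection, MatSmoothOn 𝓘(ℝ, ℝ) (fun x => toFun (σ.toFun x)) σ.dom
  fixes : ∀ (q : Q) (w : Fin n → ℝ) (h : w ≠ 0), τ.toFun q = rayOfNeZero ℝ w h →
    ∃ c : ℝ, (toFun q).mulVec w = c • w

/-- The adjoint action (of the inverse) on the Lie algebra. -/
def InfGauFix.comp {τ : P.SphereMap} (ζ : InfGauFix τ) (u : P.GauFix τ) : InfGauFix τ where
  toFun q := ζ.toFun (u.1.1 q)
  trace_toFun q := ζ.trace_toFun _
  equivariant g q := by rw [u.1.2.2.1, ζ.equivariant]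
  smooth σ := ζ.smooth (σ.map u.1)
  fixes q w h hq := ζ.fixes _ w h (by rw [u.2 q, hq])

/-! ### The quotient of the space of connections by the annihilator -/

variable (P) in
/-- A local section defined near a given point. -/
def sectionAt (x : C) : P.LocalSection := (P.exists_section x).choose

variable (P) in
theorem mem_sectionAt (x : C) : x ∈ (P.sectionAt x).dom := (P.exists_section x).choose_spec

/-- The real one-form `tr(a ζ)` on `C`. It is evaluated in an arbitrary local section, see
`AdForm.pair_eq`. -/
def AdForm.pair (a : P.AdForm) {τ : P.SphereMap} (ζ : InfGauFix τ) : OneForm C ℝ := fun x =>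
  (Matrix.traceLinearMap (Fin n) ℝ ℝ).comp
    ((LinearMap.mulRight ℝ (ζ.toFun ((P.sectionAt x).toFun x))).comp (a.form (P.sectionAt x) x))

theorem AdForm.pair_eq (a : P.AdForm) {τ : P.SphereMap} (ζ : InfGauFix τ) (σ : P.LocalSection)
    {x : C} (hx : x ∈ σ.dom) (v : TangentSpace 𝓘(ℝ, ℝ) x) :
    a.pair ζ x v = (a.form σ x v * ζ.toFun (σ.toFun x)).trace := by
  have hx' := P.mem_sectionAt x
  change (a.form (P.sectionAt x) x v * ζ.toFun ((P.sectionAt x).toFun x)).trace = _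
  rw [a.change σ (P.sectionAt x) x hx hx' v]
  set g : SLn n := groupDiff (σ.toFun x) ((P.sectionAt x).toFun x) with hg
  have hq : op g • σ.toFun x = (P.sectionAt x).toFun x := P.groupDiff_smul (by
    rw [σ.proj_toFun x hx, (P.sectionAt x).proj_toFun x hx'])
  rw [← hq, ζ.equivariant]
  have h1 : g.1 * (g⁻¹).1 = 1 := by
    rw [← Matrix.SpecialLinearGroup.coe_mul, mul_inv_cancel, Matrix.SpecialLinearGroup.coe_one]
  calc ((g⁻¹).1 * a.form σ x v * g.1 * ((g⁻¹).1 * ζ.toFun (σ.toFun x) * g.1)).trace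
      = ((g⁻¹).1 * (a.form σ x v * (g.1 * (g⁻¹).1) * ζ.toFun (σ.toFun x) * g.1)).trace := by
        simp only [Matrix.mul_assoc]
    _ = (a.form σ x v * ζ.toFun (σ.toFun x) * (g.1 * (g⁻¹).1)).trace := by
        rw [h1, Matrix.mul_one, Matrix.trace_mul_comm, Matrix.mul_assoc, h1]
    _ = _ := by rw [h1, Matrix.mul_one]

theorem AdForm.pair_continuous (a : P.AdForm) {τ : P.SphereMap} (ζ : InfGauFix τ) :
    FormContinuous (a.pair ζ) := by
  intro e he t ht
  have hσ := P.mem_sectionAt (e.symm t)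
  set σ := P.sectionAt (e.symm t)
  have hopen : IsOpen (e.target ∩ e.symm ⁻¹' (σ.dom : Set C)) :=
    e.isOpen_inter_preimage_symm σ.dom.isOpen
  have hmem : t ∈ e.target ∩ e.symm ⁻¹' (σ.dom : Set C) := ⟨ht, hσ⟩
  refine ContinuousAt.continuousWithinAt ?_
  refine ContinuousOn.continuousAt (s := e.target ∩ e.symm ⁻¹' (σ.dom : Set C)) ?_
    (hopen.mem_nhds hmem)
  have hc : ContinuousOn (fun s => ∑ i, ∑ j, formCoeff e (a.form σ) s i j *
      ζ.toFun (σ.toFun (e.symm s)) j i) (e.target ∩ e.symm ⁻¹' (σ.dom : Set C)) := by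
    refine continuousOn_finsetSum _ fun i _ => continuousOn_finsetSum _ fun j _ => ?_
    refine (a.smooth σ e he i j).continuousOn.mul ?_
    exact (ζ.smooth σ j i).continuousOn.comp
      (e.continuousOn_symm.mono Set.inter_subset_left) (fun s hs => hs.2)
  refine hc.congr fun s hs => ?_
  unfold formCoeff
  rw [a.pair_eq ζ σ hs.2]
  simp only [Matrix.trace, Matrix.diag_apply, Matrix.mul_apply]

variable [IsManifold 𝓘(ℝ, ℝ) ∞ C] [T2Space C] [CompactSpace C]

/-- The annihilator of the Lie algebra of infinitesimal gauge transformations fixing `τ`, for the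
pairing `∫_C tr(a ζ)` defined by the trace form. -/
def ann (τ : P.SphereMap) : Set P.AdForm :=
  {a | ∀ ζ : InfGauFix τ, formIntegral (a.pair ζ) = 0}

/-- Two connections are equivalent if their difference lies in the annihilator. -/
def connSetoid (τ : P.SphereMap) : Setoid P.Connection where
  r θ θ' := θ.diff θ' ∈ ann τ
  iseqv :=
    { refl := fun θ ζ => by
        have h : (θ.diff θ).pair ζ = fun x => (0 : TangentSpace 𝓘(ℝ, ℝ) x →ₗ[ℝ] ℝ) := by
          funext x
          refine LinearMap.ext fun v => ?_
          simp [AdForm.pair, Connection.diff]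
        rw [h]
        simp [formIntegral, formCoeff]
      symm := fun {θ θ'} h ζ => by
        have h' : (θ'.diff θ).pair ζ = fun x => -((θ.diff θ').pair ζ x) := by
          funext x
          refine LinearMap.ext fun v => ?_
          simp [AdForm.pair, Connection.diff, sub_mul]
        rw [h', formIntegral_neg, h ζ, neg_zero]
      trans := fun {θ θ' θ''} h h' ζ => by
        have h'' : (θ.diff θ'').pair ζ =
            fun x => (θ.diff θ').pair ζ x + (θ'.diff θ'').pair ζ x := by
          funext x
          refine LinearMap.ext fun v => ?_
          simp [AdForm.pair, Connection.diff, sub_mul]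
        rw [h'', formIntegral_add (AdForm.pair_continuous _ _) (AdForm.pair_continuous _ _),
          h ζ, h' ζ, add_zero] }

/-- The quotient of the space of connections by the annihilator of the Lie algebra of
infinitesimal gauge transformations fixing `τ`. -/
def ReducedConnection (τ : P.SphereMap) : Type _ := Quotient (connSetoid τ)

/-- The (affine) moment map for the gauge transformations fixing `τ`: the quotient projection. -/
def momentMap (τ : P.SphereMap) (θ : P.Connection) : ReducedConnection τ :=
  Quotient.mk (connSetoid τ) θ

/-- The action of the gauge transformations fixing `τ` descends to the quotient. -/
instance (τ : P.SphereMap) : MulAction (P.GauFix τ) (ReducedConnection τ) where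
  smul u := Quotient.map (fun θ => u • θ) (by
    intro θ θ' h ζ
    have h' : ((u • θ).diff (u • θ')).pair ζ = (θ.diff θ').pair (ζ.comp u) := by
      funext x
      refine LinearMap.ext fun v => ?_
      have hx := P.mem_sectionAt x
      rw [AdForm.pair_eq _ _ _ hx, AdForm.pair_eq _ _ ((P.sectionAt x).map u.1⁻¹) hx]
      have hq : u.1.1 ((u.1⁻¹).1 ((P.sectionAt x).toFun x)) = (P.sectionAt x).toFun x :=
        Equiv.apply_symm_apply u.1.1 _
      simp only [InfGauFix.comp, LocalSection.map, hq]
      rfl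
    rw [h']
    exact h _)
  one_smul := by
    rintro ⟨θ⟩
    exact congrArg (momentMap τ) (one_smul (P.GauFix τ) θ)
  mul_smul := by
    rintro u v ⟨θ⟩
    exact congrArg (momentMap τ) (mul_smul u v θ)

end PrincipalSLBundle

end Bundle

end

set_option linter.unusedSectionVars false

noncomputable section

/-! ### Calculus of matrix-valued functions of a real variable -/

/-! Everything is computed in one global section σ of Q along which the given lift is the standard
flag (`FlagLift.exists_global_adapted`). Adapted local sections differ by upper triangular matrices
with positive diagonal. These are closed under convex combinations, so a partition of unity glues
the local sections. Along σ the map τ is the constant ray through the first basis vector.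

A positive one-form on the compact oriented curve trivializes its cotangent bundle. Connections
become trace-free matrix functions A, and gauge transformations become functions g acting by A ↦ (gA
− g')g⁻¹ (`connMat_smul`). Such a g fixes τ exactly when its first column is a positive multiple of
the first basis vector. The trace pairing then shows that the annihilator consists of the matrices
supported in the first row off the diagonal. Hence the moment map forgets precisely those entries of
A (`momentMap_eq_iff`).

A horizontal section, written in σ, solves H' = −AH. Differentiating H times the successive
derivatives of a vector lift shows that the osculating lift is the given one if and only if A is
upper Hessenberg with positive subdiagonal (`isOsculatingLift_of_isPosHessenberg`,
`isPosHessenberg_of_isOsculatingLift`). Drinfeld–Sokolov reduction brings such an A, by an upper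
triangular g, to the shift matrix up to the forgotten entries (`exists_reduction`). The condition on
g says that every row of gA − g' after the first is the preceding row of g, so g is generated from
its last row, and the scale of that row is fixed by det g = 1.

For an arbitrary positive connection, the homotopy of lifts comes from a path of gauge
transformations fixing τ (`FlagLift.Homotopic.exists_gauge`), so an element of the identity
component reduces to the case just treated. The upper triangular g lies in the identity component by
convexity. Thus the image lies in the orbit of the shift matrix. It is the whole orbit because
osculating lifts move along with gauge transformations. The action is free because the same row
recursion, together with the condition on the first column, forces a g stabilizing the normal form
to be 1 (`eq_one_of_fixes_shiftMat`). -/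

theorem HasDerivAt.matrix_det {n : ℕ} {F : ℝ → Mat n} {F' : Mat n} {t : ℝ}
    (h : ∀ i j, HasDerivAt (fun s => F s i j) (F' i j) t) :
    HasDerivAt (fun s => (F s).det) ((F t).adjugate * F').trace t := by
  have h1 : HasDerivAt (fun s => (F s).det)
      (∑ σ : Equiv.Perm (Fin n), ((Equiv.Perm.sign σ : ℤ) : ℝ) *
        ∑ i, (∏ j ∈ Finset.univ.erase i, F t (σ j) j) * F' (σ i) i) t := by
    simp only [Matrix.det_apply']
    refine HasDerivAt.fun_sum fun σ _ => HasDerivAt.const_mul _ ?_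
    simpa [smul_eq_mul] using HasDerivAt.fun_finsetProd (u := Finset.univ)
      (f := fun j s => F s (σ j) j) (f' := fun j => F' (σ j) j) fun i _ => h (σ i) i
  convert h1 using 1
  -- Cramer's rule turns the trace into the sum of the determinants in which one column is
  -- differentiated.
  have h2 : ∀ i, ((F t).adjugate * F') i i = ((F t).updateCol i (fun k => F' k i)).det := by
    intro i
    rw [← Matrix.cramer_apply, Matrix.cramer_eq_adjugate_mulVec]
    rfl
  simp only [Matrix.trace, Matrix.diag_apply, h2, Matrix.det_apply', Finset.mul_sum]
  rw [Finset.sum_comm]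
  refine Finset.sum_congr rfl fun σ _ => Finset.sum_congr rfl fun i _ => ?_
  rw [← Finset.mul_prod_erase Finset.univ _ (Finset.mem_univ i), Matrix.updateCol_self,
    mul_comm (F' _ _)]
  congr 2
  refine Finset.prod_congr rfl fun j hj => ?_
  rw [Matrix.updateCol_ne (Finset.ne_of_mem_erase hj)]

/-- Local smooth solutions of `H' = -a H` with `H(t₀) = 1`, for trace-free `a`. -/
theorem exists_linear_ode_solution {n : ℕ} {a : ℝ → Mat n} {U : Set ℝ} (hU : IsOpen U) {t₀ : ℝ}
    (ht₀ : t₀ ∈ U) (ha : ∀ i j, ContDiffOn ℝ ∞ (fun t => a t i j) U)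
    (htr : ∀ t ∈ U, (a t).trace = 0) :
    ∃ ε > 0, Set.Ioo (t₀ - ε) (t₀ + ε) ⊆ U ∧ ∃ H : ℝ → Mat n,
      (∀ t ∈ Set.Ioo (t₀ - ε) (t₀ + ε), ∀ i j,
        HasDerivAt (fun s => H s i j) (-(a t * H t) i j) t) ∧
      (∀ i j, ContDiffOn ℝ ∞ (fun t => H t i j) (Set.Ioo (t₀ - ε) (t₀ + ε))) ∧
      ∀ t ∈ Set.Ioo (t₀ - ε) (t₀ + ε), (H t).det = 1 := by
  let f : ℝ → (Fin n → Fin n → ℝ) → (Fin n → Fin n → ℝ) := fun t x i j => -∑ k, a t i k * x k j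
  have hf : ContDiffOn ℝ ∞ (Function.uncurry f) (U ×ˢ Set.univ) := by
    refine contDiffOn_pi.2 fun i => contDiffOn_pi.2 fun j => ?_
    refine ContDiffOn.neg (ContDiffOn.sum fun k _ => ContDiffOn.mul ?_ ?_)
    · exact (ha i k).comp contDiffOn_fst fun p hp => hp.1
    · exact (contDiff_apply_apply ℝ ℝ k j).comp_contDiffOn contDiffOn_snd
  let x₀ : ℝ × (Fin n → Fin n → ℝ) := (t₀, (1 : Mat n))
  -- Time is adjoined as a coordinate with speed 1, because the existence theorem concerns
  -- autonomous vector fields.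
  let v : ℝ × (Fin n → Fin n → ℝ) → ℝ × (Fin n → Fin n → ℝ) := fun p => (1, f p.1 p.2)
  have hv : ContDiffAt ℝ 1 v x₀ := by
    refine contDiffAt_const.prodMk ?_
    exact ((hf.contDiffAt ((hU.prod isOpen_univ).mem_nhds ⟨ht₀, Set.mem_univ _⟩))).of_le
      (by exact_mod_cast le_top)
  obtain ⟨α, hα0, ε, hε, hα⟩ :=
    hv.exists_forall_mem_closedBall_exists_eq_forall_mem_Ioo_hasDerivAt₀ t₀
  obtain ⟨δ, hδ, hδU⟩ := Metric.isOpen_iff.1 hU t₀ ht₀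
  have hfst : ∀ t ∈ Set.Ioo (t₀ - ε) (t₀ + ε), (α t).1 = t := by
    have hd : ∀ t ∈ Set.Ioo (t₀ - ε) (t₀ + ε),
        HasDerivAt (fun s => (α s).1 - s) 0 t := by
      intro t ht
      have h := (hasDerivAt_iff_hasFDerivAt.1 (hα t ht)).fst.hasDerivAt
      have h' := h.fun_sub (hasDerivAt_id t)
      simp only [v, ContinuousLinearMap.comp_apply, id] at h'
      simpa using h'
    intro t ht
    have := isOpen_Ioo.is_const_of_deriv_eq_zero isPreconnected_Ioo
      (fun s hs => (hd s hs).differentiableAt.differentiableWithinAt)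
      (fun s hs => (hd s hs).deriv) ht (show t₀ ∈ Set.Ioo (t₀ - ε) (t₀ + ε) by
        constructor <;> linarith)
    simp only [hα0, x₀] at this
    linarith
  -- Halving leaves room for a closed interval inside both U and the interval of existence; the
  -- regularity theorem below works on closed intervals.
  set r := min ε δ / 2 with hr
  have hr0 : 0 < r := by positivity
  have hrε : r < ε := by have := min_le_left ε δ; have : 0 < min ε δ := by positivity
                         linarith
  have hrδ : r < δ := by have := min_le_right ε δ; have : 0 < min ε δ := by positivity
                         linarith
  have hIccε : Set.Icc (t₀ - r) (t₀ + r) ⊆ Set.Ioo (t₀ - ε) (t₀ + ε) := fun t ht =>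
    ⟨by linarith [ht.1], by linarith [ht.2]⟩
  have hIccU : Set.Icc (t₀ - r) (t₀ + r) ⊆ U := fun t ht => hδU (by
    rw [Metric.mem_ball, Real.dist_eq, abs_lt]
    constructor <;> linarith [ht.1, ht.2])
  have hsub : Set.Ioo (t₀ - r) (t₀ + r) ⊆ Set.Icc (t₀ - r) (t₀ + r) := Set.Ioo_subset_Icc_self
  have hsnd : ∀ t ∈ Set.Icc (t₀ - r) (t₀ + r),
      HasDerivAt (fun s => (α s).2) (f t (α t).2) t := by
    intro t ht
    have h := (hasDerivAt_iff_hasFDerivAt.1 (hα t (hIccε ht))).snd.hasDerivAt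
    simpa [v, hfst t (hIccε ht)] using h
  have hentry : ∀ t ∈ Set.Ioo (t₀ - r) (t₀ + r), ∀ i j,
      HasDerivAt (fun s => (Matrix.of (α s).2 : Mat n) i j)
        (-(a t * Matrix.of (α t).2) i j) t := by
    intro t ht i j
    exact hasDerivAt_pi.1 (hasDerivAt_pi.1 (hsnd t (hsub ht)) i) j
  refine ⟨r, hr0, hsub.trans hIccU, fun t => Matrix.of (α t).2, hentry, ?_, ?_⟩
  -- Bootstrapping: the solution inherits the smoothness of the right-hand side.
  · have h := ODE.contDiffOn_enat_Icc_of_hasDerivWithinAt (n := ⊤) (u := Set.univ)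
      (hf.mono (Set.prod_mono hIccU subset_rfl)) (fun t ht => (hsnd t ht).hasDerivWithinAt)
      (fun _ _ => Set.mem_univ _)
    intro i j
    exact ((contDiffOn_pi.1 (contDiffOn_pi.1 h i)) j).mono hsub
  -- Liouville's formula: the derivative of det H is −tr(a) det H, which vanishes.
  · have hd : ∀ t ∈ Set.Ioo (t₀ - r) (t₀ + r),
        HasDerivAt (fun s => (Matrix.of (α s).2 : Mat n).det) 0 t := by
      intro t ht
      have h := HasDerivAt.matrix_det (F := fun s => (Matrix.of (α s).2 : Mat n))
        (F' := -(a t * Matrix.of (α t).2)) (hentry t ht)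
      convert h using 1
      rw [Matrix.mul_neg, Matrix.trace_neg, Matrix.trace_mul_comm, Matrix.mul_assoc,
        Matrix.mul_adjugate, Matrix.mul_smul, Matrix.trace_smul, Matrix.mul_one,
        htr t (hIccU (hsub ht)), smul_zero, neg_zero]
    intro t ht
    have := isOpen_Ioo.is_const_of_deriv_eq_zero isPreconnected_Ioo
      (fun s hs => (hd s hs).differentiableAt.differentiableWithinAt)
      (fun s hs => (hd s hs).deriv) ht (show t₀ ∈ Set.Ioo (t₀ - r) (t₀ + r) by
        constructor <;> linarith)
    refine this.trans ?_
    rw [hα0]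
    exact Matrix.det_one

/-! ### Functions and one-forms in charts -/

section Charts

variable {C : Type*} [TopologicalSpace C] [ChartedSpace ℝ C] [IsManifold 𝓘(ℝ, ℝ) ∞ C]

theorem contMDiffOn_iff_charts {f : C → ℝ} {U : Set C} (hU : IsOpen U) :
    ContMDiffOn 𝓘(ℝ, ℝ) 𝓘(ℝ, ℝ) ∞ f U ↔
      ∀ e ∈ atlas ℝ C, ContDiffOn ℝ ∞ (fun t => f (e.symm t)) (e.target ∩ e.symm ⁻¹' U) := by
  constructor
  · intro h e he
    have := contMDiffOn_symm_of_mem_maximalAtlas (n := ∞) (I := 𝓘(ℝ, ℝ))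
      (IsManifold.subset_maximalAtlas he)
    exact (h.comp (this.mono Set.inter_subset_left) fun t ht => ht.2).contDiffOn
  · intro h x hx
    have hx' := mem_chart_source ℝ x
    have he := chart_mem_atlas ℝ x
    set e := chartAt ℝ x
    have h1 : ContMDiffAt 𝓘(ℝ, ℝ) 𝓘(ℝ, ℝ) ∞ (fun t => f (e.symm t)) (e x) :=
      ((h e he).contDiffAt ((e.isOpen_inter_preimage_symm hU).mem_nhds
        ⟨e.map_source hx', by simpa [e.left_inv hx'] using hx⟩)).contMDiffAt
    have h2 := contMDiffAt_of_mem_maximalAtlas (n := ∞) (I := 𝓘(ℝ, ℝ))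
      (IsManifold.subset_maximalAtlas he) hx'
    refine ContMDiffAt.contMDiffWithinAt ?_
    refine (h1.comp x h2).congr_of_eventuallyEq ?_
    filter_upwards [e.open_source.mem_nhds hx'] with y hy
    simp [e.left_inv hy]

theorem matSmoothOn_iff_charts {n : ℕ} {f : C → Mat n} {U : Set C} (hU : IsOpen U) :
    MatSmoothOn 𝓘(ℝ, ℝ) f U ↔ ∀ e ∈ atlas ℝ C, ∀ i j,
      ContDiffOn ℝ ∞ (fun t => f (e.symm t) i j) (e.target ∩ e.symm ⁻¹' U) :=
  ⟨fun h e he i j => (contMDiffOn_iff_charts hU).1 (h i j) e he,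
    fun h i j => (contMDiffOn_iff_charts hU).2 fun e he => h e he i j⟩

/-- The coordinate vector of a chart, as a tangent vector. -/
abbrev coordVec (e : OpenPartialHomeomorph C ℝ) (t : ℝ) : TangentSpace 𝓘(ℝ, ℝ) (e.symm t) :=
  mfderiv 𝓘(ℝ, ℝ) 𝓘(ℝ, ℝ) e.symm t (1 : ℝ)

theorem mfderiv_coordVec {f : C → ℝ} {e : OpenPartialHomeomorph C ℝ} (he : e ∈ atlas ℝ C) {t : ℝ}
    (ht : t ∈ e.target) (hf : MDifferentiableAt 𝓘(ℝ, ℝ) 𝓘(ℝ, ℝ) f (e.symm t)) :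
    (mfderiv 𝓘(ℝ, ℝ) 𝓘(ℝ, ℝ) f (e.symm t) (coordVec e t) : ℝ) =
      deriv (fun s => f (e.symm s)) t := by
  have h2 := (contMDiffAt_symm_of_mem_maximalAtlas (n := ∞) (I := 𝓘(ℝ, ℝ))
      (IsManifold.subset_maximalAtlas he) ht).mdifferentiableAt (by simp)
  have h := mfderiv_comp t hf h2
  refine Eq.trans (DFunLike.congr_fun h (1 : ℝ)).symm ?_
  exact DFunLike.congr_fun (mfderiv_eq_fderiv (f := fun s => f (e.symm s)) (x := t)) (1 : ℝ)

theorem deriv_symm_charts {e e' : OpenPartialHomeomorph C ℝ} (he : e ∈ atlas ℝ C)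
    (he' : e' ∈ atlas ℝ C) {t : ℝ} (ht : t ∈ e.target) (ht' : e.symm t ∈ e'.source) :
    (mfderiv 𝓘(ℝ, ℝ) 𝓘(ℝ, ℝ) e' (e.symm t) (coordVec e t) : ℝ) =
      deriv (fun s => e' (e.symm s)) t :=
  mfderiv_coordVec he ht ((contMDiffAt_of_mem_maximalAtlas (n := ∞) (I := 𝓘(ℝ, ℝ))
      (IsManifold.subset_maximalAtlas he') ht').mdifferentiableAt (by simp))

end Charts

/-! ### A positive one-form and the corresponding derivation -/

section PosForm

variable {C : Type*} [TopologicalSpace C] [ChartedSpace ℝ C] [IsManifold 𝓘(ℝ, ℝ) ∞ C]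
  [T2Space C] [CompactSpace C]

theorem chartPartition_finite :
    {c : C | (Function.support (chartPartition C c)).Nonempty}.Finite :=
  (chartPartition C).locallyFinite.finite_nonempty_of_compact

/-- The differential of a preferred chart. -/
def dChart (c x : C) : TangentSpace 𝓘(ℝ, ℝ) x →ₗ[ℝ] ℝ :=
  (mfderiv 𝓘(ℝ, ℝ) 𝓘(ℝ, ℝ) (chartAt ℝ c) x : TangentSpace 𝓘(ℝ, ℝ) x →L[ℝ] ℝ).toLinearMap

theorem dChart_coordVec {e : OpenPartialHomeomorph C ℝ} (he : e ∈ atlas ℝ C) {c : C} {t : ℝ}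
    (ht : t ∈ e.target) (hs : e.symm t ∈ (chartAt ℝ c).source) :
    dChart c (e.symm t) (coordVec e t) = deriv (fun s => chartAt ℝ c (e.symm s)) t :=
  deriv_symm_charts he (chart_mem_atlas ℝ c) ht hs

/-- A one-form on a compact oriented one-manifold which is positive in all oriented charts. -/
def posForm (x : C) : TangentSpace 𝓘(ℝ, ℝ) x →ₗ[ℝ] ℝ :=
  ∑ c ∈ chartPartition_finite.toFinset, chartPartition C c x • dChart c x

theorem sum_chartPartition (x : C) :
    ∑ c ∈ chartPartition_finite.toFinset, chartPartition C c x = 1 := by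
  rw [← (chartPartition C).sum_eq_one (Set.mem_univ x)]
  refine (finsum_eq_sum_of_support_subset _ fun c hc => ?_).symm
  simp only [Set.Finite.coe_toFinset, Set.mem_ofPred_eq]
  exact ⟨x, hc⟩

theorem formCoeff_posForm (e : OpenPartialHomeomorph C ℝ) (t : ℝ) :
    formCoeff e posForm t = ∑ c ∈ chartPartition_finite.toFinset,
      chartPartition C c (e.symm t) *
        dChart c (e.symm t) (coordVec e t) := by
  simp only [formCoeff, posForm, LinearMap.sum_apply, LinearMap.smul_apply, smul_eq_mul]

theorem mem_chart_source_of_partition_ne {c x : C} (h : chartPartition C c x ≠ 0) :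
    x ∈ (chartAt ℝ c).source :=
  chartPartition_subordinate C c (subset_tsupport _ h)

theorem formCoeff_posForm_pos [OrientedAtlas C] {e : OpenPartialHomeomorph C ℝ}
    (he : e ∈ atlas ℝ C) {t : ℝ} (ht : t ∈ e.target) : 0 < formCoeff e posForm t := by
  rw [formCoeff_posForm]
  have hpos : ∀ c, chartPartition C c (e.symm t) ≠ 0 →
      0 < dChart c (e.symm t) (coordVec e t) := by
    intro c hc
    have hs := mem_chart_source_of_partition_ne hc
    rw [dChart_coordVec he ht hs]
    exact OrientedAtlas.deriv_pos e he _ (chart_mem_atlas ℝ c) t (by simp [ht, hs])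
  have hnn : ∀ c, 0 ≤ chartPartition C c (e.symm t) *
        dChart c (e.symm t) (coordVec e t) := by
    intro c
    by_cases hc : chartPartition C c (e.symm t) = 0
    · rw [hc, zero_mul]
    · exact mul_nonneg ((chartPartition C).nonneg c _) (hpos c hc).le
  obtain ⟨c, hcm, hc⟩ : ∃ c ∈ (chartPartition_finite (C := C)).toFinset,
      chartPartition C c (e.symm t) ≠ 0 := by
    by_contra! hne
    have := sum_chartPartition (e.symm t)
    rw [Finset.sum_eq_zero hne] at this
    exact zero_ne_one this
  refine Finset.sum_pos' (fun c _ => hnn c) ⟨c, hcm, ?_⟩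
  exact mul_pos (lt_of_le_of_ne ((chartPartition C).nonneg c _) hc.symm) (hpos c hc)

theorem contDiffOn_formCoeff_posForm {e : OpenPartialHomeomorph C ℝ} (he : e ∈ atlas ℝ C) :
    ContDiffOn ℝ ∞ (formCoeff e (posForm (C := C))) e.target := by
  have : formCoeff e (posForm (C := C)) = fun t => ∑ c ∈ chartPartition_finite.toFinset,
      chartPartition C c (e.symm t) *
        dChart c (e.symm t) (coordVec e t) :=
    funext (formCoeff_posForm e)
  rw [this]
  refine ContDiffOn.sum fun c _ t ht => ContDiffAt.contDiffWithinAt ?_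
  by_cases hs : e.symm t ∈ (chartAt ℝ c).source
  · have ho : IsOpen (e.target ∩ e.symm ⁻¹' (chartAt ℝ c).source) :=
      e.isOpen_inter_preimage_symm (chartAt ℝ c).open_source
    have hmem : t ∈ e.target ∩ e.symm ⁻¹' (chartAt ℝ c).source := ⟨ht, hs⟩
    have h1 : ContDiffOn ℝ ∞ (fun s => chartPartition C c (e.symm s))
        (e.target ∩ e.symm ⁻¹' Set.univ) :=
      (contMDiffOn_iff_charts isOpen_univ).1 (chartPartition C c).contMDiff.contMDiffOn e he
    have h2 : ContDiffOn ℝ ∞ (fun s => chartAt ℝ c (e.symm s))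
        (e.target ∩ e.symm ⁻¹' (chartAt ℝ c).source) :=
      (contMDiffOn_iff_charts (chartAt ℝ c).open_source).1
        (contMDiffOn_of_mem_maximalAtlas
          (IsManifold.subset_maximalAtlas (chart_mem_atlas ℝ c))) e he
    have h3 := h2.deriv_of_isOpen (m := ∞) ho (by simp)
    refine ((h1.contDiffAt (by simpa using e.open_target.mem_nhds ht)).mul
      (h3.contDiffAt (ho.mem_nhds hmem))).congr_of_eventuallyEq ?_
    filter_upwards [ho.mem_nhds hmem] with s hs
    rw [dChart_coordVec he hs.1 hs.2]
  -- Outside the domain of the chart its differential is a meaningless value, but the cutoff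
  -- vanishes in a neighbourhood.
  · have hs' : e.symm t ∈ (tsupport (chartPartition C c))ᶜ := fun h =>
      hs (chartPartition_subordinate C c h)
    have ho : IsOpen (e.target ∩ e.symm ⁻¹' (tsupport (chartPartition C c))ᶜ) :=
      e.isOpen_inter_preimage_symm (isClosed_tsupport _).isOpen_compl
    refine (contDiffAt_const (c := (0 : ℝ))).congr_of_eventuallyEq ?_
    filter_upwards [ho.mem_nhds ⟨ht, hs'⟩] with s hs
    rw [image_eq_zero_of_notMem_tsupport hs.2, zero_mul]

/-- The number one, as a tangent vector (the coordinate vector of the preferred chart). -/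
abbrev unitVec (x : C) : TangentSpace 𝓘(ℝ, ℝ) x := (1 : ℝ)

/-- The tangent space is definitionally ℝ, so v is its own coefficient. One-forms can therefore be
compared on a single vector. -/
theorem eq_smul_unitVec {x : C} (v : TangentSpace 𝓘(ℝ, ℝ) x) : ∃ c : ℝ, v = c • unitVec x :=
  ⟨v, (mul_one (M := ℝ) v).symm⟩

theorem posForm_unitVec_ne [OrientedAtlas C] (x : C) : posForm x (unitVec x) ≠ 0 := by
  intro h
  have hx := mem_chart_source ℝ x
  have := formCoeff_posForm_pos (chart_mem_atlas ℝ x) ((chartAt ℝ x).map_source hx)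
  have h0 : ∀ y : C, posForm y (unitVec y) = 0 → ∀ v, posForm y v = 0 := by
    intro y hy v
    obtain ⟨c, rfl⟩ := eq_smul_unitVec v
    rw [map_smul, hy, smul_zero]
  refine this.ne' (h0 _ ?_ _)
  rwa [(chartAt ℝ x).left_inv hx]

/-- The quotient of a one-form by the positive one-form. -/
def formRatio {V : Type*} [AddCommGroup V] [Module ℝ V] (α : OneForm C V) (x : C) : V :=
  (posForm x (unitVec x))⁻¹ • α x (unitVec x)

/-- In dimension one a nowhere vanishing form is a basis. This replaces connection forms by globally
defined matrix functions, without choosing a coordinate on the curve. -/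
theorem eq_posForm_smul_formRatio [OrientedAtlas C] {V : Type*} [AddCommGroup V] [Module ℝ V]
    (α : OneForm C V) (x : C) (v : TangentSpace 𝓘(ℝ, ℝ) x) :
    α x v = posForm x v • formRatio α x := by
  obtain ⟨c, rfl⟩ := eq_smul_unitVec v
  rw [map_smul, map_smul, formRatio, smul_smul, smul_eq_mul, mul_assoc,
    mul_inv_cancel₀ (posForm_unitVec_ne x), mul_one]

theorem formCoeff_eq_smul_formRatio [OrientedAtlas C] {V : Type*} [AddCommGroup V] [Module ℝ V]
    (α : OneForm C V) (e : OpenPartialHomeomorph C ℝ) (t : ℝ) :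
    formCoeff e α t = formCoeff e posForm t • formRatio α (e.symm t) :=
  eq_posForm_smul_formRatio _ _ _

theorem FormSmoothOn.formRatio [OrientedAtlas C] {n : ℕ} {α : OneForm C (Mat n)} {U : Set C}
    (hU : IsOpen U) (h : FormSmoothOn α U) : MatSmoothOn 𝓘(ℝ, ℝ) (formRatio α) U := by
  rw [matSmoothOn_iff_charts hU]
  intro e he i j
  refine ContDiffOn.congr (f := fun t => (formCoeff e posForm t)⁻¹ * formCoeff e α t i j) ?_ ?_
  · exact (((contDiffOn_formCoeff_posForm he).mono Set.inter_subset_left).inv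
      fun t ht => (formCoeff_posForm_pos he ht.1).ne').mul (h e he i j)
  · intro t ht
    rw [formCoeff_eq_smul_formRatio α, Matrix.smul_apply, smul_eq_mul, inv_mul_cancel_left₀
      (formCoeff_posForm_pos he ht.1).ne']

/-- The derivative of a matrix-valued function along the vector field dual to the positive
one-form. -/
def matD {n : ℕ} (f : C → Mat n) (x : C) : Mat n :=
  (posForm x (unitVec x))⁻¹ • matDeriv f x (unitVec x)

theorem matDeriv_eq_smul_matD [OrientedAtlas C] {n : ℕ} (f : C → Mat n) (x : C)
    (v : TangentSpace 𝓘(ℝ, ℝ) x) : matDeriv f x v = posForm x v • matD f x := by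
  obtain ⟨c, rfl⟩ := eq_smul_unitVec v
  have : matDeriv f x (c • unitVec x) = c • matDeriv f x (unitVec x) := by
    ext i j
    simp only [matDeriv, Matrix.smul_apply]
    exact map_smul (mfderiv 𝓘(ℝ, ℝ) 𝓘(ℝ, ℝ) (fun y => f y i j) x) c (unitVec x)
  rw [this, map_smul, matD, smul_smul, smul_eq_mul, mul_assoc,
    mul_inv_cancel₀ (posForm_unitVec_ne x), mul_one]

variable [OrientedAtlas C] {n : ℕ}

/-- The dictionary between the global derivation and ordinary derivatives: in a chart they differ by
the positive coefficient of `posForm`. -/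
theorem MatSmoothOn.hasDerivAt {f : C → Mat n} {U : Set C} (hU : IsOpen U)
    (hf : MatSmoothOn 𝓘(ℝ, ℝ) f U) {e : OpenPartialHomeomorph C ℝ} (he : e ∈ atlas ℝ C) {t : ℝ}
    (ht : t ∈ e.target) (htU : e.symm t ∈ U) (i j : Fin n) :
    HasDerivAt (fun s => f (e.symm s) i j) (formCoeff e posForm t * matD f (e.symm t) i j) t := by
  have hd : DifferentiableAt ℝ (fun s => f (e.symm s) i j) t :=
    (((contMDiffOn_iff_charts hU).1 (hf i j) e he).contDiffAt
      ((e.isOpen_inter_preimage_symm hU).mem_nhds ⟨ht, htU⟩)).differentiableAt (by simp)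
  refine hd.hasDerivAt.congr_deriv ?_
  rw [← mfderiv_coordVec he ht (f := fun y => f y i j)
    (((hf i j).contMDiffAt (hU.mem_nhds htU)).mdifferentiableAt (by simp))]
  have := congrFun (congrFun (matDeriv_eq_smul_matD f (e.symm t) (coordVec e t)) i) j
  exact this

theorem MatSmoothOn.matD {f : C → Mat n} {U : Set C} (hU : IsOpen U)
    (hf : MatSmoothOn 𝓘(ℝ, ℝ) f U) : MatSmoothOn 𝓘(ℝ, ℝ) (matD f) U := by
  rw [matSmoothOn_iff_charts hU]
  intro e he i j
  have ho := e.isOpen_inter_preimage_symm hU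
  refine ContDiffOn.congr (f := fun t => (formCoeff e posForm t)⁻¹ *
    deriv (fun s => f (e.symm s) i j) t) ?_ ?_
  · exact (((contDiffOn_formCoeff_posForm he).mono Set.inter_subset_left).inv
      fun t ht => (formCoeff_posForm_pos he ht.1).ne').mul
      ((((contMDiffOn_iff_charts hU).1 (hf i j)) e he).deriv_of_isOpen ho (by simp))
  · intro t ht
    rw [(hf.hasDerivAt hU he ht.1 ht.2 i j).deriv, inv_mul_cancel_left₀
      (formCoeff_posForm_pos he ht.1).ne']

/-- To compute `matD`, differentiate in a chart. -/
theorem matD_eq_of_hasDerivAt {f : C → Mat n} {U : Set C} (hU : IsOpen U)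
    (hf : MatSmoothOn 𝓘(ℝ, ℝ) f U) {x : C} (hx : x ∈ U) {B : Mat n}
    (h : ∀ i j, HasDerivAt (fun s => f ((chartAt ℝ x).symm s) i j)
      (formCoeff (chartAt ℝ x) posForm (chartAt ℝ x x) * B i j) (chartAt ℝ x x)) :
    matD f x = B := by
  have hx' := mem_chart_source ℝ x
  have ht := (chartAt ℝ x).map_source hx'
  have hl := (chartAt ℝ x).left_inv hx'
  ext i j
  have h1 := hf.hasDerivAt hU (chart_mem_atlas ℝ x) ht (by rwa [hl]) i j
  rw [hl] at h1
  exact mul_left_cancel₀ (formCoeff_posForm_pos (chart_mem_atlas ℝ x) ht).ne'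
    (h1.unique (h i j))

theorem matD_mul {f g : C → Mat n} {U : Set C} (hU : IsOpen U)
    (hf : MatSmoothOn 𝓘(ℝ, ℝ) f U) (hg : MatSmoothOn 𝓘(ℝ, ℝ) g U) {x : C} (hx : x ∈ U) :
    matD (fun y => f y * g y) x = matD f x * g x + f x * matD g x := by
  have hx' := mem_chart_source ℝ x
  have ht := (chartAt ℝ x).map_source hx'
  have hl := (chartAt ℝ x).left_inv hx'
  refine matD_eq_of_hasDerivAt hU (hf.mul hg) hx fun i j => ?_
  have h1 := fun i j => hf.hasDerivAt hU (chart_mem_atlas ℝ x) ht (by rwa [hl]) i j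
  have h2 := fun i j => hg.hasDerivAt hU (chart_mem_atlas ℝ x) ht (by rwa [hl]) i j
  simp only [Matrix.mul_apply]
  refine (HasDerivAt.fun_sum fun k _ => (h1 i k).mul (h2 k j)).congr_deriv ?_
  rw [hl, Matrix.add_apply, Matrix.mul_apply, Matrix.mul_apply, ← Finset.sum_add_distrib,
    Finset.mul_sum]
  exact Finset.sum_congr rfl fun k _ => by ring

theorem matD_const (A : Mat n) (x : C) : matD (fun _ : C => A) x = 0 :=
  matD_eq_of_hasDerivAt isOpen_univ (MatSmoothOn.const A _) (Set.mem_univ x) fun i j => by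
    simpa using hasDerivAt_const _ _

theorem matD_congr {f g : C → Mat n} {U : Set C} (hU : IsOpen U) (h : ∀ y ∈ U, f y = g y) {x : C}
    (hx : x ∈ U) : matD f x = matD g x := by
  unfold matD matDeriv
  congr 2
  funext i j
  have : (fun y => f y i j) =ᶠ[𝓝 x] fun y => g y i j := by
    filter_upwards [hU.mem_nhds hx] with y hy
    rw [h y hy]
  exact DFunLike.congr_fun this.mfderiv_eq _

/-- The logarithmic derivative of a function with values in the special linear group. -/
theorem matD_inv {f : C → SLn n} {U : Set C} (hU : IsOpen U)
    (hf : MatSmoothOn 𝓘(ℝ, ℝ) (fun y => (f y).1) U) {x : C} (hx : x ∈ U) :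
    (f x).1 * matD (fun y => ((f y)⁻¹).1) x = -(matD (fun y => (f y).1) x * ((f x)⁻¹).1) := by
  rw [eq_neg_iff_add_eq_zero, add_comm, ← matD_mul hU hf hf.inv hx,
    ← matD_const (1 : Mat n) x]
  congr 1
  funext y
  rw [← Matrix.SpecialLinearGroup.coe_mul, mul_inv_cancel]
  rfl

/-- Jacobi's formula applied to a constant determinant. -/
theorem trace_matD {f : C → SLn n} {U : Set C} (hU : IsOpen U)
    (hf : MatSmoothOn 𝓘(ℝ, ℝ) (fun y => (f y).1) U) {x : C} (hx : x ∈ U) :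
    (((f x)⁻¹).1 * matD (fun y => (f y).1) x).trace = 0 := by
  have hx' := mem_chart_source ℝ x
  have ht := (chartAt ℝ x).map_source hx'
  have hl := (chartAt ℝ x).left_inv hx'
  have h1 := fun i j => hf.hasDerivAt hU (chart_mem_atlas ℝ x) ht (by rwa [hl]) i j
  have h2 := HasDerivAt.matrix_det (F := fun s => (f ((chartAt ℝ x).symm s)).1)
    (F' := formCoeff (chartAt ℝ x) posForm (chartAt ℝ x x) • matD (fun y => (f y).1)
      ((chartAt ℝ x).symm (chartAt ℝ x x))) h1
  have h3 : (fun s => (f ((chartAt ℝ x).symm s)).1.det) = fun _ => (1 : ℝ) :=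
    funext fun s => (f _).2
  rw [h3] at h2
  have h4 := h2.unique (hasDerivAt_const _ _)
  rw [hl, Matrix.mul_smul, Matrix.trace_smul, smul_eq_mul] at h4
  rw [Matrix.SpecialLinearGroup.coe_inv]
  exact (mul_eq_zero.1 h4).resolve_left (formCoeff_posForm_pos (chart_mem_atlas ℝ x) ht).ne'

end PosForm

/-! ### Oriented flags and normalization of oriented bases -/

section Flags

variable {n : ℕ}

theorem flagOf_eq_iff {A B : Mat n} (hA : 0 < A.det) (hB : 0 < B.det) :
    flagOf A hA = flagOf B hB ↔ ∃ b : Mat n, IsPosUpper b ∧ B = A * b :=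
  Quotient.eq (r := flagSetoid n)

theorem flagOf_congr {A B : Mat n} (hA : 0 < A.det) (h : A = B) :
    flagOf A hA = flagOf B (h ▸ hA) := by
  subst h
  rfl

theorem SLn.det_mul_pos (g : SLn n) {A : Mat n} (hA : 0 < A.det) : 0 < (g.1 * A).det := by
  rwa [Matrix.det_mul, g.2, one_mul]

theorem SLn.det_pos (g : SLn n) : 0 < g.1.det := by
  rw [g.2]
  exact one_pos

theorem actFlag_flagOf (g : SLn n) {A : Mat n} (hA : 0 < A.det) :
    actFlag g (flagOf A hA) = flagOf (g.1 * A) (g.det_mul_pos hA) := rfl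

theorem IsPosUpper.sl_inv {g : SLn n} (h : IsPosUpper g.1) : IsPosUpper (g⁻¹).1 := by
  rw [Matrix.SpecialLinearGroup.coe_inv]
  have := h.inv
  rwa [Matrix.inv_def, g.2, Ring.inverse_one, one_smul] at this

theorem flagOf_sl_eq_one_iff (g : SLn n) :
    flagOf g.1 g.det_pos = flagOf 1 (by simp) ↔ IsPosUpper g.1 := by
  rw [flagOf_eq_iff]
  constructor
  · rintro ⟨b, hb, h⟩
    have h1 : g.1 = b⁻¹ := (Matrix.inv_eq_left_inv h.symm).symm
    rw [h1]
    exact hb.inv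
  · intro h
    exact ⟨(g⁻¹).1, h.sl_inv, by
      rw [← Matrix.SpecialLinearGroup.coe_mul, mul_inv_cancel, Matrix.SpecialLinearGroup.coe_one]⟩

theorem IsPosUpper.smul {b : Mat n} (hb : IsPosUpper b) {c : ℝ} (hc : 0 < c) :
    IsPosUpper (c • b) :=
  ⟨fun i j h => by simp [hb.1 i j h], fun i => by simpa using mul_pos hc (hb.2 i)⟩

theorem IsPosUpper.add {b c : Mat n} (hb : IsPosUpper b) (hc : IsPosUpper c) :
    IsPosUpper (b + c) :=
  ⟨fun i j h => by simp [hb.1 i j h, hc.1 i j h], fun i => by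
    simpa using add_pos (hb.2 i) (hc.2 i)⟩

/-- Convexity is what connects upper triangular gauge transformations to the identity. -/
theorem IsPosUpper.convex_combination {b c : Mat n} (hb : IsPosUpper b) (hc : IsPosUpper c)
    {r : ℝ} (h0 : 0 ≤ r) (h1 : r ≤ 1) : IsPosUpper ((1 - r) • b + r • c) := by
  rcases h0.eq_or_lt with rfl | h0
  · simpa using hb
  rcases h1.eq_or_lt with rfl | h1
  · simpa using hc
  exact (hb.smul (sub_pos.2 h1)).add (hc.smul h0)

/-- Used with a partition of unity: positivity is asked only where the weight is nonzero, since a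
transition matrix carries no information outside the overlap. -/
theorem IsPosUpper.weighted_sum {ι : Type*} (S : Finset ι) (r : ι → ℝ) (b : ι → Mat n)
    (h0 : ∀ i ∈ S, 0 ≤ r i) (h1 : ∑ i ∈ S, r i = 1)
    (hb : ∀ i ∈ S, r i ≠ 0 → IsPosUpper (b i)) : IsPosUpper (∑ i ∈ S, r i • b i) := by
  constructor
  · intro i j hij
    rw [Matrix.sum_apply]
    refine Finset.sum_eq_zero fun k hk => ?_
    by_cases hr : r k = 0
    · simp [hr]
    · simp [(hb k hk hr).1 i j hij]
  · intro i
    rw [Matrix.sum_apply]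
    obtain ⟨k, hk, hr⟩ : ∃ k ∈ S, r k ≠ 0 := by
      by_contra! hne
      rw [Finset.sum_eq_zero hne] at h1
      exact zero_ne_one h1
    refine Finset.sum_pos' (fun l hl => ?_) ⟨k, hk, ?_⟩
    · by_cases hl' : r l = 0
      · simp [hl']
      · exact mul_nonneg (h0 l hl) ((hb l hl hl').2 i).le
    · exact mul_pos (lt_of_le_of_ne (h0 k hk) (Ne.symm hr)) ((hb k hk hr).2 i)

/-! ### The action of the special linear group on rays. -/

theorem SLn.mulVec_ne_zero (g : SLn n) {v : Fin n → ℝ} (hv : v ≠ 0) : g.1.mulVec v ≠ 0 := by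
  have := (Matrix.SpecialLinearGroup.toLin' g).map_ne_zero_iff.2 hv
  rwa [Matrix.SpecialLinearGroup.toLin'_apply] at this

theorem actRay_rayOfNeZero (g : SLn n) {v : Fin n → ℝ} (hv : v ≠ 0) :
    actRay g (rayOfNeZero ℝ v hv) = rayOfNeZero ℝ (g.1.mulVec v) (g.mulVec_ne_zero hv) := rfl

theorem actRay_mul (g h : SLn n) (r : RaySphere n) :
    actRay (g * h) r = actRay g (actRay h r) := by
  induction r using Module.Ray.ind with
  | h v hv =>
    change rayOfNeZero ℝ ((g * h).1.mulVec v) _ = rayOfNeZero ℝ (g.1.mulVec (h.1.mulVec v)) _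
    congr 1
    exact (Matrix.mulVec_mulVec _ _ _).symm

theorem actRay_one (r : RaySphere n) : actRay 1 r = r := by
  induction r using Module.Ray.ind with
  | h v hv =>
    rw [actRay_rayOfNeZero]
    congr 1
    exact Matrix.one_mulVec v

theorem actRay_inv_eq_iff (g : SLn n) (r s : RaySphere n) :
    actRay g⁻¹ r = s ↔ r = actRay g s := by
  constructor
  · rintro rfl
    rw [← actRay_mul, mul_inv_cancel, actRay_one]
  · rintro rfl
    rw [← actRay_mul, inv_mul_cancel, actRay_one]

variable [NeZero n]

/-- The diagonal matrix with first entry `r` and all other entries one. -/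
def firstDiag (n : ℕ) [NeZero n] (r : ℝ) : Mat n := Matrix.diagonal (Function.update 1 0 r)

theorem det_firstDiag (r : ℝ) : (firstDiag n r).det = r := by
  rw [firstDiag, Matrix.det_diagonal, Finset.prod_update_of_mem (Finset.mem_univ _)]
  simp

theorem isPosUpper_firstDiag {r : ℝ} (hr : 0 < r) : IsPosUpper (firstDiag n r) := by
  refine ⟨fun i j h => Matrix.diagonal_apply_ne _ h.ne', fun i => ?_⟩
  rw [firstDiag, Matrix.diagonal_apply_eq]
  by_cases h : i = 0
  · subst h
    simpa using hr
  · simp [h]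

/-- Rescale the first column of an oriented basis to make the determinant one. -/
def slNormalize (A : Mat n) : SLn n :=
  if h : 0 < A.det then ⟨A * firstDiag n A.det⁻¹, by
    rw [Matrix.det_mul, det_firstDiag, mul_inv_cancel₀ h.ne']⟩ else 1

theorem coe_slNormalize {A : Mat n} (h : 0 < A.det) :
    (slNormalize A).1 = A * firstDiag n A.det⁻¹ := by
  exact congrArg Subtype.val (dif_pos h)

theorem slNormalize_sl (g : SLn n) : slNormalize g.1 = g := by
  refine Subtype.ext ?_
  rw [coe_slNormalize g.det_pos, g.2, inv_one, firstDiag]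
  have : Function.update (1 : Fin n → ℝ) 0 1 = 1 := Function.update_eq_self (0 : Fin n) (1 : Fin n → ℝ)
  rw [this]
  exact (congrArg (g.1 * ·) Matrix.diagonal_one).trans (Matrix.mul_one _)

theorem slNormalize_one : slNormalize (1 : Mat n) = 1 := slNormalize_sl 1

/-- The normalization is a right multiplication depending only on the determinant, which c
preserves. This equivariance makes the glued section independent of the local one used. -/
theorem slNormalize_mul (c : SLn n) {A : Mat n} (h : 0 < A.det) :
    slNormalize (c.1 * A) = c * slNormalize A := by
  refine Subtype.ext ?_
  rw [coe_slNormalize (c.det_mul_pos h), Matrix.SpecialLinearGroup.coe_mul, coe_slNormalize h,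
    Matrix.det_mul, c.2, one_mul, Matrix.mul_assoc]

theorem IsPosUpper.slNormalize {b : Mat n} (hb : IsPosUpper b) : IsPosUpper (slNormalize b).1 := by
  rw [coe_slNormalize hb.det_pos]
  exact hb.mul (isPosUpper_firstDiag (inv_pos.2 hb.det_pos))

theorem flagOf_slNormalize {A : Mat n} (h : 0 < A.det) :
    flagOf (slNormalize A).1 (slNormalize A).det_pos = flagOf A h := by
  rw [eq_comm, flagOf_eq_iff]
  exact ⟨_, isPosUpper_firstDiag (inv_pos.2 h), coe_slNormalize h⟩

theorem MatSmoothOn.slNormalize {E : Type*} [NormedAddCommGroup E] [NormedSpace ℝ E]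
    {H : Type*} [TopologicalSpace H] {I : ModelWithCorners ℝ E H}
    {M : Type*} [TopologicalSpace M] [ChartedSpace H M] {f : M → Mat n} {U : Set M}
    (hf : MatSmoothOn I f U) (h : ∀ x ∈ U, 0 < (f x).det) :
    MatSmoothOn I (fun x => (_root_.slNormalize (f x)).1) U := by
  refine (hf.mul (g := fun x => firstDiag n (f x).det⁻¹) ?_).congr fun x hx =>
    coe_slNormalize (h x hx)
  intro i j
  by_cases hij : i = j
  · subst hij
    simp only [firstDiag, Matrix.diagonal_apply_eq]
    by_cases hi : i = 0
    · subst hi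
      simp only [Function.update_self]
      exact hf.det.inv₀ fun x hx => (h x hx).ne'
    · simp only [Function.update_of_ne hi]
      exact contMDiffOn_const
  · simp only [firstDiag, Matrix.diagonal_apply_ne _ hij]
    exact contMDiffOn_const

/-- The first standard basis vector. -/
abbrev baseVec (n : ℕ) [NeZero n] : Fin n → ℝ := Pi.single 0 1

theorem baseVec_ne_zero : baseVec n ≠ 0 := fun h => by
  have := congrFun h 0
  simp at this

/-- The ray through the first standard basis vector. -/
def baseRay (n : ℕ) [NeZero n] : RaySphere n := rayOfNeZero ℝ (baseVec n) baseVec_ne_zero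

theorem flagRay_flagOf {A : Mat n} (hA : 0 < A.det) :
    flagRay (flagOf A hA) = rayOfNeZero ℝ (A.col 0) (firstColumn_ne_zero ⟨A, hA⟩) := rfl


theorem flagRay_one : flagRay (flagOf (1 : Mat n) (by simp)) = baseRay n := by
  rw [flagRay_flagOf, baseRay]
  congr 1
  funext i
  simp [Matrix.one_apply, Pi.single_apply]

theorem rayOfNeZero_eq_baseRay_iff {v : Fin n → ℝ} (hv : v ≠ 0) :
    rayOfNeZero ℝ v hv = baseRay n ↔ 0 < v 0 ∧ ∀ i, i ≠ 0 → v i = 0 := by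
  rw [baseRay, ray_eq_iff]
  constructor
  · intro h
    obtain ⟨r, hr, h⟩ := h.symm.exists_pos_left baseVec_ne_zero hv
    rw [← h]
    refine ⟨by simpa using hr, fun i hi => by simp [hi]⟩
  · rintro ⟨h0, h1⟩
    have : v = v 0 • baseVec n := by
      funext i
      by_cases hi : i = 0
      · subst hi
        simp
      · simp [h1 i hi, hi]
    rw [this]
    exact (SameRay.sameRay_pos_smul_left _ h0)

theorem actRay_baseRay_iff (g : SLn n) :
    actRay g (baseRay n) = baseRay n ↔ 0 < g.1 0 0 ∧ ∀ i, i ≠ 0 → g.1 i 0 = 0 := by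
  rw [baseRay, actRay_rayOfNeZero]
  refine (rayOfNeZero_eq_baseRay_iff _).trans ?_
  simp

theorem flagRay_actFlag (g : SLn n) (F : OrientedFlag n) :
    flagRay (actFlag g F) = actRay g (flagRay F) := by
  obtain ⟨A, hA⟩ := F
  change flagRay (actFlag g (flagOf A hA)) = actRay g (flagRay (flagOf A hA))
  rw [actFlag_flagOf, flagRay_flagOf, flagRay_flagOf, actRay_rayOfNeZero]
  congr 1

end Flags

/-! ### Sections of principal bundles -/

theorem MatSmoothOn.of_locally {n : ℕ} {E : Type*} [NormedAddCommGroup E] [NormedSpace ℝ E]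
    {H : Type*} [TopologicalSpace H] {I : ModelWithCorners ℝ E H}
    {M : Type*} [TopologicalSpace M] [ChartedSpace H M] {f : M → Mat n} {U : Set M}
    (h : ∀ x ∈ U, ∃ V, IsOpen V ∧ x ∈ V ∧ MatSmoothOn I f (U ∩ V)) : MatSmoothOn I f U :=
  fun i j => contMDiffOn_of_locally_contMDiffOn fun x hx => by
    obtain ⟨V, hV, hxV, hf⟩ := h x hx
    exact ⟨V, hV, hxV, hf i j⟩

namespace PrincipalSLBundle

section Sections

variable {n : ℕ} {C Q : Type*} [TopologicalSpace C] [ChartedSpace ℝ C] [MulAction (SLn n)ᵐᵒᵖ Q]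
variable (P : PrincipalSLBundle n C Q)

theorem groupDiff_smul_right (P : PrincipalSLBundle n C Q) (q : Q) (g : SLn n) : groupDiff q (op g • q) = g :=
  P.groupDiff_eq rfl

theorem groupDiff_mul {q q' q'' : Q} (h : P.proj q = P.proj q') (h' : P.proj q' = P.proj q'') :
    (groupDiff q q' : SLn n) * groupDiff q' q'' = groupDiff q q'' := by
  refine (P.groupDiff_eq ?_).symm
  rw [op_mul, mul_smul, P.groupDiff_smul h, P.groupDiff_smul h']

theorem groupDiff_inv {q q' : Q} (h : P.proj q = P.proj q') :
    (groupDiff q q' : SLn n)⁻¹ = groupDiff q' q :=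
  (P.groupDiff_eq (P.groupDiff_inv_smul h)).symm

theorem groupDiff_self (P : PrincipalSLBundle n C Q) (q : Q) : (groupDiff q q : SLn n) = 1 := P.groupDiff_eq (by simp)

variable {P}

theorem LocalSection.proj_eq (σ σ' : P.LocalSection) {x : C} (hx : x ∈ σ.dom) (hx' : x ∈ σ'.dom) :
    P.proj (σ.toFun x) = P.proj (σ'.toFun x) := by
  rw [σ.proj_toFun x hx, σ'.proj_toFun x hx']

/-- The transition function between two local sections. -/
abbrev transition (σ σ' : P.LocalSection) (x : C) : SLn n := groupDiff (σ.toFun x) (σ'.toFun x)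

theorem transition_smul (σ σ' : P.LocalSection) {x : C} (hx : x ∈ σ.dom) (hx' : x ∈ σ'.dom) :
    op (transition σ σ' x) • σ.toFun x = σ'.toFun x :=
  P.groupDiff_smul (σ.proj_eq σ' hx hx')

theorem transition_mul (σ σ' σ'' : P.LocalSection) {x : C} (hx : x ∈ σ.dom) (hx' : x ∈ σ'.dom)
    (hx'' : x ∈ σ''.dom) : transition σ σ' x * transition σ' σ'' x = transition σ σ'' x :=
  P.groupDiff_mul (σ.proj_eq σ' hx hx') (σ'.proj_eq σ'' hx' hx'')

theorem matSmoothOn_transition (σ σ' : P.LocalSection) :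
    MatSmoothOn 𝓘(ℝ, ℝ) (fun x => (transition σ σ' x).1) ((σ.dom : Set C) ∩ σ'.dom) := by
  refine MatSmoothOn.of_locally fun x hx => ?_
  obtain ⟨f, hf, hxf⟩ := P.frames_cover x
  refine ⟨f.1, f.1.isOpen, hxf, ?_⟩
  refine MatSmoothOn.congr ((((σ.smooth f hf).inv).mono
    (V := ((σ.dom : Set C) ∩ σ'.dom) ∩ f.1) fun y hy => ⟨hy.2, hy.1.1⟩).mul
    ((σ'.smooth f hf).mono fun y hy => ⟨hy.2, hy.1.2⟩)) fun y hy => ?_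
  have h0 := P.frames_section f hf y hy.2
  have h1 := σ.proj_toFun y hy.1.1
  have h2 := σ'.proj_toFun y hy.1.2
  rw [← Matrix.SpecialLinearGroup.coe_mul, P.groupDiff_inv (h0.trans h1.symm),
    P.groupDiff_mul (h1.trans h0.symm) (h0.trans h2.symm)]

/-- Translate a local section by a function with values in the group. -/
def LocalSection.mulRight (σ : P.LocalSection) (V : Opens C) (hV : V ≤ σ.dom) (g : C → SLn n)
    (hg : MatSmoothOn 𝓘(ℝ, ℝ) (fun x => (g x).1) V) : P.LocalSection where
  dom := V
  toFun x := op (g x) • σ.toFun x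
  proj_toFun x hx := by rw [P.proj_smul, σ.proj_toFun x (hV hx)]
  smooth f hf := by
    refine MatSmoothOn.congr (((σ.smooth f hf).mono
      (V := (f.1 : Set C) ∩ V) fun x hx => ⟨hx.1, hV hx.2⟩).mul
      (hg.mono Set.inter_subset_right)) fun x hx => ?_
    rw [← Matrix.SpecialLinearGroup.coe_mul]
    congr 1
    refine P.groupDiff_eq ?_
    rw [op_mul, mul_smul, P.groupDiff_smul]
    rw [P.frames_section f hf x hx.1, σ.proj_toFun x (hV hx.2)]

variable [NeZero n]

/-- If A is a normalized basis of the flag along a section, translating the section by A makes A⁻¹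
act on the flag, which becomes standard. -/
theorem FlagLift.exists_local_adapted {τ : P.SphereMap} (τhat : FlagLift τ) (x : C) :
    ∃ σ : P.LocalSection, x ∈ σ.dom ∧
      ∀ y ∈ σ.dom, τhat.toFun (σ.toFun y) = flagOf 1 (by simp) := by
  obtain ⟨A, hA, h⟩ := τhat.smooth (P.sectionAt x)
  refine ⟨(P.sectionAt x).mulRight _ le_rfl (fun y => slNormalize (A y))
    (hA.slNormalize fun y hy => (h y hy).1), P.mem_sectionAt x, fun y hy => ?_⟩
  obtain ⟨hy0, hy1⟩ := h y hy
  change τhat.toFun (op (slNormalize (A y)) • (P.sectionAt x).toFun y) = _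
  rw [τhat.equivariant, hy1, ← flagOf_slNormalize hy0, actFlag_flagOf]
  refine flagOf_congr _ ?_
  rw [← Matrix.SpecialLinearGroup.coe_mul, inv_mul_cancel, Matrix.SpecialLinearGroup.coe_one]

/-- The adapted points form a reduction of the structure group to the stabilizer of the standard
flag. -/
theorem isPosUpper_of_adapted {τ : P.SphereMap} (τhat : FlagLift τ) {q : Q} {g : SLn n}
    (h : τhat.toFun q = flagOf 1 (by simp)) (h' : τhat.toFun (op g • q) = flagOf 1 (by simp)) :
    IsPosUpper g.1 := by
  rw [τhat.equivariant, h, actFlag_flagOf] at h'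
  have h2 : IsPosUpper (g⁻¹).1 := by
    rw [← flagOf_sl_eq_one_iff, ← h']
    exact flagOf_congr _ (Matrix.mul_one _).symm
  simpa using h2.sl_inv

/-- The reduced structure group is convex up to rescaling the determinant, so local adapted sections
can be averaged. In particular Q is trivial. -/
theorem FlagLift.exists_global_adapted [IsManifold 𝓘(ℝ, ℝ) ∞ C] [T2Space C] [CompactSpace C]
    {τ : P.SphereMap} (τhat : FlagLift τ) :
    ∃ σ : P.LocalSection, (∀ x, x ∈ σ.dom) ∧
      ∀ y, τhat.toFun (σ.toFun y) = flagOf 1 (by simp) := by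
  choose s hs hadapt using τhat.exists_local_adapted
  obtain ⟨ρ, hρ⟩ := SmoothPartitionOfUnity.exists_isSubordinate 𝓘(ℝ, ℝ) (isClosed_univ (X := C))
    (fun i => ((s i).dom : Set C)) (fun i => (s i).dom.isOpen)
    (fun x _ => Set.mem_iUnion.2 ⟨x, hs x⟩)
  have hfin : {c : C | (Function.support (ρ c)).Nonempty}.Finite :=
    ρ.locallyFinite.finite_nonempty_of_compact
  have hsum : ∀ x, ∑ c ∈ hfin.toFinset, ρ c x = 1 := by
    intro x
    rw [← ρ.sum_eq_one (Set.mem_univ x)]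
    refine (finsum_eq_sum_of_support_subset _ fun c hc => ?_).symm
    simp only [Set.Finite.coe_toFinset, Set.mem_ofPred_eq]
    exact ⟨x, hc⟩
  have hmem : ∀ {i x}, ρ i x ≠ 0 → x ∈ (s i).dom := fun h => hρ _ (subset_tsupport _ h)
  -- The average of all the local adapted sections, expressed in the i-th one.
  let M : C → C → Mat n := fun i x =>
    ∑ j ∈ hfin.toFinset, ρ j x • (transition (s i) (s j) x).1
  have hMpos : ∀ i, ∀ x ∈ (s i).dom, IsPosUpper (M i x) := by
    intro i x hx
    refine IsPosUpper.weighted_sum _ _ _ (fun j _ => ρ.nonneg j x) (hsum x) fun j _ hj => ?_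
    refine isPosUpper_of_adapted τhat (hadapt i x hx) ?_
    rw [transition_smul _ _ hx (hmem hj), hadapt j x (hmem hj)]
  have hMsmooth : ∀ i, MatSmoothOn 𝓘(ℝ, ℝ) (M i) (s i).dom := by
    intro i k l
    simp only [M, Matrix.sum_apply, Matrix.smul_apply, smul_eq_mul]
    refine contMDiffOn_finsetSum fun j _ x hx => ContMDiffAt.contMDiffWithinAt ?_
    by_cases hj : x ∈ (s j).dom
    · exact (ρ j).contMDiff.contMDiffAt.mul ((matSmoothOn_transition (s i) (s j) k l).contMDiffAt
        (((s i).dom.isOpen.inter (s j).dom.isOpen).mem_nhds ⟨hx, hj⟩))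
    · refine contMDiffAt_const (c := (0 : ℝ)) |>.congr_of_eventuallyEq ?_
      filter_upwards [(isClosed_tsupport (ρ j)).isOpen_compl.mem_nhds fun h => hj (hρ j h)]
        with y hy
      rw [image_eq_zero_of_notMem_tsupport hy, zero_mul]
  have hMchange : ∀ i j x, x ∈ (s i).dom → x ∈ (s j).dom →
      (transition (s i) (s j) x).1 * M j x = M i x := by
    intro i j x hi hj
    simp only [M, Finset.mul_sum]
    refine Finset.sum_congr rfl fun k _ => ?_
    by_cases hk : ρ k x = 0
    · simp [hk]
    · rw [Matrix.mul_smul, ← Matrix.SpecialLinearGroup.coe_mul,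
        transition_mul _ _ _ hi hj (hmem hk)]
  have hlocal : ∀ i j x, x ∈ (s i).dom → x ∈ (s j).dom →
      op (slNormalize (M j x)) • (s j).toFun x = op (slNormalize (M i x)) • (s i).toFun x := by
    intro i j x hi hj
    rw [← hMchange i j x hi hj, slNormalize_mul _ (hMpos j x hj).det_pos, op_mul, mul_smul,
      transition_smul _ _ hi hj]
  -- At each x the local section indexed by x itself is used; `hlocal` allows any fixed one nearby,
  -- and smoothness follows from that.
  refine ⟨⟨⊤, fun x => op (slNormalize (M x x)) • (s x).toFun x, fun x _ => ?_, fun f hf => ?_⟩,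
    fun x => trivial, fun x => ?_⟩
  · rw [P.proj_smul, (s x).proj_toFun x (hs x)]
  · refine MatSmoothOn.of_locally fun x hx => ⟨(s x).dom, (s x).dom.isOpen, hs x, ?_⟩
    refine MatSmoothOn.congr ((((s x).smooth f hf).mono
      (V := ((f.1 : Set C) ∩ (⊤ : Opens C)) ∩ (s x).dom) fun y hy => ⟨hy.1.1, hy.2⟩).mul
      (((hMsmooth x).slNormalize fun y hy => (hMpos x y hy).det_pos).mono fun y hy => hy.2))
      fun y hy => ?_
    rw [← Matrix.SpecialLinearGroup.coe_mul]
    congr 1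
    refine P.groupDiff_eq ?_
    rw [hlocal x y y hy.2 (hs y), op_mul, mul_smul, P.groupDiff_smul]
    rw [P.frames_section f hf y hy.1.1, (s x).proj_toFun y hy.2]
  · change τhat.toFun (op (slNormalize (M x x)) • (s x).toFun x) = _
    rw [τhat.equivariant, hadapt x x (hs x), actFlag_flagOf]
    have := ((flagOf_sl_eq_one_iff _).2 (hMpos x x (hs x)).slNormalize.sl_inv)
    rw [← this]
    exact flagOf_congr _ (Matrix.mul_one _)

end Sections

end PrincipalSLBundle

/-! ### Positivity of the integral -/

section Integral

open MeasureTheory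

variable {C : Type*} [TopologicalSpace C] [ChartedSpace ℝ C] [IsManifold 𝓘(ℝ, ℝ) ∞ C]
  [T2Space C] [CompactSpace C] [OrientedAtlas C]

/-- The integral is a finite sum of integrals of nonnegative continuous functions, so each integrand
vanishes. At x, use a chart whose cutoff is nonzero there. -/
theorem eq_zero_of_formIntegral_eq_zero {f : C → ℝ} (hf : Continuous f) (h0 : ∀ x, 0 ≤ f x)
    (hint : formIntegral (fun x => f x • posForm x) = 0) (x : C) : f x = 0 := by
  set F : C → ℝ → ℝ := fun c t => chartPartition C c ((chartAt ℝ c).symm t) *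
    (f ((chartAt ℝ c).symm t) * formCoeff (chartAt ℝ c) posForm t) with hF
  have hFcont : ∀ c, ContinuousOn (F c) (chartAt ℝ c).target := fun c =>
    ((chartPartition C c).contMDiff.continuous.comp_continuousOn
      (chartAt ℝ c).continuousOn_symm).mul ((hf.comp_continuousOn
      (chartAt ℝ c).continuousOn_symm).mul
      (contDiffOn_formCoeff_posForm (chart_mem_atlas ℝ c)).continuousOn)
  have hFnn : ∀ c, ∀ t ∈ (chartAt ℝ c).target, 0 ≤ F c t := fun c t ht =>
    mul_nonneg ((chartPartition C).nonneg c _)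
      (mul_nonneg (h0 _) (formCoeff_posForm_pos (chart_mem_atlas ℝ c) ht).le)
  have hFint : ∀ c, IntegrableOn (F c) (chartAt ℝ c).target := by
    intro c
    have hsub : tsupport (chartPartition C c) ⊆ (chartAt ℝ c).source :=
      chartPartition_subordinate C c
    have hK : IsCompact (chartAt ℝ c '' tsupport (chartPartition C c)) :=
      ((isClosed_tsupport _).isCompact).image_of_continuousOn
        ((chartAt ℝ c).continuousOn.mono hsub)
    have hKt : chartAt ℝ c '' tsupport (chartPartition C c) ⊆ (chartAt ℝ c).target := by
      rintro _ ⟨y, hy, rfl⟩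
      exact (chartAt ℝ c).map_source (hsub hy)
    refine (((hFcont c).mono hKt).integrableOn_compact hK).of_forall_sdiff_eq_zero
      (chartAt ℝ c).open_target.measurableSet ?_
    rintro t ⟨ht, htK⟩
    have : chartPartition C c ((chartAt ℝ c).symm t) = 0 := by
      by_contra hne
      exact htK ⟨(chartAt ℝ c).symm t, subset_tsupport _ hne, (chartAt ℝ c).right_inv ht⟩
    simp [hF, this]
  have hInn : ∀ c, 0 ≤ ∫ t in (chartAt ℝ c).target, F c t := fun c =>
    setIntegral_nonneg (chartAt ℝ c).open_target.measurableSet (hFnn c)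
  have hform : formIntegral (fun x => f x • posForm x) =
      ∑ c ∈ (chartPartition_finite (C := C)).toFinset, ∫ t in (chartAt ℝ c).target, F c t := by
    refine finsum_eq_sum_of_support_subset _ fun c hc => ?_
    simp only [Set.Finite.coe_toFinset, Set.mem_ofPred_eq]
    by_contra hne
    apply hc
    have hz : ∀ y, chartPartition C c y = 0 := by
      intro y
      by_contra hy
      exact hne ⟨y, hy⟩
    simp [hz]
  rw [hform, Finset.sum_eq_zero_iff_of_nonneg fun c _ => hInn c] at hint
  obtain ⟨c, hcm, hc⟩ : ∃ c ∈ (chartPartition_finite (C := C)).toFinset,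
      chartPartition C c x ≠ 0 := by
    by_contra! hne
    have := sum_chartPartition x
    rw [Finset.sum_eq_zero hne] at this
    exact zero_ne_one this
  have hx := mem_chart_source_of_partition_ne hc
  have ht := (chartAt ℝ c).map_source hx
  have hae : F c =ᵐ[volume.restrict (chartAt ℝ c).target] 0 := by
    rw [← setIntegral_eq_zero_iff_of_nonneg_ae _ (hFint c)]
    · exact hint c hcm
    · exact (ae_restrict_iff' (chartAt ℝ c).open_target.measurableSet).2
        (Filter.Eventually.of_forall (hFnn c))
  have := Measure.eqOn_open_of_ae_eq hae (chartAt ℝ c).open_target (hFcont c)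
    continuousOn_const ht
  simp only [hF, (chartAt ℝ c).left_inv hx, Pi.zero_apply] at this
  exact ((mul_eq_zero.1 ((mul_eq_zero.1 this).resolve_left hc))).resolve_right
    (formCoeff_posForm_pos (chart_mem_atlas ℝ c) ht).ne'

theorem MatSmoothOn.formSmoothOn {n : ℕ} {A : C → Mat n} {U : Set C} (hU : IsOpen U)
    (hA : MatSmoothOn 𝓘(ℝ, ℝ) A U) {α : OneForm C (Mat n)}
    (h : ∀ x ∈ U, ∀ v, α x v = posForm x v • A x) : FormSmoothOn α U := by
  intro e he i j
  refine (((contDiffOn_formCoeff_posForm he).mono Set.inter_subset_left).mul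
    ((matSmoothOn_iff_charts hU).1 hA e he i j)).congr fun t ht => ?_
  have := congrFun (congrFun (h _ ht.2 (coordVec e t)) i) j
  exact this

end Integral

namespace PrincipalSLBundle

section Global

variable {n : ℕ} {C Q : Type*} [TopologicalSpace C] [ChartedSpace ℝ C] [MulAction (SLn n)ᵐᵒᵖ Q]
variable {P : PrincipalSLBundle n C Q}

/-! ### Gauge transformations in a section -/

/-- The matrix of a gauge transformation in a local section. -/
def gaugeFun (u : P.Gau) (σ : P.LocalSection) (x : C) : SLn n :=
  groupDiff (σ.toFun x) (u.1 (σ.toFun x))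

theorem gaugeFun_smul (u : P.Gau) (σ : P.LocalSection) (x : C) :
    op (gaugeFun u σ x) • σ.toFun x = u.1 (σ.toFun x) :=
  P.groupDiff_smul (u.2.1 _).symm

theorem matSmoothOn_gaugeFun (u : P.Gau) (σ : P.LocalSection) :
    MatSmoothOn 𝓘(ℝ, ℝ) (fun x => (gaugeFun u σ x).1) σ.dom := u.2.2.2 σ

theorem gaugeFun_mul (u v : P.Gau) (σ : P.LocalSection) (x : C) :
    gaugeFun (u * v) σ x = gaugeFun u σ x * gaugeFun v σ x := by
  refine P.groupDiff_eq ?_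
  rw [op_mul, mul_smul, gaugeFun_smul, ← u.2.2.1, gaugeFun_smul]
  rfl

theorem gaugeFun_one (σ : P.LocalSection) (x : C) : gaugeFun (1 : P.Gau) σ x = 1 :=
  P.groupDiff_self _

theorem gaugeFun_inv (u : P.Gau) (σ : P.LocalSection) (x : C) :
    gaugeFun u⁻¹ σ x = (gaugeFun u σ x)⁻¹ := by
  rw [eq_inv_iff_mul_eq_one, ← gaugeFun_mul, inv_mul_cancel, gaugeFun_one]

/-- The position of a point relative to a section. -/
def coord (σ : P.LocalSection) (q : Q) : SLn n := groupDiff (σ.toFun (P.proj q)) q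

theorem coord_smul {σ : P.LocalSection} (hσ : ∀ x, x ∈ σ.dom) (q : Q) :
    op (coord σ q) • σ.toFun (P.proj q) = q :=
  P.groupDiff_smul (σ.proj_toFun _ (hσ _))

theorem coord_op_smul {σ : P.LocalSection} (hσ : ∀ x, x ∈ σ.dom) (g : SLn n) (q : Q) :
    coord σ (op g • q) = coord σ q * g := by
  refine P.groupDiff_eq ?_
  rw [op_mul, mul_smul, P.proj_smul, coord_smul hσ]

theorem coord_section (σ σ' : P.LocalSection) {x : C} (hx : x ∈ σ'.dom) :
    coord σ (σ'.toFun x) = transition σ σ' x := by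
  rw [coord, σ'.proj_toFun x hx]

theorem coord_self {σ : P.LocalSection} (hσ : ∀ x, x ∈ σ.dom) (x : C) :
    coord σ (σ.toFun x) = 1 := by
  rw [coord_section σ σ (hσ x)]
  exact P.groupDiff_self _

theorem Gau.ext_section {σ : P.LocalSection} (hσ : ∀ x, x ∈ σ.dom) {u v : P.Gau}
    (h : ∀ x, gaugeFun u σ x = gaugeFun v σ x) : u = v := by
  refine Subtype.ext (Equiv.ext fun q => ?_)
  rw [← coord_smul hσ q, u.2.2.1, v.2.2.1, ← gaugeFun_smul u, ← gaugeFun_smul v, h]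

theorem proj_op_smul_section {σ : P.LocalSection} (hσ : ∀ x, x ∈ σ.dom) (g : SLn n) (x : C) :
    P.proj (op g • σ.toFun x) = x := by
  rw [P.proj_smul, σ.proj_toFun x (hσ x)]

/-- The gauge transformation with a given matrix in a global section. -/
def gaugeOf (σ : P.LocalSection) (hσ : ∀ x, x ∈ σ.dom) (g : C → SLn n)
    (hg : MatSmoothOn 𝓘(ℝ, ℝ) (fun x => (g x).1) Set.univ) : P.Gau :=
  -- In the trivialization by σ this is left multiplication by g, which commutes with the right
  -- action.
  ⟨{ toFun := fun q => op (g (P.proj q) * coord σ q) • σ.toFun (P.proj q)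
     invFun := fun q => op ((g (P.proj q))⁻¹ * coord σ q) • σ.toFun (P.proj q)
     left_inv := fun q => by
      beta_reduce
      rw [proj_op_smul_section hσ, coord_op_smul hσ, coord_self hσ, one_mul,
        inv_mul_cancel_left, coord_smul hσ]
     right_inv := fun q => by
      beta_reduce
      rw [proj_op_smul_section hσ, coord_op_smul hσ, coord_self hσ, one_mul,
        mul_inv_cancel_left, coord_smul hσ] },
    fun q => proj_op_smul_section hσ _ _,
    fun h q => by
      change op (g (P.proj (op h • q)) * coord σ (op h • q)) • σ.toFun (P.proj (op h • q)) =
        op h • op (g (P.proj q) * coord σ q) • σ.toFun (P.proj q)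
      rw [P.proj_smul, coord_op_smul hσ, ← mul_assoc, op_mul, mul_smul],
    fun σ' => by
      have ht := (matSmoothOn_transition σ σ').mono (V := (σ'.dom : Set C)) fun x hx => ⟨hσ x, hx⟩
      refine ((ht.inv.mul (hg.mono (Set.subset_univ _))).mul ht).congr fun x hx => ?_
      rw [← Matrix.SpecialLinearGroup.coe_mul, ← Matrix.SpecialLinearGroup.coe_mul]
      congr 1
      refine P.groupDiff_eq ?_
      change _ = op (g (P.proj (σ'.toFun x)) * coord σ (σ'.toFun x)) •
        σ.toFun (P.proj (σ'.toFun x))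
      rw [coord_section σ σ' hx, σ'.proj_toFun x hx, ← transition_smul σ σ' (hσ x) hx,
        ← mul_smul, ← op_mul]
      congr 2
      change transition σ σ' x * ((transition σ σ' x)⁻¹ * g x * transition σ σ' x) = _
      rw [mul_assoc, mul_inv_cancel_left]⟩

theorem gaugeOf_section {σ : P.LocalSection} (hσ : ∀ x, x ∈ σ.dom) {g : C → SLn n}
    (hg : MatSmoothOn 𝓘(ℝ, ℝ) (fun x => (g x).1) Set.univ) (x : C) :
    (gaugeOf σ hσ g hg).1 (σ.toFun x) = op (g x) • σ.toFun x := by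
  change op (g (P.proj (σ.toFun x)) * coord σ (σ.toFun x)) • σ.toFun (P.proj (σ.toFun x)) = _
  rw [coord_self hσ, σ.proj_toFun x (hσ x), mul_one]

theorem gaugeFun_gaugeOf {σ : P.LocalSection} (hσ : ∀ x, x ∈ σ.dom) {g : C → SLn n}
    (hg : MatSmoothOn 𝓘(ℝ, ℝ) (fun x => (g x).1) Set.univ) (x : C) :
    gaugeFun (gaugeOf σ hσ g hg) σ x = g x :=
  P.groupDiff_eq (gaugeOf_section hσ hg x).symm

theorem gaugeFun_change (u : P.Gau) (σ σ' : P.LocalSection) {x : C} (hx : x ∈ σ.dom)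
    (hx' : x ∈ σ'.dom) :
    gaugeFun u σ' x = (transition σ σ' x)⁻¹ * gaugeFun u σ x * transition σ σ' x := by
  refine P.groupDiff_eq ?_
  rw [← transition_smul σ σ' hx hx', ← mul_smul, ← op_mul, mul_assoc, mul_inv_cancel_left,
    op_mul, mul_smul, gaugeFun_smul, u.2.2.1]

/-- The gauge transformation fixing `τ` with a given matrix in a global section. -/
def gaugeFixOf [NeZero n] {τ : P.SphereMap} (σ : P.LocalSection) (hσ : ∀ x, x ∈ σ.dom)
    (hτ : ∀ x, τ.toFun (σ.toFun x) = baseRay n) (g : C → SLn n)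
    (hg : MatSmoothOn 𝓘(ℝ, ℝ) (fun x => (g x).1) Set.univ)
    (hfix : ∀ x, actRay (g x) (baseRay n) = baseRay n) : P.GauFix τ :=
  ⟨gaugeOf σ hσ g hg, fun q => by
    rw [← coord_smul hσ q, (gaugeOf σ hσ g hg).2.2.1, gaugeOf_section, τ.equivariant,
      τ.equivariant, τ.equivariant, hτ]
    congr 1
    rw [actRay_inv_eq_iff, hfix]⟩

theorem actRay_gaugeFun [NeZero n] {τ : P.SphereMap} {σ : P.LocalSection} {x : C}
    (hτ : τ.toFun (σ.toFun x) = baseRay n) (u : P.GauFix τ) :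
    actRay (gaugeFun u.1 σ x) (baseRay n) = baseRay n := by
  have h := u.2 (σ.toFun x)
  rw [← gaugeFun_smul, τ.equivariant, hτ, actRay_inv_eq_iff] at h
  exact h.symm

/-- Paths in the gauge group can be given by matrices in σ alone: in any other section the matrices
are conjugated by a transition function independent of the parameter, which keeps joint smoothness.
-/
theorem gaugeFixOf_mem_GauO [NeZero n] {τ : P.SphereMap} (σ : P.LocalSection)
    (hσ : ∀ x, x ∈ σ.dom) (hτ : ∀ x, τ.toFun (σ.toFun x) = baseRay n) (G : ℝ × C → SLn n)
    (hG : MatSmoothOn (𝓘(ℝ, ℝ).prod 𝓘(ℝ, ℝ)) (fun p => (G p).1) Set.univ)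
    (hGs : ∀ s, MatSmoothOn 𝓘(ℝ, ℝ) (fun x => (G (s, x)).1) Set.univ)
    (hfix : ∀ s x, actRay (G (s, x)) (baseRay n) = baseRay n)
    (h0 : ∀ x, G (0, x) = 1) :
    gaugeFixOf σ hσ hτ (fun x => G (1, x)) (hGs 1) (hfix 1) ∈ P.GauO τ := by
  refine ⟨fun s => gaugeFixOf σ hσ hτ (fun x => G (s, x)) (hGs s) (hfix s), ?_, rfl,
    fun σ' => ?_⟩
  · refine Subtype.ext (Gau.ext_section hσ fun x => ?_)
    refine (gaugeFun_gaugeOf hσ _ x).trans ?_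
    rw [h0]
    exact (gaugeFun_one σ x).symm
  · have ht : MatSmoothOn (𝓘(ℝ, ℝ).prod 𝓘(ℝ, ℝ))
        (fun p : ℝ × C => (transition σ σ' p.2).1) (Set.univ ×ˢ (σ'.dom : Set C)) :=
      fun i j => (matSmoothOn_transition σ σ' i j).comp contMDiffOn_snd
        fun p hp => ⟨hσ p.2, hp.2⟩
    refine ((ht.inv.mul (hG.mono (Set.subset_univ _))).mul ht).congr fun p hp => ?_
    rw [← Matrix.SpecialLinearGroup.coe_mul, ← Matrix.SpecialLinearGroup.coe_mul]
    refine congrArg Subtype.val ?_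
    refine (gaugeFun_change (gaugeOf σ hσ (fun x => G (p.1, x)) (hGs p.1)) σ σ' (hσ p.2)
      hp.2).trans ?_
    rw [gaugeFun_gaugeOf]

end Global

end PrincipalSLBundle

namespace PrincipalSLBundle

section ConnMat

variable {n : ℕ} {C Q : Type*} [TopologicalSpace C] [ChartedSpace ℝ C] [IsManifold 𝓘(ℝ, ℝ) ∞ C]
  [OrientedAtlas C] [T2Space C] [CompactSpace C] [MulAction (SLn n)ᵐᵒᵖ Q]
variable {P : PrincipalSLBundle n C Q}

/-! ### Connections in a section -/

/-- The coefficient matrix of a connection in a local section, relative to the positive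
one-form. -/
def connMat (θ : P.Connection) (σ : P.LocalSection) (x : C) : Mat n := formRatio (θ.form σ) x

theorem form_eq_smul_connMat (θ : P.Connection) (σ : P.LocalSection) (x : C)
    (v : TangentSpace 𝓘(ℝ, ℝ) x) : θ.form σ x v = posForm x v • connMat θ σ x :=
  eq_posForm_smul_formRatio _ _ _

theorem matSmoothOn_connMat (θ : P.Connection) (σ : P.LocalSection) :
    MatSmoothOn 𝓘(ℝ, ℝ) (connMat θ σ) σ.dom :=
  FormSmoothOn.formRatio σ.dom.isOpen (θ.smooth σ)

theorem trace_connMat (θ : P.Connection) (σ : P.LocalSection) (x : C) :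
    (connMat θ σ x).trace = 0 := by
  rw [connMat, formRatio, Matrix.trace_smul, θ.trace_form, smul_zero]

theorem connMat_eq_of_smul (θ : P.Connection) (σ : P.LocalSection) (x : C) (B : Mat n)
    (h : θ.form σ x (unitVec x) = posForm x (unitVec x) • B) : connMat θ σ x = B := by
  rw [connMat, formRatio, h, smul_smul, inv_mul_cancel₀ (posForm_unitVec_ne x), one_smul]

theorem connMat_change (θ : P.Connection) (σ σ' : P.LocalSection) {x : C} (hx : x ∈ σ.dom)
    (hx' : x ∈ σ'.dom) : connMat θ σ' x =
      ((transition σ σ' x)⁻¹).1 * connMat θ σ x * (transition σ σ' x).1 +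
        ((transition σ σ' x)⁻¹).1 * matD (fun y => (transition σ σ' y).1) x := by
  refine connMat_eq_of_smul _ _ _ _ ?_
  rw [θ.change σ σ' x hx hx', form_eq_smul_connMat, matDeriv_eq_smul_matD, Matrix.mul_smul,
    Matrix.mul_smul, Matrix.smul_mul, smul_add]

/-- The potential of u • θ in σ is that of θ in u⁻¹ ∘ σ, and the transition function to that section
is g⁻¹. -/
theorem connMat_smul (u : P.Gau) (θ : P.Connection) (σ : P.LocalSection) {x : C}
    (hx : x ∈ σ.dom) :
    connMat (u • θ) σ x = ((gaugeFun u σ x).1 * connMat θ σ x -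
      matD (fun y => (gaugeFun u σ y).1) x) * ((gaugeFun u σ x)⁻¹).1 := by
  have h := connMat_change θ σ (σ.map u⁻¹) hx hx
  have ht : ∀ y, transition σ (σ.map u⁻¹) y = (gaugeFun u σ y)⁻¹ := fun y => gaugeFun_inv u σ y
  simp only [ht, inv_inv] at h
  refine h.trans ?_
  rw [matD_inv σ.dom.isOpen (matSmoothOn_gaugeFun u σ) hx, ← sub_eq_add_neg, sub_mul]

/-- The connection with a given coefficient matrix in a global section. -/
def connectionOf (σ : P.LocalSection) (hσ : ∀ x, x ∈ σ.dom) (A : C → Mat n)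
    (hA : MatSmoothOn 𝓘(ℝ, ℝ) A Set.univ) (htr : ∀ x, (A x).trace = 0) : P.Connection where
  form σ' x := open Classical in if x ∈ σ'.dom then (posForm x).smulRight
      (((transition σ σ' x)⁻¹).1 * A x * (transition σ σ' x).1 +
        ((transition σ σ' x)⁻¹).1 * matD (fun y => (transition σ σ' y).1) x) else 0
  form_outside σ' x hx := by rw [if_neg hx]
  trace_form σ' x v := by
    by_cases hx : x ∈ σ'.dom
    · rw [if_pos hx, LinearMap.smulRight_apply, Matrix.trace_smul, Matrix.trace_add,
        trace_matD (σ.dom.isOpen.inter σ'.dom.isOpen) (matSmoothOn_transition σ σ') ⟨hσ x, hx⟩,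
        Matrix.mul_assoc, Matrix.trace_mul_comm, Matrix.mul_assoc,
        ← Matrix.SpecialLinearGroup.coe_mul, mul_inv_cancel, Matrix.SpecialLinearGroup.coe_one,
        Matrix.mul_one, htr, add_zero, smul_zero]
    · rw [if_neg hx]
      simp
  smooth σ' := by
    have ht := (matSmoothOn_transition σ σ').mono (V := (σ'.dom : Set C)) fun x hx => ⟨hσ x, hx⟩
    refine MatSmoothOn.formSmoothOn (A := fun x =>
      ((transition σ σ' x)⁻¹).1 * A x * (transition σ σ' x).1 +
        ((transition σ σ' x)⁻¹).1 * matD (fun y => (transition σ σ' y).1) x) σ'.dom.isOpen ?_ ?_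
    · have h1 := (ht.inv.mul (hA.mono (Set.subset_univ _))).mul ht
      have h2 := ht.inv.mul (ht.matD σ'.dom.isOpen)
      exact fun i j => (h1 i j).add (h2 i j)
    · intro x hx v
      rw [if_pos (show x ∈ σ'.dom from hx)]
      rfl
  change σ' σ'' x hx' hx'' v := by
    -- The change law follows from the cocycle identity and the Leibniz rule.
    have hmul : ∀ y ∈ (σ'.dom : Set C) ∩ σ''.dom, (transition σ σ'' y).1 =
        (transition σ σ' y).1 * (transition σ' σ'' y).1 := fun y hy => by
      rw [← Matrix.SpecialLinearGroup.coe_mul, transition_mul _ _ _ (hσ y) hy.1 hy.2]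
    have ho := σ'.dom.isOpen.inter σ''.dom.isOpen
    rw [if_pos hx', if_pos hx'', LinearMap.smulRight_apply, LinearMap.smulRight_apply,
      matDeriv_eq_smul_matD, matD_congr ho hmul ⟨hx', hx''⟩,
      matD_mul ho ((matSmoothOn_transition σ σ').mono fun y hy => ⟨hσ y, hy.1⟩)
        (matSmoothOn_transition σ' σ'') ⟨hx', hx''⟩, Matrix.mul_smul, Matrix.mul_smul,
      Matrix.smul_mul, ← smul_add, ← transition_mul σ σ' σ'' (hσ x) hx' hx'']
    congr 1
    set a := transition σ σ' x
    set b := transition σ' σ'' x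
    change ((a * b)⁻¹).1 * A x * (a * b).1 + ((a * b)⁻¹).1 * (_ * b.1 + a.1 * _) = (b⁻¹).1 *
      ((a⁻¹).1 * A x * a.1 + (a⁻¹).1 * _) * b.1 + (b⁻¹).1 * _
    have haa : (a⁻¹).1 * a.1 = 1 := by
      rw [← Matrix.SpecialLinearGroup.coe_mul, inv_mul_cancel, Matrix.SpecialLinearGroup.coe_one]
    rw [mul_inv_rev, Matrix.SpecialLinearGroup.coe_mul, Matrix.SpecialLinearGroup.coe_mul]
    simp only [Matrix.mul_add, Matrix.add_mul, Matrix.mul_assoc]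
    rw [← Matrix.mul_assoc (a⁻¹).1 a.1, haa, Matrix.one_mul, add_assoc]

theorem connMat_connectionOf {σ : P.LocalSection} (hσ : ∀ x, x ∈ σ.dom) {A : C → Mat n}
    (hA : MatSmoothOn 𝓘(ℝ, ℝ) A Set.univ) (htr : ∀ x, (A x).trace = 0) (x : C) :
    connMat (connectionOf σ hσ A hA htr) σ x = A x := by
  refine connMat_eq_of_smul _ _ _ _ ?_
  simp only [connectionOf]
  rw [if_pos (hσ x), LinearMap.smulRight_apply]
  have : ∀ y, transition σ σ y = 1 := fun y => P.groupDiff_self _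
  simp only [this, matD_const, Matrix.mul_zero, add_zero, inv_one,
    Matrix.SpecialLinearGroup.coe_one, Matrix.one_mul, Matrix.mul_one]

/-! ### Infinitesimal gauge transformations and the annihilator -/

variable [NeZero n] {τ : P.SphereMap}

theorem InfGauFix.section_apply {σ : P.LocalSection} {x : C}
    (hτ : τ.toFun (σ.toFun x) = baseRay n) (ζ : InfGauFix τ) {i : Fin n} (hi : i ≠ 0) :
    ζ.toFun (σ.toFun x) i 0 = 0 := by
  obtain ⟨c, hc⟩ := ζ.fixes _ (baseVec n) baseVec_ne_zero hτ
  have := congrFun hc i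
  simpa [hi] using this

/-- The infinitesimal gauge transformation fixing `τ` with a given matrix in a global section. -/
def infGauOf (σ : P.LocalSection) (hσ : ∀ x, x ∈ σ.dom)
    (hτ : ∀ x, τ.toFun (σ.toFun x) = baseRay n) (Z : C → Mat n)
    (hZ : MatSmoothOn 𝓘(ℝ, ℝ) Z Set.univ) (htr : ∀ x, (Z x).trace = 0)
    (h0 : ∀ x i, i ≠ 0 → Z x i 0 = 0) : InfGauFix τ where
  toFun q := ((coord σ q)⁻¹).1 * Z (P.proj q) * (coord σ q).1
  trace_toFun q := by
    rw [Matrix.mul_assoc, Matrix.trace_mul_comm, Matrix.mul_assoc,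
        ← Matrix.SpecialLinearGroup.coe_mul, mul_inv_cancel, Matrix.SpecialLinearGroup.coe_one,
        Matrix.mul_one, htr]
  equivariant g q := by
    rw [coord_op_smul hσ, P.proj_smul, mul_inv_rev, Matrix.SpecialLinearGroup.coe_mul,
      Matrix.SpecialLinearGroup.coe_mul]
    simp only [Matrix.mul_assoc]
  smooth σ' := by
    have ht := (matSmoothOn_transition σ σ').mono (V := (σ'.dom : Set C)) fun x hx => ⟨hσ x, hx⟩
    refine ((ht.inv.mul (hZ.mono (Set.subset_univ _))).mul ht).congr fun x hx => ?_
    rw [coord_section σ σ' hx, σ'.proj_toFun x hx]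
  fixes q w hw hq := by
    -- Transported to the frame σ, the vector w spans the base ray, on which Z acts by its upper
    -- left entry.
    have h1 : rayOfNeZero ℝ ((coord σ q).1.mulVec w)
        ((coord σ q).mulVec_ne_zero hw) = baseRay n := by
      rw [← actRay_rayOfNeZero (coord σ q) hw, ← hq, eq_comm, ← actRay_inv_eq_iff]
      rw [← hτ (P.proj q), ← τ.equivariant, coord_smul hσ]
    obtain ⟨-, h2⟩ := (rayOfNeZero_eq_baseRay_iff _).1 h1
    refine ⟨Z (P.proj q) 0 0, ?_⟩
    have h3 : (Z (P.proj q)).mulVec ((coord σ q).1.mulVec w) =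
        Z (P.proj q) 0 0 • (coord σ q).1.mulVec w := by
      funext i
      rw [Matrix.mulVec, dotProduct, Finset.sum_eq_single 0]
      · by_cases hi : i = 0
        · subst hi
          rfl
        · rw [h0 _ _ hi, zero_mul, Pi.smul_apply, h2 i hi, smul_zero]
      · intro k _ hk
        rw [h2 k hk, mul_zero]
      · simp
    rw [← Matrix.mulVec_mulVec, ← Matrix.mulVec_mulVec, h3, Matrix.mulVec_smul,
      Matrix.mulVec_mulVec, ← Matrix.SpecialLinearGroup.coe_mul, inv_mul_cancel,
      Matrix.SpecialLinearGroup.coe_one, Matrix.one_mulVec]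

theorem infGauOf_section {σ : P.LocalSection} (hσ : ∀ x, x ∈ σ.dom)
    (hτ : ∀ x, τ.toFun (σ.toFun x) = baseRay n) {Z : C → Mat n}
    (hZ : MatSmoothOn 𝓘(ℝ, ℝ) Z Set.univ) (htr : ∀ x, (Z x).trace = 0)
    (h0 : ∀ x i, i ≠ 0 → Z x i 0 = 0) (x : C) :
    (infGauOf σ hσ hτ Z hZ htr h0).toFun (σ.toFun x) = Z x := by
  simp only [infGauOf]
  rw [coord_self hσ, σ.proj_toFun x (hσ x), inv_one, Matrix.SpecialLinearGroup.coe_one,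
    Matrix.one_mul, Matrix.mul_one]

theorem pair_diff_eq (θ θ' : P.Connection) (ζ : InfGauFix τ) {σ : P.LocalSection}
    (hσ : ∀ x, x ∈ σ.dom) : (θ.diff θ').pair ζ = fun x =>
      ((connMat θ σ x - connMat θ' σ x) * ζ.toFun (σ.toFun x)).trace • posForm x := by
  funext x
  refine LinearMap.ext fun v => ?_
  rw [AdForm.pair_eq _ _ σ (hσ x)]
  change ((θ.form σ x v - θ'.form σ x v) * _).trace = _
  rw [form_eq_smul_connMat, form_eq_smul_connMat, ← smul_sub, Matrix.smul_mul,
    Matrix.trace_smul, LinearMap.smul_apply, smul_eq_mul, smul_eq_mul, mul_comm]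

theorem formIntegral_zero_form : formIntegral (fun x : C =>
    (0 : TangentSpace 𝓘(ℝ, ℝ) x →ₗ[ℝ] ℝ)) = 0 := by
  simp [formIntegral, formCoeff]

/-- Connections have the same image under the moment map if and only if they differ only in the
first row, outside the diagonal. -/
theorem momentMap_eq_iff {σ : P.LocalSection} (hσ : ∀ x, x ∈ σ.dom)
    (hτ : ∀ x, τ.toFun (σ.toFun x) = baseRay n) (θ θ' : P.Connection) :
    momentMap τ θ = momentMap τ θ' ↔
      ∀ x i j, (i ≠ 0 ∨ j = 0) → connMat θ σ x i j = connMat θ' σ x i j := by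
  have hq : momentMap τ θ = momentMap τ θ' ↔ θ.diff θ' ∈ ann τ :=
    Quotient.eq (r := connSetoid τ)
  rw [hq]
  constructor
  · intro h
    set a : C → Mat n := fun x => connMat θ σ x - connMat θ' σ x with ha
    have has : MatSmoothOn 𝓘(ℝ, ℝ) a Set.univ := fun i j =>
      ((matSmoothOn_connMat θ σ i j).sub (matSmoothOn_connMat θ' σ i j)).mono fun x _ => hσ x
    -- The transpose of a, with the entries deleted that would move the base ray. Then tr(aZ) is the
    -- sum of the squares of the entries of a except those in the first row off the diagonal. The
    -- diagonal is kept, so Z stays trace-free.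
    let Z : C → Mat n := fun x => Matrix.of fun i j => if i ≠ 0 ∧ j = 0 then 0 else a x j i
    have hZ : MatSmoothOn 𝓘(ℝ, ℝ) Z Set.univ := by
      intro i j
      by_cases hij : i ≠ 0 ∧ j = 0
      · simp only [Z, Matrix.of_apply, if_pos hij]
        exact contMDiffOn_const
      · simp only [Z, Matrix.of_apply, if_neg hij]
        exact has j i
    have htr : ∀ x, (Z x).trace = 0 := by
      intro x
      have : (a x).trace = 0 := by
        rw [ha, Matrix.trace_sub, trace_connMat, trace_connMat, sub_zero]
      rw [← this]
      refine Finset.sum_congr rfl fun i _ => ?_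
      simp only [Matrix.diag_apply, Z, Matrix.of_apply]
      rw [if_neg]
      rintro ⟨h1, h2⟩
      exact h1 h2
    have h0 : ∀ x i, i ≠ 0 → Z x i 0 = 0 := fun x i hi => if_pos ⟨hi, rfl⟩
    have hint := h (infGauOf σ hσ hτ Z hZ htr h0)
    rw [pair_diff_eq θ θ' _ hσ] at hint
    have hterm : ∀ x i k, 0 ≤ a x i k * Z x k i := by
      intro x i k
      simp only [Z, Matrix.of_apply]
      split_ifs
      · simp
      · exact mul_self_nonneg _
    have hz := eq_zero_of_formIntegral_eq_zero (f := fun x => (a x * Z x).trace) ?_ ?_ ?_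
    · intro x i j hij
      have h1 : ∑ i, ∑ k, a x i k * Z x k i = 0 := hz x
      rw [Finset.sum_eq_zero_iff_of_nonneg fun i _ => Finset.sum_nonneg fun k _ => hterm x i k]
        at h1
      have h2 := h1 i (Finset.mem_univ _)
      rw [Finset.sum_eq_zero_iff_of_nonneg fun k _ => hterm x i k] at h2
      have h3 := h2 j (Finset.mem_univ _)
      simp only [Z, Matrix.of_apply] at h3
      rw [if_neg] at h3
      · exact sub_eq_zero.1 (mul_self_eq_zero.1 h3)
      · rintro ⟨h4, h5⟩
        exact hij.elim (fun h => h h5) h4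
    · have : Continuous fun x => ∑ i, ∑ k, a x i k * Z x k i :=
        continuous_finsetSum _ fun i _ => continuous_finsetSum _ fun k _ =>
          (continuousOn_univ.1 (has i k).continuousOn).mul
            (continuousOn_univ.1 (hZ k i).continuousOn)
      exact this
    · intro x
      have : 0 ≤ ∑ i, ∑ k, a x i k * Z x k i :=
        Finset.sum_nonneg fun i _ => Finset.sum_nonneg fun k _ => hterm x i k
      exact this
    · rw [← hint]
      congr 1
      funext x
      rw [infGauOf_section]
  · intro h ζ
    rw [pair_diff_eq θ θ' ζ hσ, ← formIntegral_zero_form (C := C)]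
    congr 1
    funext x
    -- The surviving entries of the difference meet only the entries of ζ below the diagonal in its
    -- first column, which vanish.
    have : ((connMat θ σ x - connMat θ' σ x) * ζ.toFun (σ.toFun x)).trace = 0 := by
      refine Finset.sum_eq_zero fun i _ => ?_
      rw [Matrix.diag_apply, Matrix.mul_apply]
      refine Finset.sum_eq_zero fun k _ => ?_
      by_cases hik : i ≠ 0 ∨ k = 0
      · rw [Matrix.sub_apply, h x i k hik, sub_self, zero_mul]
      · push Not at hik
        rw [hik.1, ζ.section_apply (hτ x) hik.2, mul_zero]
    rw [this, zero_smul]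

end ConnMat

end PrincipalSLBundle

/-! ### Hessenberg matrices and frames of successive derivatives -/

section Hessenberg

variable {n : ℕ}

/-- Upper Hessenberg matrices with positive entries directly below the diagonal. -/
def IsPosHessenberg (A : Mat n) : Prop :=
  (∀ i j : Fin n, (j : ℕ) + 1 < i → A i j = 0) ∧ ∀ i j : Fin n, (i : ℕ) = j + 1 → 0 < A i j

theorem IsPosHessenberg.smul {A : Mat n} (hA : IsPosHessenberg A) {c : ℝ} (hc : 0 < c) :
    IsPosHessenberg (c • A) :=
  ⟨fun i j h => by simp [hA.1 i j h], fun i j h => by simpa using mul_pos hc (hA.2 i j h)⟩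

theorem IsPosHessenberg.of_smul {A : Mat n} {c : ℝ} (hA : IsPosHessenberg (c • A)) (hc : 0 < c) :
    IsPosHessenberg A := by
  have := hA.smul (inv_pos.2 hc)
  rwa [smul_smul, inv_mul_cancel₀ hc.ne', one_smul] at this

theorem hasDerivAt_eq_zero {f : ℝ → ℝ} {T : Set ℝ} (hT : IsOpen T) (h0 : ∀ t ∈ T, f t = 0) {t : ℝ}
    (ht : t ∈ T) {f' : ℝ} (h : HasDerivAt f f' t) : f' = 0 := by
  refine h.unique ((hasDerivAt_const t (0 : ℝ)).congr_of_eventuallyEq ?_)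
  filter_upwards [hT.mem_nhds ht] with s hs using h0 s hs

/-- If the columns of `B` satisfy `B (k + 1) = B k ' + a (B k)` with `a` upper Hessenberg with
positive subdiagonal, and the first column is a positive multiple of the first basis vector, then
`B` is upper triangular with positive diagonal. -/
theorem isPosUpper_of_isPosHessenberg [NeZero n] {a B : ℝ → Mat n} {T : Set ℝ} (hT : IsOpen T)
    (hB : ∀ t ∈ T, ∀ i k k' : Fin n, (k' : ℕ) = k + 1 →
      HasDerivAt (fun s => B s i k) (B t i k' - (a t * B t) i k) t)
    (ha : ∀ t ∈ T, IsPosHessenberg (a t)) (h0 : ∀ t ∈ T, 0 < B t 0 0)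
    (h1 : ∀ t ∈ T, ∀ i, i ≠ 0 → B t i 0 = 0) : ∀ t ∈ T, IsPosUpper (B t) := by
  have key : ∀ m : ℕ, ∀ k : Fin n, (k : ℕ) = m → ∀ t ∈ T,
      (∀ i, k < i → B t i k = 0) ∧ 0 < B t k k := by
    intro m
    induction m with
    | zero =>
      intro k hk t ht
      obtain rfl : k = 0 := Fin.ext hk
      exact ⟨fun i hi => h1 t ht i hi.ne', h0 t ht⟩
    | succ m ih =>
      intro k' hk' t ht
      let k : Fin n := ⟨m, by omega⟩
      have hk := ih k rfl
      have hkk : (k' : ℕ) = k + 1 := hk'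
      -- Below the diagonal column k vanishes identically in t, hence so does its derivative.
      have hlow : ∀ i, k < i → B t i k' = (a t * B t) i k := fun i hi =>
        sub_eq_zero.1 (hasDerivAt_eq_zero hT (fun s hs => (hk s hs).1 i hi) ht
          (hB t ht i k k' hkk))
      -- Terms with j > k vanish because column k of B is triangular, those with j < k because then
      -- j + 1 < i and a is Hessenberg.
      have hsum : ∀ i, k < i → B t i k' = a t i k * B t k k := by
        intro i hi
        rw [hlow i hi, Matrix.mul_apply, Finset.sum_eq_single k]
        · intro j _ hj
          rcases lt_or_gt_of_ne hj with h | h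
          · rw [(ha t ht).1 i j (by rw [Fin.lt_def] at h hi; omega), zero_mul]
          · rw [(hk t ht).1 j h, mul_zero]
        · simp
      constructor
      · intro i hi
        rw [hsum i (by rw [Fin.lt_def] at hi ⊢; omega), (ha t ht).1 i k (by
          rw [Fin.lt_def] at hi; omega), zero_mul]
      · rw [hsum k' (by rw [Fin.lt_def]; omega)]
        exact mul_pos ((ha t ht).2 k' k hkk) (hk t ht).2
  exact fun t ht => ⟨fun i j hij => (key j j rfl t ht).1 i hij, fun i => (key i i rfl t ht).2⟩

/-- The converse of `isPosUpper_of_isPosHessenberg`. -/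
theorem isPosHessenberg_of_isPosUpper {a B : ℝ → Mat n} {T : Set ℝ} (hT : IsOpen T)
    (hB : ∀ t ∈ T, ∀ i k k' : Fin n, (k' : ℕ) = k + 1 →
      HasDerivAt (fun s => B s i k) (B t i k' - (a t * B t) i k) t)
    (hup : ∀ t ∈ T, IsPosUpper (B t)) : ∀ t ∈ T, IsPosHessenberg (a t) := by
  intro t ht
  -- The sum collapses to one term only if all earlier columns of a are already known to be
  -- Hessenberg, hence strong induction on the column.
  have key : ∀ m : ℕ, ∀ k k' : Fin n, (k : ℕ) = m → (k' : ℕ) = k + 1 →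
      (∀ i, k' < i → a t i k = 0) ∧ 0 < a t k' k := by
    intro m
    induction m using Nat.strong_induction_on with
    | _ m ih =>
      intro k k' hkm hk'
      have hlow : ∀ i, k < i → B t i k' = (a t * B t) i k := fun i hi =>
        sub_eq_zero.1 (hasDerivAt_eq_zero hT (fun s hs => (hup s hs).1 i k hi) ht
          (hB t ht i k k' hk'))
      have hsum : ∀ i, k < i → B t i k' = a t i k * B t k k := by
        intro i hi
        rw [hlow i hi, Matrix.mul_apply, Finset.sum_eq_single k]
        · intro j _ hj
          rcases lt_or_gt_of_ne hj with h | h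
          · rw [Fin.lt_def] at h hi
            rw [(ih j (by omega) j ⟨j + 1, by omega⟩ rfl rfl).1 i
              (by rw [Fin.lt_def]; simp only; omega), zero_mul]
          · rw [(hup t ht).1 j k h, mul_zero]
        · simp
      have hpos := (hup t ht).2 k
      constructor
      · intro i hi
        have h1 := hsum i (by rw [Fin.lt_def] at hi ⊢; omega)
        rw [(hup t ht).1 i k' hi] at h1
        exact (mul_eq_zero.1 h1.symm).resolve_right hpos.ne'
      · have h1 := hsum k' (by rw [Fin.lt_def]; omega)
        exact pos_of_mul_pos_left (h1 ▸ (hup t ht).2 k') hpos.le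
  constructor
  · intro i j hij
    exact (key j j ⟨j + 1, by omega⟩ rfl rfl).1 i (by rw [Fin.lt_def]; exact hij)
  · intro i j hij
    exact (key j j i rfl hij).2

theorem hasDerivAt_iteratedDeriv {f : ℝ → ℝ} {T : Set ℝ} (hT : IsOpen T)
    (hf : ContDiffOn ℝ ∞ f T) {t : ℝ} (ht : t ∈ T) (k : ℕ) :
    HasDerivAt (iteratedDeriv k f) (iteratedDeriv (k + 1) f t) t := by
  have h1 : DifferentiableAt ℝ (iteratedDeriv k f) t := by
    have h2 := (hf.differentiableOn_iteratedDerivWithin (m := k)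
      (by exact_mod_cast WithTop.coe_lt_top _) hT.uniqueDiffOn).differentiableAt (hT.mem_nhds ht)
    refine h2.congr_of_eventuallyEq ?_
    filter_upwards [hT.mem_nhds ht] with s hs
    exact (iteratedDerivWithin_of_isOpen hT hs).symm
  rw [iteratedDeriv_succ]
  exact h1.hasDerivAt

end Hessenberg

/-! ### Horizontal sections and osculating flags. -/

namespace PrincipalSLBundle

section Horizontal

variable {n : ℕ} {C Q : Type*} [TopologicalSpace C] [ChartedSpace ℝ C] [IsManifold 𝓘(ℝ, ℝ) ∞ C]
  [OrientedAtlas C] [T2Space C] [CompactSpace C] [MulAction (SLn n)ᵐᵒᵖ Q]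
variable {P : PrincipalSLBundle n C Q}

theorem isHorizontal_iff (θ : P.Connection) (s : P.LocalSection) :
    θ.IsHorizontal s ↔ ∀ x ∈ s.dom, connMat θ s x = 0 := by
  refine forall₂_congr fun x _ => ⟨fun h => ?_, fun h => ?_⟩
  · rw [connMat, formRatio, h, LinearMap.zero_apply, smul_zero]
  · refine LinearMap.ext fun v => ?_
    rw [form_eq_smul_connMat, h, smul_zero, LinearMap.zero_apply]

/-- Horizontality is the linear equation H' = −AH for the transition function H from σ. -/
theorem isHorizontal_iff_matD (θ : P.Connection) {σ : P.LocalSection} (hσ : ∀ x, x ∈ σ.dom)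
    (s : P.LocalSection) : θ.IsHorizontal s ↔ ∀ x ∈ s.dom,
      matD (fun y => (transition σ s y).1) x = -(connMat θ σ x * (transition σ s x).1) := by
  rw [isHorizontal_iff]
  refine forall₂_congr fun x hx => ?_
  rw [connMat_change θ σ s (hσ x) hx, Matrix.mul_assoc, ← Matrix.mul_add]
  constructor
  · intro h
    have h2 : (transition σ s x).1 * (((transition σ s x)⁻¹).1 * _) = _ * 0 :=
      congrArg ((transition σ s x).1 * ·) h
    rw [← Matrix.mul_assoc, ← Matrix.SpecialLinearGroup.coe_mul, mul_inv_cancel,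
      Matrix.SpecialLinearGroup.coe_one, Matrix.one_mul, Matrix.mul_zero] at h2
    exact (neg_eq_of_add_eq_zero_right h2).symm
  · intro h
    rw [h, add_neg_cancel, Matrix.mul_zero]

/-- Conditions quantified over horizontal sections would be vacuous without this; it is where the
differential equation is solved. -/
theorem exists_isHorizontal (θ : P.Connection) {σ : P.LocalSection} (hσ : ∀ x, x ∈ σ.dom) (x₀ : C) :
    ∃ s : P.LocalSection, x₀ ∈ s.dom ∧ θ.IsHorizontal s := by
  have hx₀ := mem_chart_source ℝ x₀
  have he := chart_mem_atlas ℝ x₀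
  set e := chartAt ℝ x₀
  have hA := (matSmoothOn_connMat θ σ).mono (V := Set.univ) fun x _ => hσ x
  obtain ⟨ε, hε, hsub, H, hH, hHs, hdet⟩ := exists_linear_ode_solution (n := n) e.open_target
    (e.map_source hx₀) (a := fun t => formCoeff e posForm t • connMat θ σ (e.symm t))
    (fun i j => (contDiffOn_formCoeff_posForm he).mul (by
      simpa using (matSmoothOn_iff_charts isOpen_univ).1 hA e he i j))
    (fun t _ => by rw [Matrix.trace_smul, trace_connMat, smul_zero])
  set J := Set.Ioo (e x₀ - ε) (e x₀ + ε)
  let V : Opens C := ⟨e.source ∩ e ⁻¹' J, e.isOpen_inter_preimage isOpen_Ioo⟩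
  -- The value 1 is a filler; on V the determinant is 1 and g is the solution H.
  let g : C → SLn n := fun x =>
    open Classical in if h : (H (e x)).det = 1 then ⟨H (e x), h⟩ else 1
  have hg : ∀ x ∈ V, (g x).1 = H (e x) := fun x hx =>
    congrArg Subtype.val (dif_pos (hdet (e x) hx.2))
  have hgs : MatSmoothOn 𝓘(ℝ, ℝ) (fun x => (g x).1) V := by
    refine MatSmoothOn.congr (f := fun x => H (e x)) (fun i j => ?_) hg
    exact (hHs i j).contMDiffOn.comp ((contMDiffOn_of_mem_maximalAtlas
      (IsManifold.subset_maximalAtlas he)).mono Set.inter_subset_left) fun x hx => hx.2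
  refine ⟨σ.mulRight V (fun x _ => hσ x) g hgs, ⟨hx₀, by
    change e x₀ ∈ J
    constructor <;> linarith⟩, ?_⟩
  rw [isHorizontal_iff_matD θ hσ]
  intro x hx
  have ht : ∀ y, transition σ (σ.mulRight V (fun x _ => hσ x) g hgs) y = g y := fun y =>
    P.groupDiff_smul_right _ _
  simp only [ht]
  have hxV : x ∈ V := hx
  have hxe : e.symm (e x) = x := e.left_inv hxV.1
  ext i j
  have h1 := hgs.hasDerivAt V.isOpen he (e.map_source hxV.1) (by rw [hxe]; exact hxV) i j
  have h2 := hH (e x) hxV.2 i j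
  have h3 : (fun s => (g (e.symm s)).1 i j) =ᶠ[𝓝 (e x)] fun s => H s i j := by
    have ho : IsOpen (e.target ∩ J) := e.open_target.inter isOpen_Ioo
    filter_upwards [ho.mem_nhds ⟨e.map_source hxV.1, hxV.2⟩] with s hs
    rw [hg, e.right_inv hs.1]
    exact ⟨e.map_target hs.1, by rw [Set.mem_preimage, e.right_inv hs.1]; exact hs.2⟩
  have h4 := h1.unique (h2.congr_of_eventuallyEq h3)
  rw [hxe, ← hg x hxV] at h4
  refine mul_left_cancel₀ (formCoeff_posForm_pos he (e.map_source hxV.1)).ne' (h4.trans ?_)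
  rw [Matrix.smul_mul]
  exact (mul_neg _ _).symm

/-- The derivatives of a vector lift along a horizontal section, in the frame of a global
section. -/
def osculatingFrame (σ s : P.LocalSection) (w : C → Fin n → ℝ) (e : OpenPartialHomeomorph C ℝ)
    (t : ℝ) : Mat n :=
  (transition σ s (e.symm t)).1 *
    Matrix.of fun i k : Fin n => iteratedDeriv (k : ℕ) (fun t => w (e.symm t) i) t

theorem osculatingFrame_eq (σ s : P.LocalSection) (w : C → Fin n → ℝ)
    {e : OpenPartialHomeomorph C ℝ} {x : C} (hx : x ∈ e.source) :
    osculatingFrame σ s w e (e x) = (transition σ s x).1 * wronskian e w x := by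
  rw [osculatingFrame, e.left_inv hx]
  rfl

/-- Leibniz rule with H' = −aH: the derivative of H w⁽ᵏ⁾ is H w⁽ᵏ⁺¹⁾ − a H w⁽ᵏ⁾. Here a is the
connection coefficient in the coordinate, a positive multiple of `connMat`. -/
theorem hasDerivAt_osculatingFrame {θ : P.Connection} {σ : P.LocalSection} (hσ : ∀ x, x ∈ σ.dom)
    {s : P.LocalSection} (hs : θ.IsHorizontal s) {w : C → Fin n → ℝ}
    (hw : ∀ i, ContMDiffOn 𝓘(ℝ, ℝ) 𝓘(ℝ, ℝ) ∞ (fun x => w x i) s.dom)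
    {e : OpenPartialHomeomorph C ℝ} (he : e ∈ atlas ℝ C) {t : ℝ}
    (ht : t ∈ e.target ∩ e.symm ⁻¹' (s.dom : Set C)) (i k k' : Fin n) (hk : (k' : ℕ) = k + 1) :
    HasDerivAt (fun r => osculatingFrame σ s w e r i k) (osculatingFrame σ s w e t i k' -
      ((formCoeff e posForm t • connMat θ σ (e.symm t)) * osculatingFrame σ s w e t) i k) t := by
  have hsm := (matSmoothOn_transition σ s).mono (V := (s.dom : Set C)) fun x hx => ⟨hσ x, hx⟩
  have h1 := fun j => hsm.hasDerivAt s.dom.isOpen he ht.1 ht.2 i j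
  have h2 := fun j => hasDerivAt_iteratedDeriv (e.isOpen_inter_preimage_symm s.dom.isOpen)
    ((contMDiffOn_iff_charts s.dom.isOpen).1 (hw j) e he) ht k
  rw [(isHorizontal_iff_matD θ hσ s).1 hs _ ht.2] at h1
  have h3 := HasDerivAt.fun_sum (u := Finset.univ) fun j _ => (h1 j).mul (h2 j)
  refine h3.congr_deriv ?_
  rw [Finset.sum_add_distrib, add_comm, sub_eq_add_neg]
  congr 1
  · rw [osculatingFrame, Matrix.mul_apply]
    simp only [Matrix.of_apply, hk]
  · rw [osculatingFrame, ← Matrix.mul_assoc, Matrix.smul_mul, Matrix.mul_apply,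
      ← Finset.sum_neg_distrib]
    refine Finset.sum_congr rfl fun j _ => ?_
    simp only [Matrix.of_apply, Matrix.neg_apply, Matrix.smul_apply, smul_eq_mul]
    ring

variable [NeZero n] {τ : P.SphereMap}

theorem osculatingFrame_firstColumn {σ s : P.LocalSection} {w : C → Fin n → ℝ}
    (hw : τ.IsVectorLift s w) {x : C} (hσx : x ∈ σ.dom) (hx : x ∈ s.dom)
    (hτ : τ.toFun (σ.toFun x) = baseRay n) :
    0 < (transition σ s x).1.mulVec (w x) 0 ∧
      ∀ i, i ≠ 0 → (transition σ s x).1.mulVec (w x) i = 0 := by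
  obtain ⟨h0, h1⟩ := hw.2 x hx
  rw [← transition_smul σ s hσx hx, τ.equivariant, hτ, actRay_inv_eq_iff, actRay_rayOfNeZero] at h1
  exact (rayOfNeZero_eq_baseRay_iff _).1 h1.symm

theorem FlagLift.adapted_ray (f : FlagLift τ) {q : Q} (h : f.toFun q = flagOf 1 (by simp)) :
    τ.toFun q = baseRay n := by
  rw [← f.lifts, h, flagRay_one]

theorem isPosUpper_osculatingFrame {θ : P.Connection} {σ : P.LocalSection} (hσ : ∀ x, x ∈ σ.dom)
    (hτ : ∀ x, τ.toFun (σ.toFun x) = baseRay n) (hA : ∀ x, IsPosHessenberg (connMat θ σ x))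
    {s : P.LocalSection} (hs : θ.IsHorizontal s) {w : C → Fin n → ℝ} (hw : τ.IsVectorLift s w)
    {e : OpenPartialHomeomorph C ℝ} (he : e ∈ atlas ℝ C) {x : C} (hx : x ∈ s.dom)
    (hxe : x ∈ e.source) : IsPosUpper ((transition σ s x).1 * wronskian e w x) := by
  have hcol : ∀ t i, osculatingFrame σ s w e t i 0 =
      (transition σ s (e.symm t)).1.mulVec (w (e.symm t)) i := by
    intro t i
    rw [osculatingFrame, Matrix.mul_apply]
    simp [Matrix.mulVec, dotProduct]
  rw [← osculatingFrame_eq σ s w hxe]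
  refine isPosUpper_of_isPosHessenberg (e.isOpen_inter_preimage_symm s.dom.isOpen)
    (fun t ht => hasDerivAt_osculatingFrame hσ hs hw.1 he ht)
    (fun t ht => (hA _).smul (formCoeff_posForm_pos he ht.1)) (fun t ht => ?_)
    (fun t ht i hi => ?_) (e x) ⟨e.map_source hxe, by
      rw [Set.mem_preimage, e.left_inv hxe]
      exact hx⟩
  · rw [hcol]
    exact (osculatingFrame_firstColumn hw (hσ _) ht.2 (hτ _)).1
  · rw [hcol]
    exact (osculatingFrame_firstColumn hw (hσ _) ht.2 (hτ _)).2 i hi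

theorem flag_section_eq {f : FlagLift τ} {σ s : P.LocalSection} {x : C} (hσx : x ∈ σ.dom)
    (hx : x ∈ s.dom) (hf : f.toFun (σ.toFun x) = flagOf 1 (by simp)) :
    f.toFun (s.toFun x) = flagOf ((transition σ s x)⁻¹).1 (SLn.det_pos _) := by
  rw [← transition_smul σ s hσx hx, f.equivariant, hf, actFlag_flagOf]
  exact flagOf_congr _ (Matrix.mul_one _)

/-- Along s the lift is the flag of H⁻¹, while the Wronskian is H⁻¹(HW) with HW upper triangular of
positive diagonal, so both define the same flag. -/
theorem isOsculatingLift_of_isPosHessenberg {θ : P.Connection} {f : FlagLift τ}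
    {σ : P.LocalSection} (hσ : ∀ x, x ∈ σ.dom)
    (hf : ∀ x, f.toFun (σ.toFun x) = flagOf 1 (by simp))
    (hA : ∀ x, IsPosHessenberg (connMat θ σ x)) : θ.IsOsculatingLift f := by
  intro s hs w hw e he x hx hxe
  have h1 := isPosUpper_osculatingFrame hσ (fun x => f.adapted_ray (hf x)) hA hs hw he hx hxe
  have h2 : 0 < (wronskian e w x).det := by
    have := h1.det_pos
    rwa [Matrix.det_mul, (transition σ s x).2, one_mul] at this
  refine ⟨h2, ?_⟩
  rw [flag_section_eq (hσ x) hx (hf x), flagOf_eq_iff]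
  refine ⟨_, h1, ?_⟩
  rw [← Matrix.mul_assoc, ← Matrix.SpecialLinearGroup.coe_mul, inv_mul_cancel,
    Matrix.SpecialLinearGroup.coe_one, Matrix.one_mul]

theorem Connection.IsOsculatingLift.isNondegenerate {θ : P.Connection} {f : FlagLift τ}
    (h : θ.IsOsculatingLift f) : θ.IsNondegenerate τ :=
  fun s hs w hw e he x hx hxe => (h s hs w hw e he x hx hxe).1

/-- Equality of flags says that HW is upper triangular with positive diagonal along a horizontal
section through x, and the recursion of its columns recovers A. -/
theorem isPosHessenberg_of_isOsculatingLift {θ : P.Connection} {f : FlagLift τ}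
    (h : θ.IsOsculatingLift f) {σ : P.LocalSection} (hσ : ∀ x, x ∈ σ.dom)
    (hf : ∀ x, f.toFun (σ.toFun x) = flagOf 1 (by simp)) (x : C) :
    IsPosHessenberg (connMat θ σ x) := by
  obtain ⟨s, hx, hs⟩ := exists_isHorizontal θ hσ x
  obtain ⟨w, hw⟩ := τ.smooth s
  have hxe := mem_chart_source ℝ x
  have he := chart_mem_atlas ℝ x
  set e := chartAt ℝ x
  have hup : ∀ t ∈ e.target ∩ e.symm ⁻¹' (s.dom : Set C),
      IsPosUpper (osculatingFrame σ s w e t) := by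
    intro t ht
    obtain ⟨h1, h2⟩ := h s hs w hw e he (e.symm t) ht.2 (e.map_target ht.1)
    rw [flag_section_eq (hσ _) ht.2 (hf _), flagOf_eq_iff] at h2
    obtain ⟨b, hb, h3⟩ := h2
    have h4 := osculatingFrame_eq σ s w (e.map_target ht.1)
    rw [e.right_inv ht.1, h3, ← Matrix.mul_assoc, ← Matrix.SpecialLinearGroup.coe_mul,
      mul_inv_cancel, Matrix.SpecialLinearGroup.coe_one, Matrix.one_mul] at h4
    rwa [h4]
  have hmem : e x ∈ e.target ∩ e.symm ⁻¹' (s.dom : Set C) := ⟨e.map_source hxe, by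
    rw [Set.mem_preimage, e.left_inv hxe]
    exact hx⟩
  have := isPosHessenberg_of_isPosUpper (e.isOpen_inter_preimage_symm s.dom.isOpen)
    (fun t ht => hasDerivAt_osculatingFrame hσ hs hw.1 he ht) hup (e x) hmem
  rw [e.left_inv hxe] at this
  exact this.of_smul (formCoeff_posForm_pos he (e.map_source hxe))

end Horizontal

end PrincipalSLBundle

/-! ### Drinfeld–Sokolov reduction -/

section DrinfeldSokolov

/-- The nilpotent matrix with ones directly below the diagonal. -/
def shiftMat (n : ℕ) : Mat n := Matrix.of fun i j => if (i : ℕ) = j + 1 then 1 else 0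

theorem shiftMat_apply {n : ℕ} (i j : Fin n) :
    shiftMat n i j = if (i : ℕ) = j + 1 then 1 else 0 := rfl

theorem trace_shiftMat (n : ℕ) : (shiftMat n).trace = 0 :=
  Finset.sum_eq_zero fun i _ => if_neg (by simp)

theorem isPosHessenberg_shiftMat (n : ℕ) : IsPosHessenberg (shiftMat n) :=
  ⟨fun i j h => if_neg (by omega), fun i j h => by rw [shiftMat_apply, if_pos h]; exact one_pos⟩

theorem shiftMat_mul_apply {n : ℕ} (B : Mat n) {i i' : Fin n} (h : (i : ℕ) = i' + 1) (j : Fin n) :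
    (shiftMat n * B) i j = B i' j := by
  rw [Matrix.mul_apply, Finset.sum_eq_single i', shiftMat_apply, if_pos h, one_mul]
  · intro k _ hk
    rw [shiftMat_apply, if_neg, zero_mul]
    intro h'
    exact hk (Fin.ext (by omega))
  · simp

theorem mul_shiftMat_apply {n : ℕ} (B : Mat n) {j j' : Fin n} (h : (j' : ℕ) = j + 1) (i : Fin n) :
    (B * shiftMat n) i j = B i j' := by
  rw [Matrix.mul_apply, Finset.sum_eq_single j', shiftMat_apply, if_pos h, mul_one]
  · intro k _ hk
    rw [shiftMat_apply, if_neg, mul_zero]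
    intro h'
    exact hk (Fin.ext (by omega))
  · simp

theorem Fin.exists_val_eq_add_one {n : ℕ} [NeZero n] {i : Fin n} (hi : i ≠ 0) :
    ∃ i' : Fin n, (i : ℕ) = i' + 1 := by
  have : (i : ℕ) ≠ 0 := fun h => hi (Fin.ext h)
  exact ⟨⟨i - 1, by omega⟩, by simp only; omega⟩

variable {n : ℕ} {C : Type*} [TopologicalSpace C] [ChartedSpace ℝ C] [IsManifold 𝓘(ℝ, ℝ) ∞ C]
  [T2Space C] [CompactSpace C] [OrientedAtlas C]

theorem matD_apply_congr {f g : C → Mat n} {i j k l : Fin n} (h : ∀ y, f y i j = g y k l) (x : C) :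
    matD f x i j = matD g x k l := by
  have : (fun y => f y i j) = fun y => g y k l := funext h
  exact congrArg (fun φ : C → ℝ => (posForm x (unitVec x))⁻¹ *
    (show ℝ from mfderiv 𝓘(ℝ, ℝ) 𝓘(ℝ, ℝ) φ x (unitVec x))) this

theorem matD_apply_eq_zero {f : C → Mat n} {i j : Fin n} {c : ℝ} (h : ∀ y, f y i j = c) (x : C) :
    matD f x i j = 0 := by
  have := matD_apply_congr (g := fun _ => Matrix.of fun _ _ => c) (k := i) (l := j) h x
  rw [this, matD_const]
  rfl

/-- Iterates of `ρ ↦ ρ A - ρ'`, starting with multiples of the last basis row vector. All rows of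
these matrices are equal. -/
def rowIterate (A : C → Mat n) (μ : C → ℝ) : ℕ → C → Mat n
  | 0 => fun x => Matrix.of fun _ j => if (j : ℕ) + 1 = n then μ x else 0
  | m + 1 => fun x => rowIterate A μ m x * A x - matD (rowIterate A μ m) x

theorem rowIterate_row_eq (A : C → Mat n) (μ : C → ℝ) (m : ℕ) (x : C) (i i' j : Fin n) :
    rowIterate A μ m x i j = rowIterate A μ m x i' j := by
  induction m generalizing x j with
  | zero => rfl
  | succ m ih =>
    simp only [rowIterate, Matrix.sub_apply, Matrix.mul_apply]
    congr 1
    · exact Finset.sum_congr rfl fun k _ => by rw [ih]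
    · exact matD_apply_congr (fun y => ih y j) x

theorem matSmoothOn_rowIterate {A : C → Mat n} (hA : MatSmoothOn 𝓘(ℝ, ℝ) A Set.univ) {μ : C → ℝ}
    (hμ : ContMDiffOn 𝓘(ℝ, ℝ) 𝓘(ℝ, ℝ) ∞ μ Set.univ) (m : ℕ) :
    MatSmoothOn 𝓘(ℝ, ℝ) (rowIterate A μ m) Set.univ := by
  induction m with
  | zero =>
    intro i j
    simp only [rowIterate, Matrix.of_apply]
    split_ifs
    · exact hμ
    · exact contMDiffOn_const
  | succ m ih => exact fun i j => (ih.mul hA i j).sub (ih.matD isOpen_univ i j)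

/-- Multiplication by a Hessenberg matrix moves the support of a row at most one column to the left,
and differentiation does not enlarge it. -/
theorem rowIterate_apply_eq_zero {A : C → Mat n} (hA : ∀ x, IsPosHessenberg (A x)) (μ : C → ℝ)
    (m : ℕ) (x : C) (i j : Fin n) (h : (j : ℕ) + m + 1 < n) : rowIterate A μ m x i j = 0 := by
  induction m generalizing x j with
  | zero => exact if_neg (by omega)
  | succ m ih =>
    simp only [rowIterate, Matrix.sub_apply, Matrix.mul_apply]
    rw [matD_apply_eq_zero (fun y => ih y j (by omega)), sub_zero]
    refine Finset.sum_eq_zero fun k _ => ?_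
    by_cases hk : (k : ℕ) + m + 1 < n
    · rw [ih x k hk, zero_mul]
    · rw [(hA x).1 k j (by omega), mul_zero]

/-- In the newly reached column the previous iterate vanishes identically, so no derivative enters
and only a subdiagonal entry of A contributes. -/
theorem rowIterate_leading {A : C → Mat n} (hA : ∀ x, IsPosHessenberg (A x)) (μ : C → ℝ)
    (m : ℕ) (x : C) (i j j' : Fin n) (h : (j : ℕ) + m + 2 = n) (hj : (j' : ℕ) = j + 1) :
    rowIterate A μ (m + 1) x i j = rowIterate A μ m x i j' * A x j' j := by
  simp only [rowIterate, Matrix.sub_apply, Matrix.mul_apply]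
  rw [matD_apply_eq_zero (fun y => rowIterate_apply_eq_zero hA μ m y i j (by omega)), sub_zero]
  refine Finset.sum_eq_single j' (fun k _ hk => ?_) (by simp)
  have hk' : (k : ℕ) ≠ j' := fun h => hk (Fin.ext h)
  by_cases hkm : (k : ℕ) + m + 1 < n
  · rw [rowIterate_apply_eq_zero hA μ m x i k hkm, zero_mul]
  · rw [(hA x).1 k j (by omega), mul_zero]

theorem rowIterate_leading_pos {A : C → Mat n} (hA : ∀ x, IsPosHessenberg (A x)) {μ : C → ℝ}
    (hμ : ∀ x, 0 < μ x) (m : ℕ) (x : C) (i j : Fin n) (h : (j : ℕ) + m + 1 = n) :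
    0 < rowIterate A μ m x i j := by
  induction m generalizing j with
  | zero =>
    simp only [rowIterate, Matrix.of_apply]
    rw [if_pos (by omega)]
    exact hμ x
  | succ m ih =>
    rw [rowIterate_leading hA μ m x i j ⟨j + 1, by omega⟩ (by omega) rfl]
    exact mul_pos (ih _ (by simp only; omega)) ((hA x).2 _ _ rfl)

theorem rowIterate_leading_eq_mul {A : C → Mat n} (hA : ∀ x, IsPosHessenberg (A x)) (μ : C → ℝ)
    (m : ℕ) (x : C) (i j : Fin n) (h : (j : ℕ) + m + 1 = n) :
    rowIterate A μ m x i j = μ x * rowIterate A 1 m x i j := by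
  induction m generalizing j with
  | zero =>
    simp only [rowIterate, Matrix.of_apply]
    rw [if_pos (by omega), if_pos (by omega), Pi.one_apply, mul_one]
  | succ m ih =>
    rw [rowIterate_leading hA μ m x i j ⟨j + 1, by omega⟩ (by omega) rfl,
      rowIterate_leading hA 1 m x i j ⟨j + 1, by omega⟩ (by omega) rfl,
      ih _ (by simp only; omega), mul_assoc]

/-- The matrix whose rows are the successive iterates, from the last one to the first one. -/
def reductionMat (A : C → Mat n) (μ : C → ℝ) (x : C) : Mat n :=
  Matrix.of fun i j => rowIterate A μ (n - 1 - i) x i j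

theorem matSmoothOn_reductionMat {A : C → Mat n} (hA : MatSmoothOn 𝓘(ℝ, ℝ) A Set.univ) {μ : C → ℝ}
    (hμ : ContMDiffOn 𝓘(ℝ, ℝ) 𝓘(ℝ, ℝ) ∞ μ Set.univ) :
    MatSmoothOn 𝓘(ℝ, ℝ) (reductionMat A μ) Set.univ :=
  fun i j => matSmoothOn_rowIterate hA hμ (n - 1 - i) i j

theorem isPosUpper_reductionMat {A : C → Mat n} (hA : ∀ x, IsPosHessenberg (A x)) {μ : C → ℝ}
    (hμ : ∀ x, 0 < μ x) (x : C) : IsPosUpper (reductionMat A μ x) :=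
  ⟨fun i j h => rowIterate_apply_eq_zero hA μ _ x i j (by rw [Fin.lt_def] at h; omega),
    fun i => rowIterate_leading_pos hA hμ _ x i i (by omega)⟩

/-- Only diagonal entries matter, and they are linear in μ without derivatives of μ. Hence the
determinant can be normalized pointwise. -/
theorem det_reductionMat {A : C → Mat n} (hA : ∀ x, IsPosHessenberg (A x)) {μ : C → ℝ}
    (hμ : ∀ x, 0 < μ x) (x : C) :
    (reductionMat A μ x).det = μ x ^ n * (reductionMat A 1 x).det := by
  rw [Matrix.det_of_isUpperTriangular (isPosUpper_reductionMat hA hμ x).blockTriangular,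
    Matrix.det_of_isUpperTriangular
      (isPosUpper_reductionMat hA (μ := 1) (fun _ => one_pos) x).blockTriangular]
  have : μ x ^ n = ∏ _i : Fin n, μ x := by simp
  rw [this, ← Finset.prod_mul_distrib]
  exact Finset.prod_congr rfl fun i _ => rowIterate_leading_eq_mul hA μ _ x i i (by omega)

theorem reductionMat_row (A : C → Mat n) (μ : C → ℝ) (x : C) {i i' : Fin n} (h : (i : ℕ) = i' + 1)
    (j : Fin n) : (reductionMat A μ x * A x - matD (reductionMat A μ) x) i j =
      reductionMat A μ x i' j := by
  -- Rows are numbered from the bottom, so the row above is the next iterate.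
  have h1 : n - 1 - (i' : ℕ) = (n - 1 - i) + 1 := by omega
  have h2 : matD (reductionMat A μ) x i j = matD (rowIterate A μ (n - 1 - i)) x i j :=
    matD_apply_congr (fun _ => rfl) x
  rw [Matrix.sub_apply, h2, Matrix.mul_apply]
  simp only [reductionMat, Matrix.of_apply, h1]
  rw [rowIterate_row_eq A μ _ x i' i]
  simp only [rowIterate, Matrix.sub_apply, Matrix.mul_apply]

variable [NeZero n]

/-- The gauge transform `(g A - g') g⁻¹` agrees with the shift matrix outside the first row if and
only if each row of `g A - g'` other than the first one is the preceding row of `g`. -/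
theorem gauge_eq_shiftMat_iff (g : SLn n) (B : Mat n) (hB : (B * (g⁻¹).1).trace = 0) :
    (∀ i j, (i ≠ 0 ∨ j = 0) → (B * (g⁻¹).1) i j = shiftMat n i j) ↔
      ∀ i i' : Fin n, (i : ℕ) = i' + 1 → ∀ j, B i j = g.1 i' j := by
  have hgg : (g⁻¹).1 * g.1 = 1 := by
    rw [← Matrix.SpecialLinearGroup.coe_mul, inv_mul_cancel, Matrix.SpecialLinearGroup.coe_one]
  have hgg' : g.1 * (g⁻¹).1 = 1 := by
    rw [← Matrix.SpecialLinearGroup.coe_mul, mul_inv_cancel, Matrix.SpecialLinearGroup.coe_one]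
  constructor
  · intro h i i' hi j
    have hi0 : i ≠ 0 := by
      rintro rfl
      simp at hi
    calc B i j = (B * (g⁻¹).1 * g.1) i j := by rw [Matrix.mul_assoc, hgg, Matrix.mul_one]
      _ = (shiftMat n * g.1) i j := by
        rw [Matrix.mul_apply, Matrix.mul_apply]
        exact Finset.sum_congr rfl fun k _ => by rw [h i k (Or.inl hi0)]
      _ = g.1 i' j := shiftMat_mul_apply _ hi j
  · intro h
    have h1 : ∀ i, i ≠ 0 → ∀ j, (B * (g⁻¹).1) i j = shiftMat n i j := by
      intro i hi j
      obtain ⟨i', hi'⟩ := Fin.exists_val_eq_add_one hi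
      calc (B * (g⁻¹).1) i j = (shiftMat n * g.1 * (g⁻¹).1) i j := by
            rw [Matrix.mul_apply, Matrix.mul_apply]
            exact Finset.sum_congr rfl fun k _ => by
              rw [h i i' hi' k, shiftMat_mul_apply _ hi']
        _ = shiftMat n i j := by rw [Matrix.mul_assoc, hgg', Matrix.mul_one]
    intro i j hij
    by_cases hi : i = 0
    · obtain rfl := hi
      obtain rfl := hij.resolve_left (fun h => h rfl)
      -- The upper left entry is not covered by the row condition; it follows since both traces
      -- vanish and the other diagonal entries agree.
      have h2 := hB.trans (trace_shiftMat n).symm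
      simp only [Matrix.trace, Matrix.diag_apply] at h2
      rw [← Finset.add_sum_erase Finset.univ _ (Finset.mem_univ (0 : Fin n)),
        ← Finset.add_sum_erase Finset.univ (fun i => shiftMat n i i)
          (Finset.mem_univ (0 : Fin n)),
        Finset.sum_congr rfl fun k hk => h1 k (Finset.ne_of_mem_erase hk) k] at h2
      exact add_right_cancel h2
    · exact h1 i hi j

theorem trace_gauge {g : C → SLn n} (hg : MatSmoothOn 𝓘(ℝ, ℝ) (fun x => (g x).1) Set.univ)
    {A : Mat n} (hA : A.trace = 0) (x : C) :
    (((g x).1 * A - matD (fun y => (g y).1) x) * ((g x)⁻¹).1).trace = 0 := by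
  rw [Matrix.sub_mul, Matrix.trace_sub, Matrix.trace_mul_comm, ← Matrix.mul_assoc,
    ← Matrix.SpecialLinearGroup.coe_mul, inv_mul_cancel, Matrix.SpecialLinearGroup.coe_one,
    Matrix.one_mul, hA, Matrix.trace_mul_comm, trace_matD isOpen_univ hg (Set.mem_univ x), sub_zero]

/-- Every connection matrix which is upper Hessenberg with positive subdiagonal can be brought to
the normal form by an upper triangular gauge transformation. -/
theorem exists_reduction {A : C → Mat n} (hA : MatSmoothOn 𝓘(ℝ, ℝ) A Set.univ)
    (htr : ∀ x, (A x).trace = 0) (hpos : ∀ x, IsPosHessenberg (A x)) :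
    ∃ g : C → SLn n, MatSmoothOn 𝓘(ℝ, ℝ) (fun x => (g x).1) Set.univ ∧
      (∀ x, IsPosUpper (g x).1) ∧ ∀ x i j, (i ≠ 0 ∨ j = 0) →
        (((g x).1 * A x - matD (fun y => (g y).1) x) * ((g x)⁻¹).1) i j = shiftMat n i j := by
  have hone : MatSmoothOn 𝓘(ℝ, ℝ) (reductionMat A 1) Set.univ :=
    matSmoothOn_reductionMat hA contMDiffOn_const
  have hd : ∀ x, 0 < (reductionMat A 1 x).det := fun x =>
    (isPosUpper_reductionMat hpos (μ := 1) (fun _ => one_pos) x).det_pos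
  -- The solution of μⁿ det = 1 prescribed by `det_reductionMat`.
  set μ : C → ℝ := fun x => (reductionMat A 1 x).det ^ (-(1 / (n : ℝ))) with hμdef
  have hμ : ∀ x, 0 < μ x := fun x => Real.rpow_pos_of_pos (hd x) _
  have hμs : ContMDiffOn 𝓘(ℝ, ℝ) 𝓘(ℝ, ℝ) ∞ μ Set.univ := by
    rw [contMDiffOn_iff_charts isOpen_univ]
    intro e he
    exact ((contMDiffOn_iff_charts isOpen_univ).1 hone.det e he).rpow_const_of_ne
      fun t _ => (hd _).ne'
  have hdet : ∀ x, (reductionMat A μ x).det = 1 := by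
    intro x
    have hn : (n : ℝ) ≠ 0 := Nat.cast_ne_zero.2 (NeZero.ne n)
    rw [det_reductionMat hpos hμ, hμdef, ← Real.rpow_natCast, ← Real.rpow_mul (hd x).le]
    have : -(1 / (n : ℝ)) * n = -1 := by field_simp
    rw [this, Real.rpow_neg_one, inv_mul_cancel₀ (hd x).ne']
  let g : C → SLn n := fun x => ⟨reductionMat A μ x, hdet x⟩
  have hg : MatSmoothOn 𝓘(ℝ, ℝ) (fun x => (g x).1) Set.univ := matSmoothOn_reductionMat hA hμs
  refine ⟨g, hg, fun x => isPosUpper_reductionMat hpos hμ x, fun x => ?_⟩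
  rw [gauge_eq_shiftMat_iff _ _ (trace_gauge hg (htr x) x)]
  exact fun i i' h j => reductionMat_row A μ x h j

/-- The stabilizer of the normal form is trivial. -/
theorem eq_one_of_fixes_shiftMat {g : C → SLn n}
    (hg : MatSmoothOn 𝓘(ℝ, ℝ) (fun x => (g x).1) Set.univ)
    (hfix : ∀ x, actRay (g x) (baseRay n) = baseRay n)
    (h : ∀ x i j, (i ≠ 0 ∨ j = 0) →
      (((g x).1 * shiftMat n - matD (fun y => (g y).1) x) * ((g x)⁻¹).1) i j = shiftMat n i j)
    (x : C) : g x = 1 := by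
  have hrow : ∀ x, ∀ i i' : Fin n, (i : ℕ) = i' + 1 → ∀ j,
      ((g x).1 * shiftMat n - matD (fun y => (g y).1) x) i j = (g x).1 i' j := fun x =>
    (gauge_eq_shiftMat_iff (g x) _ (trace_gauge hg (trace_shiftMat n) x)).1 (h x)
  have hbase : ∀ x, 0 < (g x).1 0 0 ∧ ∀ i, i ≠ 0 → (g x).1 i 0 = 0 := fun x =>
    (actRay_baseRay_iff _).1 (hfix x)
  -- From left to right: where column j vanishes identically, the row relation reads g(i, j+1) =
  -- g(i−1, j). The zeros below the diagonal and the diagonal value propagate from the first column.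
  have hcol : ∀ m : ℕ, ∀ j : Fin n, (j : ℕ) = m → ∀ x, (∀ i, j < i → (g x).1 i j = 0) ∧
      (g x).1 j j = (g x).1 0 0 := by
    intro m
    induction m with
    | zero =>
      intro j hj x
      obtain rfl : j = 0 := Fin.ext hj
      exact ⟨fun i hi => (hbase x).2 i hi.ne', rfl⟩
    | succ m ih =>
      intro j' hj' x
      let j : Fin n := ⟨m, by omega⟩
      have hj := ih j rfl
      have hstep : ∀ i i' : Fin n, (i : ℕ) = i' + 1 → j < i → (g x).1 i j' = (g x).1 i' j := by
        intro i i' hi hlt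
        rw [← hrow x i i' hi j, Matrix.sub_apply, mul_shiftMat_apply _ hj',
          matD_apply_eq_zero (fun y => (hj y).1 i hlt), sub_zero]
      constructor
      · intro i hi
        rw [Fin.lt_def] at hi
        rw [hstep i ⟨i - 1, by omega⟩ (by simp only; omega) (by
          rw [Fin.lt_def]; simp only [j]; omega)]
        exact (hj x).1 _ (by rw [Fin.lt_def]; simp only [j]; omega)
      · rw [hstep j' j hj' (by rw [Fin.lt_def]; simp only [j]; omega)]
        exact (hj x).2
  -- The constant diagonal value is positive and its n-th power is det g = 1.
  have hdiag : ∀ x i, (g x).1 i i = 1 := by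
    have h0 : ∀ x, (g x).1 0 0 = 1 := by
      intro x
      have hup : (g x).1.BlockTriangular id := fun i j hij => (hcol j j rfl x).1 i hij
      have h1 := (g x).2
      rw [Matrix.det_of_isUpperTriangular hup,
        Finset.prod_congr rfl fun (i : Fin n) _ => (hcol i i rfl x).2] at h1
      simp only [Finset.prod_const, Finset.card_univ, Fintype.card_fin] at h1
      exact (pow_eq_one_iff_of_nonneg (hbase x).1.le (NeZero.ne n)).1 h1
    exact fun x i => ((hcol i i rfl x).2).trans (h0 x)
  -- From the bottom up: the last row is a constant basis covector, its derivative vanishes, and the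
  -- shift matrix carries it to the basis covector of the row above.
  have hrows : ∀ m : ℕ, ∀ i : Fin n, (i : ℕ) + m + 1 = n → ∀ x j,
      (g x).1 i j = (1 : Mat n) i j := by
    intro m
    induction m with
    | zero =>
      intro i hi x j
      by_cases hij : j = i
      · subst hij
        rw [hdiag, Matrix.one_apply_eq]
      · have hne : (j : ℕ) ≠ i := fun h => hij (Fin.ext h)
        rw [Matrix.one_apply_ne (Ne.symm hij)]
        exact (hcol j j rfl x).1 i (by rw [Fin.lt_def]; omega)
    | succ m ih =>
      intro i' hi' x j
      let i : Fin n := ⟨i' + 1, by omega⟩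
      have hi := ih i (by simp only [i]; omega)
      rw [← hrow x i i' rfl j, Matrix.sub_apply, matD_apply_eq_zero (fun y => hi y j), sub_zero,
        Matrix.mul_apply, Finset.sum_congr rfl fun k _ => by rw [hi x k], ← Matrix.mul_apply,
        Matrix.one_mul, shiftMat_apply, Matrix.one_apply]
      have : ((i : ℕ) = j + 1) ↔ i' = j := by
        rw [Fin.ext_iff]
        simp only [i]
        omega
      simp only [this]
  refine Subtype.ext ?_
  ext i j
  exact hrows (n - 1 - i) i (by omega) x j

end DrinfeldSokolov

/-! ### Positive connections and the orbit of the normal form -/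

theorem IsPosUpper.actRay_baseRay {n : ℕ} [NeZero n] {g : SLn n} (hg : IsPosUpper g.1) :
    actRay g (baseRay n) = baseRay n :=
  (actRay_baseRay_iff g).2 ⟨hg.2 0, fun i hi => hg.1 i 0 (Fin.pos_iff_ne_zero.2 hi)⟩

theorem MatSmoothOn.slice {n : ℕ} {C : Type*} [TopologicalSpace C] [ChartedSpace ℝ C]
    {f : ℝ × C → Mat n} (hf : MatSmoothOn (𝓘(ℝ, ℝ).prod 𝓘(ℝ, ℝ)) f Set.univ) (s : ℝ) :
    MatSmoothOn 𝓘(ℝ, ℝ) (fun x => f (s, x)) Set.univ := fun i j =>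
  (hf i j).comp (contMDiff_const.prodMk contMDiff_id).contMDiffOn fun _ _ => Set.mem_univ _

namespace PrincipalSLBundle

section Positive

variable {n : ℕ} [NeZero n] {C Q : Type*} [TopologicalSpace C] [ChartedSpace ℝ C]
  [MulAction (SLn n)ᵐᵒᵖ Q] {P : PrincipalSLBundle n C Q} {τ : P.SphereMap}

/-- The composition of a lift of `τ` with a gauge transformation fixing `τ`. -/
def FlagLift.comp (f : FlagLift τ) (u : P.GauFix τ) : FlagLift τ where
  toFun q := f.toFun (u.1.1 q)
  equivariant g q := by rw [u.1.2.2.1, f.equivariant]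
  lifts q := by rw [f.lifts, u.2]
  smooth σ := f.smooth (σ.map u.1)

theorem FlagLift.comp_section (f : FlagLift τ) (u : P.GauFix τ) (σ : P.LocalSection) (x : C) :
    (f.comp u).toFun (σ.toFun x) = actFlag (gaugeFun u.1 σ x)⁻¹ (f.toFun (σ.toFun x)) := by
  rw [← f.equivariant, gaugeFun_smul]
  rfl

theorem FlagLift.Homotopic.refl (f : FlagLift τ) : f.Homotopic f := by
  refine ⟨fun _ => f, rfl, rfl, fun σ => ?_⟩
  obtain ⟨A, hA, h⟩ := f.smooth σ
  exact ⟨fun p => A p.2, fun i j => (hA i j).comp contMDiffOn_snd fun p hp => hp.2,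
    fun _ x hx => h x hx⟩

/-- Compose the homotopy with the path joining 1 to u, using the same parameter. -/
theorem FlagLift.Homotopic.comp {f f' : FlagLift τ} (h : f.Homotopic f') {u : P.GauFix τ}
    (hu : u ∈ P.GauO τ) : f.Homotopic (f'.comp u) := by
  obtain ⟨F, hF0, hF1, hF⟩ := h
  obtain ⟨U, hU0, hU1, hU⟩ := hu
  refine ⟨fun s => (F s).comp (U s), ?_, ?_, fun σ => ?_⟩
  · simp only [hF0, hU0]
    rfl
  · simp only [hF1, hU1]
  · obtain ⟨A, hA, hAF⟩ := hF σ
    refine ⟨fun p => ((gaugeFun (U p.1).1 σ p.2)⁻¹).1 * A p, (hU σ).inv.mul hA, fun s x hx => ?_⟩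
    obtain ⟨h1, h2⟩ := hAF s x hx
    refine ⟨SLn.det_mul_pos _ h1, ?_⟩
    rw [FlagLift.comp_section, h2]
    rfl

/-- Naturality: u⁻¹ carries horizontal sections of u • θ to horizontal sections of θ, and the vector
lifts of τ along them are the same. -/
theorem Connection.IsOsculatingLift.comp {θ : P.Connection} {f : FlagLift τ}
    (h : θ.IsOsculatingLift f) (u : P.GauFix τ) : (u • θ).IsOsculatingLift (f.comp u⁻¹) := by
  intro s hs w hw e he x hx hxe
  refine h (s.map u⁻¹.1) hs w ⟨hw.1, fun y hy => ?_⟩ e he x hx hxe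
  obtain ⟨h0, h1⟩ := hw.2 y hy
  exact ⟨h0, (u⁻¹.2 _).trans h1⟩

/-- The identity component of the gauge group fixing `τ` acts transitively on a homotopy class
of lifts of `τ`. -/
theorem FlagLift.Homotopic.exists_gauge {f f' : FlagLift τ} (h : f.Homotopic f')
    {σ : P.LocalSection} (hσ : ∀ x, x ∈ σ.dom) (hf : ∀ x, f.toFun (σ.toFun x) = flagOf 1 (by simp)) :
    ∃ u ∈ P.GauO τ, ∀ x, (f'.comp u).toFun (σ.toFun x) = flagOf 1 (by simp) := by
  obtain ⟨F, rfl, rfl, hF⟩ := h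
  obtain ⟨A, hA, hAF⟩ := hF σ
  have hτ : ∀ x, τ.toFun (σ.toFun x) = baseRay n := fun x => by
    rw [← (F 0).lifts, hf, flagRay_one]
  have hA' : MatSmoothOn (𝓘(ℝ, ℝ).prod 𝓘(ℝ, ℝ)) A Set.univ := hA.mono fun p _ => ⟨trivial, hσ p.2⟩
  have hpos : ∀ p, 0 < (A p).det := fun p => (hAF p.1 p.2 (hσ p.2)).1
  set B : ℝ × C → SLn n := fun p => slNormalize (A p) with hBdef
  have hB : MatSmoothOn (𝓘(ℝ, ℝ).prod 𝓘(ℝ, ℝ)) (fun p => (B p).1) Set.univ :=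
    hA'.slNormalize fun p _ => hpos p
  have hBF : ∀ s x, (F s).toFun (σ.toFun x) = flagOf (B (s, x)).1 (B (s, x)).det_pos := fun s x => by
    rw [hBdef, flagOf_slNormalize (hpos _)]
    exact (hAF s x (hσ x)).2
  have hBray : ∀ s x, actRay (B (s, x)) (baseRay n) = baseRay n := fun s x => by
    rw [← flagRay_one, ← flagRay_actFlag, actFlag_flagOf]
    refine Eq.trans ?_ ((hτ x).trans flagRay_one.symm)
    rw [← (F s).lifts, hBF]
    exact congrArg flagRay (flagOf_congr _ (Matrix.mul_one _))
  -- The correction on the right makes the path start at 1. At the end, G⁻¹B = B(0, ·) represents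
  -- the initial flag, which is standard.
  set G : ℝ × C → SLn n := fun p => B p * (B (0, p.2))⁻¹ with hGdef
  have hG : MatSmoothOn (𝓘(ℝ, ℝ).prod 𝓘(ℝ, ℝ)) (fun p => (G p).1) Set.univ := by
    have h0 : MatSmoothOn (𝓘(ℝ, ℝ).prod 𝓘(ℝ, ℝ)) (fun p : ℝ × C => (B (0, p.2)).1) Set.univ :=
      fun i j => ((hB.slice 0) i j).comp contMDiffOn_snd fun _ _ => Set.mem_univ _
    exact (hB.mul h0.inv).congr fun p _ => rfl
  have hGray : ∀ s x, actRay (G (s, x)) (baseRay n) = baseRay n := fun s x => by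
    have : actRay (B (0, x))⁻¹ (baseRay n) = baseRay n := by
      rw [actRay_inv_eq_iff, hBray]
    rw [hGdef, actRay_mul, this, hBray]
  refine ⟨_, gaugeFixOf_mem_GauO σ hσ hτ G hG (fun s => hG.slice s) hGray fun x =>
    mul_inv_cancel _, fun x => ?_⟩
  rw [FlagLift.comp_section, ← hf x, hBF, hBF, actFlag_flagOf]
  refine flagOf_congr _ ?_
  have : gaugeFun (gaugeFixOf (τ := τ) σ hσ hτ (fun x => G (1, x)) (hG.slice 1) (hGray 1)).1 σ x =
    G (1, x) := gaugeFun_gaugeOf hσ _ x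
  rw [this, ← Matrix.SpecialLinearGroup.coe_mul]
  simp only [hGdef, mul_inv_rev, inv_inv, inv_mul_cancel_right]

/-- Upper triangular gauge transformations belong to the identity component. -/
theorem gaugeFixOf_mem_GauO_of_isPosUpper {σ : P.LocalSection} (hσ : ∀ x, x ∈ σ.dom)
    (hτ : ∀ x, τ.toFun (σ.toFun x) = baseRay n) {g : C → SLn n}
    (hg : MatSmoothOn 𝓘(ℝ, ℝ) (fun x => (g x).1) Set.univ) (hup : ∀ x, IsPosUpper (g x).1) :
    gaugeFixOf σ hσ hτ g hg (fun x => (hup x).actRay_baseRay) ∈ P.GauO τ := by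
  -- The path has to be defined for all real parameters, while convexity needs weights in [0, 1];
  -- hence the smooth cutoff in place of the parameter itself.
  set M : ℝ × C → Mat n := fun p =>
    (1 - Real.smoothTransition p.1) • (1 : Mat n) + Real.smoothTransition p.1 • (g p.2).1 with hM
  have hMup : ∀ p, IsPosUpper (M p) := fun p => (IsPosUpper.one n).convex_combination (hup p.2)
    (Real.smoothTransition.nonneg _) (Real.smoothTransition.le_one _)
  have hχ : ContMDiffOn (𝓘(ℝ, ℝ).prod 𝓘(ℝ, ℝ)) 𝓘(ℝ, ℝ) ∞
      (fun p : ℝ × C => Real.smoothTransition p.1) Set.univ :=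
    Real.smoothTransition.contDiff.contMDiff.comp_contMDiffOn contMDiffOn_fst
  have hMs : MatSmoothOn (𝓘(ℝ, ℝ).prod 𝓘(ℝ, ℝ)) M Set.univ := fun i j =>
    ((contMDiffOn_const.sub hχ).mul contMDiffOn_const).add
      (hχ.mul ((hg i j).comp contMDiffOn_snd fun _ _ => Set.mem_univ _))
  have hG := hMs.slNormalize fun p _ => (hMup p).det_pos
  have h1 : (fun x => slNormalize (M (1, x))) = g := funext fun x => by
    simp only [hM, Real.smoothTransition.one, sub_self, zero_smul, one_smul, zero_add,
      slNormalize_sl]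
  have h := gaugeFixOf_mem_GauO σ hσ hτ (fun p => slNormalize (M p)) hG (fun s => hG.slice s)
    (fun s x => (hMup (s, x)).slNormalize.actRay_baseRay) fun x => by
      simp only [hM, Real.smoothTransition.zero, sub_zero, zero_smul, one_smul, add_zero,
        slNormalize_one]
  simpa only [h1] using h

variable [IsManifold 𝓘(ℝ, ℝ) ∞ C] [OrientedAtlas C] [T2Space C] [CompactSpace C]

theorem momentMap_gauO_smul (u : P.GauO τ) (θ : P.Connection) :
    u • momentMap τ θ = momentMap τ (u.1.1 • θ) := rfl

end Positive

end PrincipalSLBundle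

/-! ### The image as a single orbit, and freeness. -/

open PrincipalSLBundle in
-- A positive connection is first moved so that its osculating lift is standard along σ, then
-- reduced to the shift matrix; both moves lie in the identity component. Conversely, the osculating
-- lift of u • θ₀ is the given lift composed with u⁻¹, which stays in its homotopy class.
theorem momentMap_image_eq_orbit {n : ℕ} [NeZero n]
    {C : Type*} [TopologicalSpace C] [ChartedSpace ℝ C] [IsManifold 𝓘(ℝ, ℝ) ∞ C]
    [OrientedAtlas C] [T2Space C] [CompactSpace C]
    {Q : Type*} [MulAction (SLn n)ᵐᵒᵖ Q] {P : PrincipalSLBundle n C Q}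
    {τ : P.SphereMap} (τhat : FlagLift τ) {σ : P.LocalSection} (hσ : ∀ x, x ∈ σ.dom)
    (hf : ∀ x, τhat.toFun (σ.toFun x) = flagOf 1 (by simp)) {θ₀ : P.Connection}
    (hθ₀ : ∀ x, connMat θ₀ σ x = shiftMat n) :
    momentMap τ '' {θ | θ.IsPositive τhat} = MulAction.orbit (P.GauO τ) (momentMap τ θ₀) := by
  have hτ : ∀ x, τ.toFun (σ.toFun x) = baseRay n := fun x => τhat.adapted_ray (hf x)
  apply Set.Subset.antisymm
  · rintro _ ⟨θ, ⟨-, f, hosc, hhom⟩, rfl⟩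
    obtain ⟨u, hu, huf⟩ := hhom.exists_gauge hσ hf
    have hosc' := hosc.comp u⁻¹
    rw [inv_inv] at hosc'
    set θ' : P.Connection := u⁻¹ • θ with hθ'
    have hA : MatSmoothOn 𝓘(ℝ, ℝ) (connMat θ' σ) Set.univ :=
      (matSmoothOn_connMat θ' σ).mono fun x _ => hσ x
    obtain ⟨g, hg, hup, hgA⟩ := exists_reduction hA (trace_connMat θ' σ)
      (isPosHessenberg_of_isOsculatingLift hosc' hσ huf)
    have hv := gaugeFixOf_mem_GauO_of_isPosUpper (τ := τ) hσ hτ hg hup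
    set v : P.GauFix τ := gaugeFixOf σ hσ hτ g hg (fun x => (hup x).actRay_baseRay) with hvdef
    have hvg : ∀ x, gaugeFun v.1 σ x = g x := gaugeFun_gaugeOf hσ hg
    have key : momentMap τ (v.1 • θ') = momentMap τ θ₀ := by
      rw [momentMap_eq_iff hσ hτ]
      intro x i j hij
      rw [connMat_smul _ _ _ (hσ x), hθ₀]
      simp only [hvg]
      exact hgA x i j hij
    -- Modulo the annihilator, v u⁻¹ θ equals θ₀, so θ equals u v⁻¹ θ₀.
    refine ⟨⟨u, hu⟩ * ⟨v, hv⟩⁻¹, ?_⟩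
    change ((⟨u, hu⟩ * ⟨v, hv⟩⁻¹ : P.GauO τ)) • momentMap τ θ₀ = momentMap τ θ
    have h1 : momentMap τ (v.1 • θ') =
        (⟨v, hv⟩ : P.GauO τ) • (⟨u, hu⟩ : P.GauO τ)⁻¹ • momentMap τ θ := rfl
    rw [← key, h1, mul_smul, inv_smul_smul, smul_inv_smul]
  · rintro _ ⟨u, rfl⟩
    have hosc : θ₀.IsOsculatingLift τhat := isOsculatingLift_of_isPosHessenberg hσ hf fun x => by
      rw [hθ₀]
      exact isPosHessenberg_shiftMat n
    have hosc' := hosc.comp u.1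
    exact ⟨u.1 • θ₀, ⟨hosc'.isNondegenerate, _, hosc',
      (FlagLift.Homotopic.refl τhat).comp (inv_mem u.2)⟩, rfl⟩

open PrincipalSLBundle in
theorem eq_one_of_smul_momentMap_eq {n : ℕ} [NeZero n]
    {C : Type*} [TopologicalSpace C] [ChartedSpace ℝ C] [IsManifold 𝓘(ℝ, ℝ) ∞ C]
    [OrientedAtlas C] [T2Space C] [CompactSpace C]
    {Q : Type*} [MulAction (SLn n)ᵐᵒᵖ Q] {P : PrincipalSLBundle n C Q}
    {τ : P.SphereMap} {σ : P.LocalSection} (hσ : ∀ x, x ∈ σ.dom)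
    (hτ : ∀ x, τ.toFun (σ.toFun x) = baseRay n) {θ₀ : P.Connection}
    (hθ₀ : ∀ x, connMat θ₀ σ x = shiftMat n) {u : P.GauO τ}
    (hu : u • momentMap τ θ₀ = momentMap τ θ₀) : u = 1 := by
  rw [momentMap_gauO_smul, momentMap_eq_iff hσ hτ] at hu
  have hg : MatSmoothOn 𝓘(ℝ, ℝ) (fun x => (gaugeFun u.1.1 σ x).1) Set.univ :=
    (matSmoothOn_gaugeFun u.1.1 σ).mono fun x _ => hσ x
  have h := eq_one_of_fixes_shiftMat hg (fun x => actRay_gaugeFun (hτ x) u.1) fun x i j hij => by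
    have := hu x i j hij
    rwa [connMat_smul _ _ _ (hσ x), hθ₀] at this
  refine Subtype.ext (Subtype.ext (Gau.ext_section hσ fun x => ?_))
  rw [h x]
  exact (gaugeFun_one σ x).symm

end

theorem mainTheorem7 (n : ℕ) [NeZero n] (hn : 2 ≤ n)
    {C : Type*} [TopologicalSpace C] [ChartedSpace ℝ C] [IsManifold 𝓘(ℝ, ℝ) ∞ C]
    [OrientedAtlas C] [T2Space C] [CompactSpace C] [ConnectedSpace C]
    {Q : Type*} [MulAction (SLn n)ᵐᵒᵖ Q] (P : PrincipalSLBundle n C Q)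
    (τ : P.SphereMap) (τhat : PrincipalSLBundle.FlagLift τ) :
    ∃ O : Set (PrincipalSLBundle.ReducedConnection τ),
      PrincipalSLBundle.momentMap τ '' {θ | θ.IsPositive τhat} = O ∧
      (∃ o : PrincipalSLBundle.ReducedConnection τ, O = MulAction.orbit (P.GauO τ) o) ∧
      ∀ u : P.GauO τ, ∀ o ∈ O, u • o = o → u = 1 := by
  obtain ⟨σ, hσ, hf⟩ := τhat.exists_global_adapted
  have hτ : ∀ x, τ.toFun (σ.toFun x) = baseRay n := fun x => τhat.adapted_ray (hf x)
  let θ₀ := PrincipalSLBundle.connectionOf σ hσ (fun _ => shiftMat n) (MatSmoothOn.const _ _)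
    fun _ => trace_shiftMat n
  have hθ₀ : ∀ x, PrincipalSLBundle.connMat θ₀ σ x = shiftMat n :=
    PrincipalSLBundle.connMat_connectionOf hσ _ _
  refine ⟨_, momentMap_image_eq_orbit τhat hσ hf hθ₀, ⟨_, rfl⟩, ?_⟩
  rintro u _ ⟨v, rfl⟩ huv
  -- Stabilizers along an orbit are conjugate, so triviality at the base point suffices.
  have h : (v⁻¹ * u * v) • PrincipalSLBundle.momentMap τ θ₀ =
      PrincipalSLBundle.momentMap τ θ₀ := by
    rw [mul_smul, mul_smul, inv_smul_eq_iff]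
    exact huv
  have := eq_one_of_smul_momentMap_eq hσ hτ hθ₀ h
  rwa [mul_assoc, inv_mul_eq_one, eq_comm, mul_eq_right] at this
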